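/- **Notation.** Let $\mathrm{Sp}(1,1)$ be the isometry group of the Hermitian form $\langle z,w\rangle=\bar w_2z_1+\bar w_1z_2$ on the right $\mathbb H$-space $\mathbb H^2$, acting on the quaternionic hyperbolic line $\mathbf H^1_{\mathbb H}$ (negative lines) and its boundary (null lines); $o=[0,1]^T$, $\infty=[1,0]^T$; the standard lift of a point $z\in\mathbb H$ is $(z,1)^T$, that of $\infty$ is $(1,0)^T$. An element is *hyperbolic* if it fixes exactly two boundary points, and *loxodromic* if moreover none of its right eigenvalues is real. For loxodromic $A$, $a_A$ and $r_A$ are the boundary fixed points belonging to the eigenvalue classes of modulus $<1$ and $>1$. The *real trace* is $tr_{\mathbb R}(A)=(a,b)$, where $x^4-ax^3+bx^2-ax+1$ is the characteristic polynomial of the complex $4\times4$ matrix of $A$. The *cross ratio* is $\mathbb X(A,B)=\langle z_3,z_1\rangle\langle z_3,z_2\rangle^{-1}\langle z_4,z_2\rangle\langle z_4,z_1\rangle^{-1}$ for lifts $z_1,\dots,z_4$ of $a_A,r_A,a_B,r_B$; its real part and modulus do not depend on the lifts. The *projective point* $p(A)\in\mathbb{CP}^1=\mathbb H^*/\mathbb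 C^*$ is the class of the $q$ with $A(vq)=(vq)\lambda$, where $v$ is the standard lift of $a_A$ and $\lambda$ is the complex eigenvalue representative with $\mathrm{Im}\,\lambda>0$. A pair is *irreducible* if it has no common fixed point in $\mathbf H^1_{\mathbb H}\cup\partial\mathbf H^1_{\mathbb H}$ and preserves no proper totally geodesic subspace of $\mathbf H^1_{\mathbb H}$. Let $g\ge2$, let $\Sigma_g$ be the closed orientable surface of genus $g$ with a system of $3g-3$ curves $\gamma_j$ that cuts it into $2g-2$ three-holed spheres $P_v$. Fix a spanning tree of the dual graph, and hence the description of $\pi_1(\Sigma_g)$ as the fundamental group of a graph of groups: $\pi_1(P_v)$ is generated by its boundary loops $c_{v,0},c_{v,1},c_{v,2}$ with $c_{v,0}c_{v,1}c_{v,2}=1$; if $\gamma_j$ is glued from boundary circles $x$ of $P_v$ and $y$ of $P_w$, there is an element $t_j$ with $t_jc_yt_j^{-1}=c_x^{-1}$, and $t_j=1$ on the tree. A representation $\rho:\pi_1(\Sigma_g)\to\mathrm{Sp}(1,1)$ is *geometric* if it is discrete and faithful, each $\rho(\gamma_j)$ is loxodromic, and each pair $(\rho(c_{v,0}),\rho(c_{v,1}))$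 is irreducible. *Fenchel–Nielsen coordinates of $\rho$.* For each $v$ choose $F_v\in\mathrm{Sp}(1,1)$ such that $(A_v,B_v)=F_v^{-1}(\rho(c_{v,0}),\rho(c_{v,1}))F_v$ is in the normal form $a_{A_v}=o$, $r_{A_v}=\infty$, $a_{B_v}=i$, $r_{B_v}\in\mathbb Ri+\mathbb R_{\ge0}j$ (generically $F_v$ is unique up to sign). For each $v$ take the ten real parameters $$tr_{\mathbb R}(A_v),\quad tr_{\mathbb R}(B_v),\quad \Re\,\mathbb X(A_v,B_v),\quad |\mathbb X(A_v,B_v)|,\quad p(A_v),\quad p(B_v).$$ For each curve $\gamma_j$, let $X=F_v^{-1}\rho(c_x)F_v$ and $Y=F_w^{-1}\rho(c_y)F_w$, let $R(X,Y)$ be an element, fixed once and for all as a function of $X$ and $Y$, with $R(X,Y)\,Y\,R(X,Y)^{-1}=X^{-1}$, and write $F_v^{-1}\rho(t_j)F_w=K_j\,R(X,Y)$; then $K_j$ commutes with $X$. Take the four real parameters of the twist-bend $K_j$, namely $\kappa_j=(s,\psi,k)$ with $s>0$, $\psi\in[0,\pi]$, $k=[q]\in\mathbb{CP}^1$ and $K_j(vq)=(vq)se^{i\psi}$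 for the standard lift $v$ of $a_X$ (with $k=p(X)$ if $\psi\in\{0,\pi\}$). The two sides of $\gamma_j$ have the same real trace, and $k$ is $p(X)$ or its antipode, which makes four real constraints for each curve: $10(2g-2)+4(3g-3)-4(3g-3)=20g-20$. **Theorem.** Let $g\ge 2$, a curve system on $\Sigma_g$ and a function $R$ be given as above. 1. Every geometric representation $\rho:\pi_1(\Sigma_g)\to\mathrm{Sp}(1,1)$ has Fenchel–Nielsen coordinates. 2. Two geometric representations are conjugate in $\mathrm{Sp}(1,1)$ if and only if they have a common system of Fenchel–Nielsen coordinates; and conjugate geometric representations have the same systems of Fenchel–Nielsen coordinates. 3. Exactly $20g-20$ real parameters are needed: the class of each geometric representation has an open neighbourhood in the deformation space $\mathrm{Hom}(\pi_1(\Sigma_g),\mathrm{Sp}(1,1))/\mathrm{Sp}(1,1)$ (quotient of the topology of pointwise convergence) that is homeomorphic to an open subset of $\mathbb R^{20g-20}$. -/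

import Mathlib

open scoped Quaternion Matrix

noncomputable section

namespace SpOneOne

/-! ### The Hermitian form of signature `(1,1)` and its isometry group -/

/-- Column vectors over the quaternions, a right `ℍ`-space on which matrices act from the left. -/
abbrev Vec : Type := Fin 2 → ℍ[ℝ]

/-- The vector `v q` (right multiplication by a scalar). -/
def rmul (v : Vec) (q : ℍ[ℝ]) : Vec := fun i => v i * q

/-- `⟨z, w⟩ = w̄₂ z₁ + w̄₁ z₂`. -/
def herm (z w : Vec) : ℍ[ℝ] := star (w 1) * z 0 + star (w 0) * z 1

/-- The group `Sp(1,1)` of all isometries of the Hermitian form, with the topology of matrices. -/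
def Sp11 : Subgroup (Matrix (Fin 2) (Fin 2) ℍ[ℝ])ˣ where
  carrier := {A | ∀ z w : Vec, herm (A.val *ᵥ z) (A.val *ᵥ w) = herm z w}
  one_mem' := by
    intro z w
    simp
  mul_mem' := by
    intro A B hA hB z w
    rw [Units.val_mul, ← Matrix.mulVec_mulVec, ← Matrix.mulVec_mulVec, hA, hB]
  inv_mem' := by
    intro A hA z w
    have h := hA (A⁻¹.val *ᵥ z) (A⁻¹.val *ᵥ w)
    rw [Matrix.mulVec_mulVec, Matrix.mulVec_mulVec, Units.mul_inv, Matrix.one_mulVec,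
      Matrix.one_mulVec] at h
    exact h.symm

/-- The linear action of `Sp(1,1)` on vectors. -/
def act (A : Sp11) (v : Vec) : Vec := A.val.val *ᵥ v

/-- The action of `A` as a right-linear map. -/
def toLin (A : Sp11) : Vec →ₗ[ℍ[ℝ]ᵐᵒᵖ] Vec where
  toFun := act A
  map_add' := fun v w => Matrix.mulVec_add _ v w
  map_smul' := fun q v => Matrix.mulVec_smul _ q v

theorem toLin_injective (A : Sp11) : Function.Injective (toLin A) := by
  intro v w h
  have h' : A.val⁻¹.val *ᵥ (A.val.val *ᵥ v) = A.val⁻¹.val *ᵥ (A.val.val *ᵥ w) :=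
    congrArg (fun u : Vec => A.val⁻¹.val *ᵥ u) h
  rwa [Matrix.mulVec_mulVec, Matrix.mulVec_mulVec, Units.inv_mul, Matrix.one_mulVec,
    Matrix.one_mulVec] at h'

/-! ### The quaternionic hyperbolic line and its boundary -/

/-- The quaternionic projective line of right lines in `Vec`. -/
abbrev HP1 : Type := Projectivization ℍ[ℝ]ᵐᵒᵖ Vec

/-- The action of `Sp(1,1)` on the projective line. -/
def move (A : Sp11) : HP1 → HP1 := Projectivization.map (toLin A) (toLin_injective A)

/-- The quaternionic hyperbolic line: the negative lines. -/
def hypSpace : Set HP1 := {p | (herm p.rep p.rep).re < 0}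

/-- Its ideal boundary: the null lines. -/
def bdry : Set HP1 := {p | herm p.rep p.rep = 0}

/-- A totally geodesic subset of the quaternionic hyperbolic line: it contains the complete
geodesic through any two of its points. If the lifts `x`, `y` of two points are chosen with
`⟨x, y⟩` real, that geodesic consists of the negative lines spanned by the real linear
combinations of `x` and `y`. -/
def IsTotallyGeodesic (S : Set HP1) : Prop :=
  S ⊆ hypSpace ∧
    ∀ (x y z : Vec) (hx : x ≠ 0) (hy : y ≠ 0) (hz : z ≠ 0) (r a b : ℝ),
      Projectivization.mk ℍ[ℝ]ᵐᵒᵖ x hx ∈ S → Projectivization.mk ℍ[ℝ]ᵐᵒᵖ y hy ∈ S →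
      herm x y = (r : ℍ[ℝ]) → z = a • x + b • y →
      Projectivization.mk ℍ[ℝ]ᵐᵒᵖ z hz ∈ hypSpace → Projectivization.mk ℍ[ℝ]ᵐᵒᵖ z hz ∈ S

/-- The pair `(A, B)` fixes no point of the closed hyperbolic line and preserves no proper
totally geodesic subspace. -/
def IsIrreduciblePair (A B : Sp11) : Prop :=
  (¬ ∃ p ∈ hypSpace ∪ bdry, move A p = p ∧ move B p = p) ∧
    ¬ ∃ S : Set HP1, S.Nonempty ∧ S ≠ hypSpace ∧ IsTotallyGeodesic S ∧
      move A '' S = S ∧ move B '' S = S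

/-! ### Hyperbolic and loxodromic elements -/

/-- Exactly two fixed points on the boundary. -/
def IsHyperbolic (A : Sp11) : Prop := {p | p ∈ bdry ∧ move A p = p}.ncard = 2

/-- Right eigenvalues. -/
def IsEigenvalue (A : Sp11) (μ : ℍ[ℝ]) : Prop := ∃ v : Vec, v ≠ 0 ∧ act A v = rmul v μ

/-- A hyperbolic element is loxodromic if it has no real eigenvalue. -/
def IsLoxodromic (A : Sp11) : Prop :=
  IsHyperbolic A ∧ ∀ μ, IsEigenvalue A μ → ∀ r : ℝ, μ ≠ (r : ℍ[ℝ])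

/-- `v` is a lift of the attracting fixed point `a_A`, the boundary fixed point that belongs
to the eigenvalue class of modulus less than `1`. -/
def IsAttracting (A : Sp11) (v : Vec) : Prop :=
  v ≠ 0 ∧ herm v v = 0 ∧ ∃ μ : ℍ[ℝ], ‖μ‖ < 1 ∧ act A v = rmul v μ

/-- `v` is a lift of the repelling fixed point `r_A`. -/
def IsRepelling (A : Sp11) (v : Vec) : Prop :=
  v ≠ 0 ∧ herm v v = 0 ∧ ∃ μ : ℍ[ℝ], 1 < ‖μ‖ ∧ act A v = rmul v μ

/-- Standard lifts: `(z, 1)` for a finite point, `(1, 0)` for the point `∞`. -/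
def IsStandard (v : Vec) : Prop := v 1 = 1 ∨ v = ![1, 0]

/-! ### Real trace, cross ratio, projective points -/

/-- Writing `q = z₁ + j z₂` with `z₁, z₂` complex, this is `z₁`. -/
def cpart (q : ℍ[ℝ]) : ℂ := ⟨q.re, q.imI⟩

/-- Writing `q = z₁ + j z₂` with `z₁, z₂` complex, this is `z₂`. -/
def jpart (q : ℍ[ℝ]) : ℂ := ⟨q.imJ, -q.imK⟩

/-- The embedding `A₁ + j A₂ ↦ [[A₁, -Ā₂], [A₂, Ā₁]]` into complex `4 × 4` matrices. -/
def complexify (M : Matrix (Fin 2) (Fin 2) ℍ[ℝ]) : Matrix (Fin 2 ⊕ Fin 2) (Fin 2 ⊕ Fin 2) ℂ :=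
  Matrix.fromBlocks (M.map cpart) (-(M.map fun q => star (jpart q)))
    (M.map jpart) (M.map fun q => star (cpart q))

/-- The real trace `(a, b)`, where the characteristic polynomial of the complexified matrix is
`x⁴ - a x³ + b x² - a x + 1`. -/
def realTrace (A : Sp11) : ℝ × ℝ :=
  (-((complexify A.val.val).charpoly.coeff 3).re, ((complexify A.val.val).charpoly.coeff 2).re)

/-- The Korányi–Reimann cross ratio of four lifts; its similarity class, given by its real part
and its modulus, does not depend on the lifts. -/
def crossRatio (z₁ z₂ z₃ z₄ : Vec) : ℍ[ℝ] :=
  herm z₃ z₁ * (herm z₃ z₂)⁻¹ * herm z₄ z₂ * (herm z₄ z₁)⁻¹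

/-- `X` represents the cross ratio `𝕏(A, B) = 𝕏(a_A, r_A, a_B, r_B)`. -/
def IsCrossRatio (A B : Sp11) (X : ℍ[ℝ]) : Prop :=
  ∃ z₁ z₂ z₃ z₄ : Vec, IsAttracting A z₁ ∧ IsRepelling A z₂ ∧ IsAttracting B z₃ ∧
    IsRepelling B z₄ ∧ X = crossRatio z₁ z₂ z₃ z₄

/-- The complex projective line `ℂℙ¹`, as the set of complex lines `q ℂ` in `ℍ = ℂ²`. -/
abbrev CP1 : Type :=
  ℍ[ℝ]ˣ ⧸ (Units.map (Quaternion.ofComplex : ℂ →ₐ[ℝ] ℍ[ℝ]).toMonoidHom).range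

/-- `k` is the projective point of `A`: the eigenspace of the attracting fixed point is
identified with `ℍ` through the standard lift `v`, and `k` is the complex line of all `q` for
which `v q` is an eigenvector for the complex representative `r e^{iθ}`, `0 < θ < π`, of the
eigenvalue class. -/
def IsProjectivePoint (A : Sp11) (k : CP1) : Prop :=
  ∃ (v : Vec) (q : ℍ[ℝ]ˣ) (μ : ℂ), IsAttracting A v ∧ IsStandard v ∧ 0 < μ.im ∧
    k = (q : CP1) ∧ act A (rmul v q) = rmul (rmul v q) (μ : ℍ[ℝ])

/-! ### Coordinates of a pair of loxodromic elements -/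

/-- The normal form of a pair under conjugation: `a_A = o`, `r_A = ∞`, `a_B = i` and `r_B = y`
in the closed half plane `ℝ i + ℝ_{≥0} j`. -/
def IsNormalized (A B : Sp11) : Prop :=
  ∃ y : ℍ[ℝ], y.re = 0 ∧ y.imK = 0 ∧ 0 ≤ y.imJ ∧
    IsAttracting A ![0, 1] ∧ IsRepelling A ![1, 0] ∧
    IsAttracting B ![((Complex.I : ℂ) : ℍ[ℝ]), 1] ∧ IsRepelling B ![y, 1]

/-- The ten real parameters of a pair: two real traces, the real part and the modulus of the
cross ratio, and two points of `ℂℙ¹`. -/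
structure PairCoord where
  trA : ℝ × ℝ
  trB : ℝ × ℝ
  reX : ℝ
  absX : ℝ
  pA : CP1
  pB : CP1

/-- `c` is the parameter system of the normalized pair `(A, B)`. -/
def IsPairCoord (A B : Sp11) (c : PairCoord) : Prop :=
  IsNormalized A B ∧ c.trA = realTrace A ∧ c.trB = realTrace B ∧
    (∃ X, IsCrossRatio A B X ∧ c.reX = X.re ∧ c.absX = ‖X‖) ∧
    IsProjectivePoint A c.pA ∧ IsProjectivePoint B c.pB

/-- The four real parameters of a twist-bend: `s > 0`, an angle `ψ`, and a point of `ℂℙ¹`. -/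
structure TwistBend where
  s : ℝ
  ψ : ℝ
  k : CP1

/-- `κ = (s, ψ, k)` are the parameters of the twist-bend `K` along the loxodromic `A`: `K`
commutes with `A`, it acts on the eigenline of `a_A` with eigenvalue `s e^{iψ}`, and `k` is the
projective point of this eigenvalue; where the eigenvalue is real, `k` is the projective point
of `A`. -/
def IsTwistBend (A K : Sp11) (κ : TwistBend) : Prop :=
  K * A = A * K ∧ 0 < κ.s ∧ 0 ≤ κ.ψ ∧ κ.ψ ≤ Real.pi ∧
    (∃ (v : Vec) (q : ℍ[ℝ]ˣ), IsAttracting A v ∧ IsStandard v ∧ κ.k = (q : CP1) ∧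
      act K (rmul v q) =
        rmul (rmul v q) (((κ.s : ℂ) * Complex.exp ((κ.ψ : ℂ) * Complex.I) : ℂ) : ℍ[ℝ])) ∧
    (Real.sin κ.ψ = 0 → IsProjectivePoint A κ.k)

/-! ### Surface groups and curve systems -/

/-- The fundamental group of the closed orientable surface of genus `g`:
`⟨a₁, b₁, …, a_g, b_g | [a₁, b₁] ⋯ [a_g, b_g]⟩`. -/
abbrev SurfaceGroup (g : ℕ) : Type :=
  PresentedGroup ({(List.ofFn fun i : Fin g =>
    FreeGroup.of (i, false) * FreeGroup.of (i, true) * (FreeGroup.of (i, false))⁻¹ *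
      (FreeGroup.of (i, true))⁻¹).prod} : Set (FreeGroup (Fin g × Bool)))

/-- The combinatorial type of a system of `3g - 3` curves that cuts the closed orientable
surface of genus `g` into `2g - 2` three-holed spheres. The boundary circles of the three-holed
spheres are the pairs `(v, k)`, and `sides` says which two of them are glued along each curve.
The dual graph has the three-holed spheres as vertices and the curves as edges; `tree` is a
spanning tree of it (a connected spanning subgraph with one edge less than it has vertices). -/
structure CurveSystem (g : ℕ) where
  sides : Fin (3 * g - 3) × Bool ≃ Fin (2 * g - 2) × Fin 3
  tree : Finset (Fin (3 * g - 3))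
  card_tree : tree.card + 1 = 2 * g - 2
  connected : ∀ v w, Relation.EqvGen
    (fun a b => ∃ j ∈ tree, (sides (j, false)).1 = a ∧ (sides (j, true)).1 = b) v w

namespace CurveSystem

variable {g : ℕ}

/-- The generators: `Sum.inl (v, k)` is the `k`-th boundary loop of the `v`-th three-holed
sphere, `Sum.inr j` is the loop (or, on the tree, the trivial path) that crosses the `j`-th
curve. -/
abbrev Gen (g : ℕ) : Type := (Fin (2 * g - 2) × Fin 3) ⊕ Fin (3 * g - 3)

/-- The relations of the fundamental group of the surface as the fundamental group of a graph of
groups: in each three-holed sphere the product of the three boundary loops is trivial, the two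
boundary loops along a curve are inverse to each other (with opposite boundary orientations)
after transport across the curve, and the transports along the tree are trivial. -/
def rels (P : CurveSystem g) : Set (FreeGroup (Gen g)) :=
  {r | ∃ v, r = FreeGroup.of (Sum.inl (v, 0)) * FreeGroup.of (Sum.inl (v, 1)) *
      FreeGroup.of (Sum.inl (v, 2))} ∪
  {r | ∃ j, r = FreeGroup.of (Sum.inr j) * FreeGroup.of (Sum.inl (P.sides (j, true))) *
      (FreeGroup.of (Sum.inr j))⁻¹ * FreeGroup.of (Sum.inl (P.sides (j, false)))} ∪
  {r | ∃ j ∈ P.tree, r = FreeGroup.of (Sum.inr j)}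

/-- The fundamental group of the surface, assembled from the three-holed spheres. -/
abbrev Grp (P : CurveSystem g) : Type := PresentedGroup P.rels

/-- The boundary loop of a three-holed sphere. -/
def bdryLoop (P : CurveSystem g) (x : Fin (2 * g - 2) × Fin 3) : P.Grp :=
  PresentedGroup.of (Sum.inl x)

/-- The element that crosses the `j`-th curve. -/
def crossing (P : CurveSystem g) (j : Fin (3 * g - 3)) : P.Grp :=
  PresentedGroup.of (Sum.inr j)

end CurveSystem

/-! ### Representations -/

/-- `Hom(Γ, Sp(1,1))` with the topology of pointwise convergence. -/
def RepSpace (Γ : Type) [Group Γ] : Type := Γ →* Sp11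

instance (Γ : Type) [Group Γ] : TopologicalSpace (RepSpace Γ) :=
  TopologicalSpace.induced (fun (ρ : Γ →* Sp11) (x : Γ) => ρ x) inferInstance

/-- Conjugation of representations by elements of `Sp(1,1)`. -/
def repSetoid (Γ : Type) [Group Γ] : Setoid (RepSpace Γ) where
  r := fun (ρ ρ' : Γ →* Sp11) => ∃ h : Sp11, ∀ x, ρ' x = h * ρ x * h⁻¹
  iseqv :=
    { refl := fun ρ => ⟨1, fun x => by simp⟩
      symm := by
        rintro ρ ρ' ⟨h, hh⟩
        exact ⟨h⁻¹, fun x => by rw [hh x]; group⟩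
      trans := by
        rintro ρ ρ' ρ'' ⟨h, hh⟩ ⟨k, hk⟩
        exact ⟨k * h, fun x => by rw [hk x, hh x]; group⟩ }

/-- The deformation space `Hom(Γ, Sp(1,1)) / Sp(1,1)` with the quotient topology. -/
def DeformationSpace (Γ : Type) [Group Γ] : Type := Quotient (repSetoid Γ)

instance (Γ : Type) [Group Γ] : TopologicalSpace (DeformationSpace Γ) :=
  inferInstanceAs (TopologicalSpace (Quotient (repSetoid Γ)))

/-- The point of the deformation space given by a representation. -/
def repClass {Γ : Type} [Group Γ] (ρ : Γ →* Sp11) : DeformationSpace Γ :=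
  Quotient.mk (repSetoid Γ) ρ

variable {g : ℕ}

/-- `ρ` is geometric for the curve system `P`, marked by `φ`: discrete and faithful, the image
of each curve loxodromic, and the image of each three-holed sphere group irreducible. -/
def IsGeometric (P : CurveSystem g) (φ : P.Grp ≃* SurfaceGroup g)
    (ρ : SurfaceGroup g →* Sp11) : Prop :=
  Function.Injective ρ ∧ DiscreteTopology ρ.range ∧
    (∀ j, IsLoxodromic (ρ (φ (P.bdryLoop (P.sides (j, false)))))) ∧
    ∀ v, IsIrreduciblePair (ρ (φ (P.bdryLoop (v, 0)))) (ρ (φ (P.bdryLoop (v, 1))))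

/-- A choice of reference gluings: for any two peripheral elements that can be glued, a fixed
element that conjugates the second to the inverse of the first. -/
def IsReference (ref : Sp11 → Sp11 → Sp11) : Prop :=
  ∀ X Y, IsConj Y X⁻¹ → ref X Y * Y * (ref X Y)⁻¹ = X⁻¹

/-- A system of Fenchel–Nielsen coordinates. -/
structure FNCoord (g : ℕ) where
  pants : Fin (2 * g - 2) → PairCoord
  twist : Fin (3 * g - 3) → TwistBend

/-- `c` is a system of Fenchel–Nielsen coordinates of `ρ`. For each three-holed sphere `v`, the
frame `F v` conjugates the pair of its first two peripheral elements into normal form, and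
`c.pants v` are the parameters of this pair. For each curve `j`, which glues `x` to `y`, let `X`
and `Y` be the two normalized peripheral elements; the element that glues the two normalized
groups is `K * ref X Y` with a twist-bend `K` along `X`, and `c.twist j` are the parameters of
`K`. -/
def IsFNCoord (ref : Sp11 → Sp11 → Sp11) (P : CurveSystem g) (φ : P.Grp ≃* SurfaceGroup g)
    (ρ : SurfaceGroup g →* Sp11) (c : FNCoord g) : Prop :=
  ∃ F : Fin (2 * g - 2) → Sp11,
    let per : Fin (2 * g - 2) × Fin 3 → Sp11 :=
      fun x => (F x.1)⁻¹ * ρ (φ (P.bdryLoop x)) * F x.1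
    (∀ v, IsPairCoord (per (v, 0)) (per (v, 1)) (c.pants v)) ∧
    ∀ j, let x := P.sides (j, false)
      let y := P.sides (j, true)
      IsTwistBend (per x)
        ((F x.1)⁻¹ * ρ (φ (P.crossing j)) * F y.1 * (ref (per x) (per y))⁻¹) (c.twist j)

end SpOneOne

end

open SpOneOne

open Filter Set Topology

/-! The classification rests on rigidity of eigendata: an element of `Sp11` with two nonorthogonal
null eigenvectors is determined by these vectors and by one of the eigenvalues (`eq_of_eigen_eq`).
For a pair in normal form, the cross ratio returns the only free fixed point `r_B`
(`eq_of_crossRatio_eq`), the real trace returns the complex eigenvalue in the upper half plane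
(`eq_of_trace_eq`), and the projective point selects one quaternion in the similarity class of that
eigenvalue (`eq_of_mk_eq`). Hence a coordinate system determines the normalized pairs and then the
twist-bends themselves, not only up to conjugacy. Two representations with common coordinates differ
only by their frames `F v` and `F' v`; on a tree edge the crossing is trivial, so `F' v * (F v)⁻¹`
takes the same value at both ends, and connectedness of the tree makes it one global conjugator.
Existence needs a normal form for pairs, and the fact that both the actual gluing and the reference
gluing carry `Y` to `X⁻¹`, so that their quotient commutes with `X`.

The chart is not built from these coordinates but from the standard presentation with `2g`
generators and one relator. `Sp11` is the unitary group of the adjoint involution on quaternionic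
matrices, and its Lie algebra, the skew elements, has dimension 10. The essential input is that the
commutant of an irreducible pair is `ℝ` (`IsIrreduciblePair.eq_smul_one_of_commute`): a nonscalar
self-adjoint element would give an invariant hyperplane, a nonzero skew one an invariant plane or a
common boundary fixed point.

Trivial commutant has three consequences. The relator is a submersion: a functional that kills the
image of its derivative is invariant under conjugation, so the trace form represents it by an
element of the commutant, and a scalar pairs to zero with skew elements (`eq_zero_of_annihilates`).
The orbit map of conjugation is an immersion (`orbitDeriv_injective`). Nearby conjugate tuples are
conjugate by an element near `1` (`exists_conj_mem_nhds`). So a slice transverse to the orbit, cut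
down by the implicit function theorem, is a chart of the quotient, of dimension `20g - 10 - 10`. -/

/-! ### Unitary groups of real algebras with involution -/

/-- An anti-involution of a real algebra. -/
structure AntiInvolution (M : Type*) [Ring M] [Algebra ℝ M] where
  toLin : M →ₗ[ℝ] M
  map_mul : ∀ x y, toLin (x * y) = toLin y * toLin x
  invol : ∀ x, toLin (toLin x) = x

namespace AntiInvolution

variable {M : Type*} [NormedRing M] [NormedAlgebra ℝ M] (τ : AntiInvolution M)

theorem map_one : τ.toLin 1 = 1 := by
  have h := τ.map_mul (τ.toLin 1) 1
  rw [mul_one, τ.invol, mul_one] at h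
  exact h.symm

/-- The skew elements. -/
noncomputable def skew : Submodule ℝ M := LinearMap.ker (τ.toLin + LinearMap.id)

theorem mem_skew {x : M} : x ∈ τ.skew ↔ τ.toLin x = -x := by
  simp [skew, eq_neg_iff_add_eq_zero]

/-- The projection to the skew elements. -/
noncomputable def skewPart : M →ₗ[ℝ] τ.skew :=
  LinearMap.codRestrict τ.skew ((1 / 2 : ℝ) • (LinearMap.id - τ.toLin)) (by
    intro m
    rw [mem_skew]
    simp only [LinearMap.smul_apply, LinearMap.sub_apply, LinearMap.id_apply, map_smul, map_sub,
      τ.invol]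
    rw [← smul_neg, neg_sub])

theorem coe_skewPart (m : M) : (τ.skewPart m : M) = (1 / 2 : ℝ) • (m - τ.toLin m) := rfl

theorem skewPart_of_mem (x : τ.skew) : τ.skewPart (x : M) = x := by
  ext
  rw [coe_skewPart, τ.mem_skew.1 x.2, sub_neg_eq_add, ← two_smul ℝ, smul_smul]
  norm_num

theorem skewPart_map (m : M) : τ.skewPart (τ.toLin m) = -τ.skewPart m := by
  ext
  rw [Submodule.coe_neg, coe_skewPart, coe_skewPart, τ.invol, ← smul_neg, neg_sub]

section Ad

variable {G : Type*} [Group G] {ι : G →* M}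

/-- Conjugation by a group element on the algebra. -/
noncomputable def Ad (ι : G →* M) (h : G) : M →ₗ[ℝ] M :=
  LinearMap.mulLeft ℝ (ι h) ∘ₗ LinearMap.mulRight ℝ (ι h⁻¹)

theorem Ad_apply (h : G) (m : M) : Ad ι h m = ι h * m * ι h⁻¹ := by
  simp [Ad, mul_assoc]

theorem Ad_one (m : M) : Ad ι 1 m = m := by simp [Ad_apply]

theorem Ad_mul (h k : G) (m : M) : Ad ι (h * k) m = Ad ι h (Ad ι k m) := by
  simp [Ad_apply, mul_assoc]

theorem Ad_inv_Ad (h : G) (m : M) : Ad ι h⁻¹ (Ad ι h m) = m := by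
  rw [← Ad_mul, inv_mul_cancel, Ad_one]

theorem Ad_Ad_inv (h : G) (m : M) : Ad ι h (Ad ι h⁻¹ m) = m := by
  rw [← Ad_mul, mul_inv_cancel, Ad_one]

theorem commute_of_Ad_eq {h : G} {m : M} (hm : Ad ι h m = m) : m * ι h = ι h * m := by
  conv_lhs => rw [← hm, Ad_apply, mul_assoc, ← _root_.map_mul, inv_mul_cancel, _root_.map_one,
    mul_one]

end Ad

/-- A group `G`, topologically embedded by `ι` as the unitary group of an algebra with
anti-involution. -/
structure IsUnitaryModel {G : Type*} [Group G] [TopologicalSpace G] (ι : G →* M) : Prop where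
  isInducing : IsInducing ι
  injective : Function.Injective ι
  unitary : ∀ h, τ.toLin (ι h) = ι h⁻¹
  exists_of_unitary : ∀ a, τ.toLin a * a = 1 → a * τ.toLin a = 1 → ∃ h, ι h = a

variable {τ}
variable {G : Type*} [Group G] [TopologicalSpace G] {ι : G →* M}

theorem IsUnitaryModel.map_Ad (H : τ.IsUnitaryModel ι) (h : G) (m : M) :
    τ.toLin (Ad ι h m) = Ad ι h (τ.toLin m) := by
  rw [Ad_apply, Ad_apply, τ.map_mul, τ.map_mul, H.unitary, H.unitary, inv_inv, mul_assoc]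

/-- A functional that is odd under the involution depends only on the skew part of its argument, and
`Ad` commutes with the involution; so nothing is lost by testing on the Lie algebra. -/
theorem IsUnitaryModel.invariant_of_eq_on_skew (H : τ.IsUnitaryModel ι) {ξ : M →ₗ[ℝ] ℝ}
    (hξ : ∀ m, ξ (τ.toLin m) = -ξ m) {h k : G}
    (hs : ∀ x : τ.skew, ξ (Ad ι h x) = ξ (Ad ι k x)) (m : M) : ξ (Ad ι h m) = ξ (Ad ι k m) := by
  have key : ∀ l : G, ξ (Ad ι l m) = ξ (Ad ι l (τ.skewPart m)) := by
    intro l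
    rw [coe_skewPart, map_smul, map_sub, map_smul, map_sub, ← H.map_Ad, hξ, smul_eq_mul]
    ring
  rw [key, key, hs]

/-- The skew part is injective on the unitary group near `1`. -/
theorem IsUnitaryModel.exists_injOn_skewPart (H : τ.IsUnitaryModel ι) :
    ∃ U : Set G, IsOpen U ∧ 1 ∈ U ∧ InjOn (fun h => τ.skewPart (ι h)) U := by
  refine ⟨ι ⁻¹' Metric.ball 1 (1 / 2), Metric.isOpen_ball.preimage H.isInducing.continuous, by simp,
    ?_⟩
  intro h hh k hk hhk
  have hh' : ‖ι h - 1‖ < 1 / 2 := by simpa [dist_eq_norm] using hh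
  have hk' : ‖ι k - 1‖ < 1 / 2 := by simpa [dist_eq_norm] using hk
  have e1 : ι h - ι h⁻¹ = ι k - ι k⁻¹ := by
    have := congrArg (fun x : τ.skew => (2 : ℝ) • (x : M)) hhk
    simp only [coe_skewPart, H.unitary, smul_smul] at this
    norm_num at this
    exact this
  -- Equality of the skew parts rewrites the difference `ι h - ι k` as `ι h⁻¹ - ι k⁻¹`, and
  -- multiplication by `ι h` and `ι k` from the two sides turns this into its negative. Near `1` the
  -- same multiplication is close to the identity, so the difference must vanish.
  have e2 : ι h * (ι h - ι k) * ι k = -(ι h - ι k) := by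
    have : ι h - ι k = ι h⁻¹ - ι k⁻¹ := by
      rw [sub_eq_sub_iff_add_eq_add] at e1 ⊢
      rw [e1, add_comm]
    conv_lhs => rw [this]
    rw [mul_sub, sub_mul, ← _root_.map_mul, mul_inv_cancel, _root_.map_one, one_mul, mul_assoc,
      ← _root_.map_mul, inv_mul_cancel, _root_.map_one, mul_one, neg_sub]
  set d := ι h - ι k with hd
  have e3 : (2 : ℝ) • d = -((ι h - 1) * d * (ι k - 1) + (ι h - 1) * d + d * (ι k - 1)) := by
    have : (ι h - 1) * d * (ι k - 1) + (ι h - 1) * d + d * (ι k - 1) = ι h * d * ι k - d := by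
      noncomm_ring
    rw [this, e2, two_smul]
    abel
  have e4 : 2 * ‖d‖ ≤ ‖ι h - 1‖ * ‖d‖ * ‖ι k - 1‖ + ‖ι h - 1‖ * ‖d‖ + ‖d‖ * ‖ι k - 1‖ := by
    calc 2 * ‖d‖ = ‖(2 : ℝ) • d‖ := by rw [norm_smul]; norm_num
      _ = ‖(ι h - 1) * d * (ι k - 1) + (ι h - 1) * d + d * (ι k - 1)‖ := by rw [e3, norm_neg]
      _ ≤ ‖(ι h - 1) * d * (ι k - 1)‖ + ‖(ι h - 1) * d‖ + ‖d * (ι k - 1)‖ := norm_add₃_le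
      _ ≤ _ := by
        gcongr
        · exact (norm_mul_le _ _).trans (by gcongr; exact norm_mul_le _ _)
        · exact norm_mul_le _ _
        · exact norm_mul_le _ _
  have hd0 : ‖d‖ = 0 := by
    by_contra hne
    have hpos : 0 < ‖d‖ := lt_of_le_of_ne (norm_nonneg _) (Ne.symm hne)
    -- With both distances to `1` below `1/2`, the right side of `e4` is at most `(1/4 + 1/2 +
    -- 1/2)‖d‖`, less than `2‖d‖`.
    nlinarith [norm_nonneg (ι h - 1), norm_nonneg (ι k - 1),
      mul_le_mul hh'.le hk'.le (norm_nonneg _) (by norm_num : (0 : ℝ) ≤ 1 / 2)]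
  exact H.injective (sub_eq_zero.1 (norm_eq_zero.1 hd0))

theorem continuous_toLin [FiniteDimensional ℝ M] (τ : AntiInvolution M) : Continuous τ.toLin :=
  τ.toLin.continuous_of_finiteDimensional

variable [CompleteSpace M]

theorem exp_neg_mul (x : M) : NormedSpace.exp (-x) * NormedSpace.exp x = 1 := by
  let _ : NormedAlgebra ℚ M := NormedAlgebra.restrictScalars ℚ ℝ M
  rw [← NormedSpace.exp_add_of_commute (Commute.refl x).neg_left, neg_add_cancel,
    NormedSpace.exp_zero]

theorem continuous_exp : Continuous (NormedSpace.exp : M → M) := by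
  let _ : NormedAlgebra ℚ M := NormedAlgebra.restrictScalars ℚ ℝ M
  exact NormedSpace.exp_continuous

variable [FiniteDimensional ℝ M]

theorem map_exp (x : M) : τ.toLin (NormedSpace.exp x) = NormedSpace.exp (τ.toLin x) := by
  have hpow : ∀ n : ℕ, τ.toLin (x ^ n) = τ.toLin x ^ n := by
    intro n
    induction n with
    | zero => simp [τ.map_one]
    | succ n ih => rw [pow_succ, τ.map_mul, ih, ← pow_succ']
  have h1 := (NormedSpace.exp_series_hasSum_exp' (𝕂 := ℝ) x).map τ.toLin τ.continuous_toLin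
  have h2 := NormedSpace.exp_series_hasSum_exp' (𝕂 := ℝ) (τ.toLin x)
  refine h1.unique ?_
  convert h2 using 1
  ext n
  simp [hpow]

theorem IsUnitaryModel.exists_exp (H : τ.IsUnitaryModel ι) (x : τ.skew) :
    ∃ h, ι h = NormedSpace.exp (x : M) := by
  refine H.exists_of_unitary _ ?_ ?_
  · rw [map_exp, τ.mem_skew.1 x.2, exp_neg_mul]
  · have h := exp_neg_mul (-(x : M))
    rwa [neg_neg, ← τ.mem_skew.1 x.2, ← map_exp] at h

/-- The exponential map of the unitary group. -/
noncomputable def IsUnitaryModel.exp (H : τ.IsUnitaryModel ι) (x : τ.skew) : G :=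
  (H.exists_exp x).choose

namespace IsUnitaryModel

theorem coe_exp (H : τ.IsUnitaryModel ι) (x : τ.skew) : ι (H.exp x) = NormedSpace.exp (x : M) :=
  (H.exists_exp x).choose_spec

theorem exp_zero (H : τ.IsUnitaryModel ι) : H.exp 0 = 1 := H.injective (by rw [H.coe_exp]; simp)

theorem continuous_exp (H : τ.IsUnitaryModel ι) : Continuous H.exp := by
  rw [H.isInducing.continuous_iff]
  have : ι ∘ H.exp = fun x : τ.skew => NormedSpace.exp (x : M) := funext H.coe_exp
  rw [this]
  exact AntiInvolution.continuous_exp.comp continuous_subtype_val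

theorem hasStrictFDerivAt_exp (H : τ.IsUnitaryModel ι) :
    HasStrictFDerivAt (fun x : τ.skew => ι (H.exp x)) τ.skew.subtypeL 0 := by
  have h1 : HasStrictFDerivAt (NormedSpace.exp : M → M) (1 : M →L[ℝ] M) (τ.skew.subtypeL 0) := by
    simpa using hasStrictFDerivAt_exp_zero (𝕂 := ℝ) (𝔸 := M)
  have h2 := h1.comp (0 : τ.skew) τ.skew.subtypeL.hasStrictFDerivAt
  have : (fun x : τ.skew => ι (H.exp x)) = (NormedSpace.exp : M → M) ∘ τ.skew.subtypeL := by
    ext x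
    simp [H.coe_exp]
  rw [this]
  exact h2

end IsUnitaryModel

end AntiInvolution

/-! ### Derivatives of words -/

namespace AntiInvolution.IsUnitaryModel

variable {M : Type*} [NormedRing M] [NormedAlgebra ℝ M] [CompleteSpace M] [FiniteDimensional ℝ M]
  {τ : AntiInvolution M} {G : Type*} [Group G] [TopologicalSpace G] {ι : G →* M}
  {I : Type*}

/-- The tuples of group elements near `A`, parametrized by the Lie algebra. -/
noncomputable def tuple (H : τ.IsUnitaryModel ι) (A : I → G) (u : I → τ.skew) (i : I) : G :=
  H.exp (u i) * A i

theorem tuple_zero (H : τ.IsUnitaryModel ι) (A : I → G) : H.tuple A 0 = A := by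
  ext i
  simp [tuple, H.exp_zero]

theorem continuous_tuple [IsTopologicalGroup G] (H : τ.IsUnitaryModel ι) (A : I → G) :
    Continuous (H.tuple A) :=
  continuous_pi fun i => (H.continuous_exp.comp (continuous_apply i)).mul continuous_const

/-- The value of a word on the tuple with parameter `u`. -/
noncomputable def wordMap (H : τ.IsUnitaryModel ι) (A : I → G) (w : FreeGroup I)
    (u : I → τ.skew) : M :=
  ι (FreeGroup.lift (H.tuple A u) w)

theorem wordMap_zero (H : τ.IsUnitaryModel ι) (A : I → G) (w : FreeGroup I) :
    H.wordMap A w 0 = ι (FreeGroup.lift A w) := by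
  rw [wordMap, tuple_zero]

/-- The logarithmic derivative of a word. -/
noncomputable def logDeriv (H : τ.IsUnitaryModel ι) (A : I → G) (w : FreeGroup I) :
    (I → τ.skew) →ₗ[ℝ] M :=
  LinearMap.mulRight ℝ (ι (FreeGroup.lift A w)⁻¹) ∘ₗ (fderiv ℝ (H.wordMap A w) 0).toLinearMap

theorem logDeriv_apply (H : τ.IsUnitaryModel ι) (A : I → G) (w : FreeGroup I) (u : I → τ.skew) :
    H.logDeriv A w u = fderiv ℝ (H.wordMap A w) 0 u * ι (FreeGroup.lift A w)⁻¹ := rfl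

variable [Fintype I]

theorem hasStrictFDerivAt_wordMap_of (H : τ.IsUnitaryModel ι) (A : I → G) (i : I) :
    HasStrictFDerivAt (H.wordMap A (FreeGroup.of i))
      (((ContinuousLinearMap.mul ℝ M).flip (ι (A i))) ∘L τ.skew.subtypeL ∘L
        ContinuousLinearMap.proj (R := ℝ) i) 0 := by
  have h1 : HasStrictFDerivAt (fun u : I → τ.skew => ι (H.exp (u i)))
      (τ.skew.subtypeL ∘L ContinuousLinearMap.proj (R := ℝ) i) 0 :=
    HasStrictFDerivAt.comp (g := fun x : τ.skew => ι (H.exp x)) (f := fun u : I → τ.skew => u i)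
      (0 : I → τ.skew) H.hasStrictFDerivAt_exp
      (ContinuousLinearMap.proj (R := ℝ) (φ := fun _ : I => τ.skew) i).hasStrictFDerivAt
  have h2 := ((ContinuousLinearMap.mul ℝ M).flip (ι (A i))).hasStrictFDerivAt.comp
    (0 : I → τ.skew) h1
  refine h2.congr_of_eventuallyEq (Eventually.of_forall fun u => ?_)
  simp [wordMap, tuple]

theorem exists_hasStrictFDerivAt_wordMap (H : τ.IsUnitaryModel ι) (A : I → G) (w : FreeGroup I) :
    ∃ D : (I → τ.skew) →L[ℝ] M, HasStrictFDerivAt (H.wordMap A w) D 0 := by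
  induction w using FreeGroup.induction_on with
  | C1 => exact ⟨_, (hasStrictFDerivAt_const (1 : M) 0).congr_of_eventuallyEq
      (Eventually.of_forall fun u => by simp [wordMap])⟩
  | of i => exact ⟨_, H.hasStrictFDerivAt_wordMap_of A i⟩
  -- On the unitary group inversion is the restriction of the linear map `τ.toLin`, so it need not
  -- be differentiated as an inverse.
  | inv_of i hi =>
    obtain ⟨D, hD⟩ := hi
    have h2 := (LinearMap.toContinuousLinearMap τ.toLin).hasStrictFDerivAt.comp
      (0 : I → τ.skew) hD
    exact ⟨_, h2.congr_of_eventuallyEq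
      (Eventually.of_forall fun u => by simp [wordMap, H.unitary])⟩
  | mul v w hv hw =>
    obtain ⟨D, hD⟩ := hv
    obtain ⟨D', hD'⟩ := hw
    have h := HasStrictFDerivAt.mul' (𝕜 := ℝ) (a := H.wordMap A v) (b := H.wordMap A w) hD hD'
    exact ⟨_, h.congr_of_eventuallyEq (Eventually.of_forall fun u => by simp [wordMap])⟩

theorem hasStrictFDerivAt_wordMap (H : τ.IsUnitaryModel ι) (A : I → G) (w : FreeGroup I) :
    HasStrictFDerivAt (H.wordMap A w) (fderiv ℝ (H.wordMap A w) 0) 0 := by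
  obtain ⟨D, hD⟩ := H.exists_hasStrictFDerivAt_wordMap A w
  rwa [hD.hasFDerivAt.fderiv]

/-- The product rule, trivialized by right translation: the logarithmic derivative is a crossed
homomorphism on the free group, as in Fox calculus. All further derivatives of words are computed
from this identity. -/
theorem logDeriv_mul (H : τ.IsUnitaryModel ι) (A : I → G) (v w : FreeGroup I) (u : I → τ.skew) :
    H.logDeriv A (v * w) u =
      H.logDeriv A v u + Ad ι (FreeGroup.lift A v) (H.logDeriv A w u) := by
  have h := HasStrictFDerivAt.mul' (𝕜 := ℝ) (a := H.wordMap A v) (b := H.wordMap A w)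
    (H.hasStrictFDerivAt_wordMap A v) (H.hasStrictFDerivAt_wordMap A w)
  have hw : H.wordMap A v * H.wordMap A w = H.wordMap A (v * w) := by
    ext u
    simp [wordMap]
  rw [hw] at h
  have hc : ι (FreeGroup.lift A w) * ι (FreeGroup.lift A w)⁻¹ = 1 := by
    rw [← _root_.map_mul, mul_inv_cancel, _root_.map_one]
  simp only [logDeriv_apply, h.hasFDerivAt.fderiv, Ad_apply, wordMap_zero, _root_.map_mul,
    mul_inv_rev, add_apply, smul_apply, smul_eq_mul,
    MulOpposite.smul_eq_mul_unop, MulOpposite.unop_op, add_mul]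
  rw [add_comm, mul_assoc (fderiv ℝ (H.wordMap A v) 0 u), ← mul_assoc (ι (FreeGroup.lift A w)), hc,
    one_mul]
  simp only [mul_assoc]

theorem logDeriv_one (H : τ.IsUnitaryModel ι) (A : I → G) (u : I → τ.skew) :
    H.logDeriv A 1 u = 0 := by
  have h := H.logDeriv_mul A 1 1 u
  rw [_root_.map_one, Ad_one, one_mul] at h
  simpa using h

theorem logDeriv_of (H : τ.IsUnitaryModel ι) (A : I → G) (i : I) (u : I → τ.skew) :
    H.logDeriv A (FreeGroup.of i) u = u i := by
  rw [logDeriv_apply, (H.hasStrictFDerivAt_wordMap_of A i).hasFDerivAt.fderiv]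
  simp [mul_assoc, ← _root_.map_mul]

theorem logDeriv_inv (H : τ.IsUnitaryModel ι) (A : I → G) (w : FreeGroup I) (u : I → τ.skew) :
    H.logDeriv A w⁻¹ u = -Ad ι (FreeGroup.lift A w)⁻¹ (H.logDeriv A w u) := by
  have h := H.logDeriv_mul A w⁻¹ w u
  rw [inv_mul_cancel, logDeriv_one, _root_.map_inv] at h
  exact eq_neg_of_add_eq_zero_left h.symm

theorem logDeriv_commutator (H : τ.IsUnitaryModel ι) (A : I → G) (i j : I) (u : I → τ.skew) :
    H.logDeriv A (FreeGroup.of i * FreeGroup.of j * (FreeGroup.of i)⁻¹ * (FreeGroup.of j)⁻¹) u =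
      u i + Ad ι (A i) (u j) - Ad ι (A i) (Ad ι (A j) (Ad ι (A i)⁻¹ (u i))) -
        Ad ι (A i) (Ad ι (A j) (Ad ι (A i)⁻¹ (Ad ι (A j)⁻¹ (u j)))) := by
  simp only [logDeriv_mul, logDeriv_inv, logDeriv_of, _root_.map_mul, _root_.map_inv,
    FreeGroup.lift_apply_of, Ad_mul, map_neg]
  abel

/-- The logarithmic derivative along an orbit of the conjugation action. -/
theorem logDeriv_orbit (H : τ.IsUnitaryModel ι) (A : I → G) (x : M) (u : I → τ.skew)
    (hu : ∀ i, (u i : M) = x - Ad ι (A i) x) (w : FreeGroup I) :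
    H.logDeriv A w u = x - Ad ι (FreeGroup.lift A w) x := by
  induction w using FreeGroup.induction_on with
  | C1 => simp [logDeriv_one, Ad_one]
  | of i => rw [logDeriv_of, hu, FreeGroup.lift_apply_of]
  | inv_of i hi =>
    rw [logDeriv_inv, logDeriv_of, hu, FreeGroup.lift_apply_of, map_sub, Ad_inv_Ad, _root_.map_inv,
      FreeGroup.lift_apply_of, neg_sub]
  | mul v w hv hw =>
    rw [logDeriv_mul, hv, hw, _root_.map_mul, Ad_mul, map_sub]
    abel

/-! ### The surface relation is a submersion -/

variable {g : ℕ}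

/-- The commutator of the two generators of the `i`-th handle. -/
def handle (i : Fin g) : FreeGroup (Fin g × Bool) :=
  FreeGroup.of (i, false) * FreeGroup.of (i, true) * (FreeGroup.of (i, false))⁻¹ *
    (FreeGroup.of (i, true))⁻¹

/-- Write `a`, `b` for the generators of the handle. Varying `a` alone gives `ξ = ξ ∘ Ad (a b a⁻¹)`;
varying `b` alone gives `ξ ∘ Ad a = ξ ∘ Ad (a b a⁻¹ b⁻¹)`. Together they yield `ξ ∘ Ad (a b) = ξ`,
then invariance under `a` from the first identity, and finally under `b`. -/
theorem invariant_of_handle (H : τ.IsUnitaryModel ι) (A : Fin g × Bool → G) (ξ : M →ₗ[ℝ] ℝ)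
    (hξ : ∀ m, ξ (τ.toLin m) = -ξ m) (i : Fin g)
    (h : ∀ u : Fin g × Bool → τ.skew, (∀ j b, j ≠ i → u (j, b) = 0) →
      ξ (H.logDeriv A (handle i) u) = 0) (b : Bool) (m : M) :
    ξ (Ad ι (A (i, b)) m) = ξ m := by
  have e1 : ∀ m, ξ m = ξ (Ad ι (A (i, false)) (Ad ι (A (i, true)) (Ad ι (A (i, false))⁻¹ m))) := by
    intro m
    have := H.invariant_of_eq_on_skew hξ (h := 1)
      (k := A (i, false) * A (i, true) * (A (i, false))⁻¹) (fun x => by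
        have := h (Pi.single (i, false) x) (fun j b hj => by simp [hj])
        rw [handle, logDeriv_commutator] at this
        simp only [Pi.single_eq_same, ne_eq, Prod.mk.injEq, Bool.true_eq_false, and_false,
          not_false_eq_true, Pi.single_eq_of_ne, ZeroMemClass.coe_zero, map_zero, add_zero,
          sub_zero, map_sub] at this
        rw [Ad_one, Ad_mul, Ad_mul]
        linarith) m
    rwa [Ad_one, Ad_mul, Ad_mul] at this
  have e2 : ∀ m, ξ (Ad ι (A (i, false)) m) = ξ (Ad ι (A (i, false)) (Ad ι (A (i, true))
      (Ad ι (A (i, false))⁻¹ (Ad ι (A (i, true))⁻¹ m)))) := by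
    intro m
    have := H.invariant_of_eq_on_skew hξ (h := A (i, false))
      (k := A (i, false) * A (i, true) * (A (i, false))⁻¹ * (A (i, true))⁻¹) (fun x => by
        have := h (Pi.single (i, true) x) (fun j b hj => by simp [hj])
        rw [handle, logDeriv_commutator] at this
        simp only [Pi.single_eq_same, ne_eq, Prod.mk.injEq, Bool.false_eq_true, and_false,
          not_false_eq_true, Pi.single_eq_of_ne, ZeroMemClass.coe_zero, map_zero, zero_add,
          sub_zero, map_sub] at this
        rw [Ad_mul, Ad_mul, Ad_mul]
        linarith) m
    rwa [Ad_mul, Ad_mul, Ad_mul] at this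
  have e3 : ∀ m, ξ (Ad ι (A (i, false)) (Ad ι (A (i, true)) m)) = ξ m := by
    intro m
    rw [e2, ← e1, Ad_inv_Ad]
  have e4 : ∀ m, ξ (Ad ι (A (i, false)) m) = ξ m := by
    intro m
    rw [e1 (Ad ι (A (i, false)) m), Ad_inv_Ad, e3]
  cases b
  · exact e4 m
  · rw [← e4, e3]

theorem logDeriv_handle_congr (H : τ.IsUnitaryModel ι) (A : Fin g × Bool → G) (i : Fin g)
    {u u' : Fin g × Bool → τ.skew} (h : ∀ b, u (i, b) = u' (i, b)) :
    H.logDeriv A (handle i) u = H.logDeriv A (handle i) u' := by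
  simp only [handle, logDeriv_commutator, h]

theorem logDeriv_handles_eq_zero (H : τ.IsUnitaryModel ι) (A : Fin g × Bool → G)
    (l : List (Fin g)) (u : Fin g × Bool → τ.skew) (hu : ∀ i ∈ l, ∀ b, u (i, b) = 0) :
    H.logDeriv A (l.map handle).prod u = 0 := by
  induction l with
  | nil => simp [logDeriv_one]
  | cons i l ih =>
    rw [List.map_cons, List.prod_cons, logDeriv_mul,
      ih fun j hj => hu j (List.mem_cons_of_mem _ hj),
      H.logDeriv_handle_congr A i (u' := 0) (fun b => hu i List.mem_cons_self b), map_zero,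
      map_zero, add_zero]

/-- Variations supported on the first handle make `ξ` invariant under its two generators. Then `ξ`
is also invariant under their commutator and kills the whole contribution of that handle, so the
hypothesis passes to the remaining product. -/
theorem invariant_of_handles (H : τ.IsUnitaryModel ι) (A : Fin g × Bool → G) (ξ : M →ₗ[ℝ] ℝ)
    (hξ : ∀ m, ξ (τ.toLin m) = -ξ m) (l : List (Fin g)) (hl : l.Nodup)
    (h : ∀ u, ξ (H.logDeriv A (l.map handle).prod u) = 0) :
    ∀ i ∈ l, ∀ b m, ξ (Ad ι (A (i, b)) m) = ξ m := by
  induction l with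
  | nil => simp
  | cons i l ih =>
    rw [List.nodup_cons] at hl
    have e0 : ∀ u : Fin g × Bool → τ.skew, (∀ j b, j ≠ i → u (j, b) = 0) →
        ξ (H.logDeriv A (handle i) u) = 0 := by
      intro u hu
      have := h u
      rwa [List.map_cons, List.prod_cons, logDeriv_mul,
        H.logDeriv_handles_eq_zero A l u (fun j hj b => hu j b fun hji => hl.1 (hji ▸ hj)),
        map_zero, add_zero] at this
    have e1 := H.invariant_of_handle A ξ hξ i e0
    have e2 : ∀ u, ξ (H.logDeriv A (handle i) u) = 0 := by
      intro u
      rw [H.logDeriv_handle_congr A i (u' := fun p => if p.1 = i then u p else 0) (by simp)]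
      exact e0 _ fun j b hj => by simp [hj]
    have einv : ∀ b m, ξ (Ad ι (A (i, b))⁻¹ m) = ξ m := by
      intro b m
      rw [← e1 b (Ad ι (A (i, b))⁻¹ m), Ad_Ad_inv]
    have e3 : ∀ m, ξ (Ad ι (FreeGroup.lift A (handle i)) m) = ξ m := by
      intro m
      simp only [handle, _root_.map_mul, _root_.map_inv, FreeGroup.lift_apply_of, Ad_mul, e1, einv]
    have e4 := ih hl.2 (fun u => by
      have := h u
      rwa [List.map_cons, List.prod_cons, logDeriv_mul, map_add, e2, e3, zero_add] at this)
    intro j hj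
    rcases List.mem_cons.1 hj with rfl | hj
    · exact e1
    · exact e4 j hj

/-- The relator of the surface group. -/
def relator (g : ℕ) : FreeGroup (Fin g × Bool) :=
  (List.ofFn fun i : Fin g => (handle i : FreeGroup (Fin g × Bool))).prod

/-- A functional that annihilates the image of the derivative of the surface relation is invariant;
if the commutant of the tuple consists of scalars, it vanishes. -/
theorem eq_zero_of_annihilates (H : τ.IsUnitaryModel ι) (A : Fin g × Bool → G)
    (hA : ∀ z : M, (∀ i, z * ι (A i) = ι (A i) * z) → ∃ t : ℝ, z = t • (1 : M))
    (T : M →ₗ[ℝ] ℝ) (hT : ∀ m n, T (m * n) = T (n * m)) (hTτ : ∀ m, T (τ.toLin m) = T m)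
    (hT0 : ∀ z, (∀ m, T (z * m) = 0) → z = 0)
    (ξ : M →ₗ[ℝ] ℝ) (hξ : ∀ m, ξ (τ.toLin m) = -ξ m)
    (h : ∀ u, ξ (H.logDeriv A (relator g) u) = 0) : ξ = 0 := by
  have hinv : ∀ i m, ξ (Ad ι (A i) m) = ξ m := by
    intro i m
    refine H.invariant_of_handles A ξ hξ (List.finRange g) (List.nodup_finRange g) ?_ i.1
      (List.mem_finRange _) i.2 m
    rwa [relator, List.ofFn_eq_map] at h
  -- Nondegeneracy of the form `T (z * m)` makes this map to the dual injective, hence bijective by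
  -- dimension; so `ξ` is represented by some `z`.
  let B : M →ₗ[ℝ] Module.Dual ℝ M :=
    LinearMap.mk₂ ℝ (fun z m => T (z * m)) (by intros; simp [add_mul]) (by intros; simp)
      (by intros; simp [mul_add]) (by intros; simp)
  have hB : Function.Injective B := by
    rw [injective_iff_map_eq_zero]
    intro z hz
    exact hT0 z fun m => LinearMap.congr_fun hz m
  obtain ⟨z, hz⟩ := (LinearMap.injective_iff_surjective_of_finrank_eq_finrank
    (Subspace.dual_finrank_eq (K := ℝ) (V := M)).symm).1 hB ξ
  have hz' : ∀ m, ξ m = T (z * m) := fun m => (LinearMap.congr_fun hz m).symm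
  -- By cyclicity of `T`, invariance of `ξ` means that `z` commutes with the tuple. Once `z` is a
  -- scalar `t`, `ξ = t T` is both even and odd under the involution, hence zero.
  obtain ⟨t, rfl⟩ := hA z (by
    intro i
    have : Ad ι (A i)⁻¹ z = z := by
      rw [← sub_eq_zero]
      refine hT0 _ fun m => ?_
      have h1 := hinv i m
      rw [hz', hz', Ad_apply, ← mul_assoc, ← mul_assoc, hT, ← mul_assoc, ← mul_assoc] at h1
      rw [sub_mul, map_sub, ← h1, Ad_apply, inv_inv, sub_self]
    apply commute_of_Ad_eq
    conv_lhs => rw [← this, Ad_Ad_inv])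
  ext m
  have h1 : ∀ m, ξ m = t * T m := by
    intro m
    rw [hz', smul_mul_assoc, one_mul, map_smul, smul_eq_mul]
  have h2 := hξ m
  rw [h1, h1, hTτ] at h2
  rw [h1, LinearMap.zero_apply]
  linarith

end AntiInvolution.IsUnitaryModel

/-! ### A local slice for the conjugation action -/

/-- If `κ ∘ Θ` is a local homeomorphism and `κ` is injective, then `Θ` is open. -/
theorem image_mem_nhds_of_comp {Z Y E : Type*} [TopologicalSpace Z] [TopologicalSpace Y]
    [TopologicalSpace E] {Θ : Z → Y} {κ : Y → E} (hΘ : Continuous Θ) (hκ : Continuous κ)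
    {U : Set Y} (hU : IsOpen U) (hinj : InjOn κ U) (e : OpenPartialHomeomorph Z E)
    (he : ∀ z, e z = κ (Θ z)) {z : Z} (hz : z ∈ e.source) (hzU : Θ z ∈ U) {S : Set Z}
    (hS : S ∈ 𝓝 z) : Θ '' S ∈ 𝓝 (Θ z) := by
  have h1 : S ∩ Θ ⁻¹' U ∈ 𝓝 z := inter_mem hS ((hU.preimage hΘ).mem_nhds hzU)
  have h2 : e '' (S ∩ Θ ⁻¹' U) ∈ 𝓝 (κ (Θ z)) := by
    rw [← he, ← e.map_nhds_eq hz]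
    exact image_mem_map h1
  filter_upwards [hκ.continuousAt.preimage_mem_nhds h2, hU.mem_nhds hzU] with y hy hyU
  obtain ⟨z', ⟨hz'S, hz'U⟩, hz'⟩ := hy
  exact ⟨z', hz'S, hinj hz'U hyU (by rw [← he, hz'])⟩

namespace AntiInvolution.IsUnitaryModel

variable {M : Type*} [NormedRing M] [NormedAlgebra ℝ M]
  {τ : AntiInvolution M} {G : Type*} [Group G] [TopologicalSpace G] {ι : G →* M}
  {I : Type*}

/-- The derivative of the orbit map of a tuple under conjugation. -/
noncomputable def orbitDeriv (τ : AntiInvolution M) (ι : G →* M) (A : I → G) :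
    τ.skew →ₗ[ℝ] (I → τ.skew) :=
  LinearMap.pi fun i => τ.skewPart ∘ₗ (LinearMap.id - Ad ι (A i)) ∘ₗ τ.skew.subtype

theorem coe_orbitDeriv (H : τ.IsUnitaryModel ι) (A : I → G) (x : τ.skew) (i : I) :
    (orbitDeriv τ ι A x i : M) = x - Ad ι (A i) x := by
  have hx := τ.mem_skew.1 x.2
  have : (x - Ad ι (A i) x : M) ∈ τ.skew := by
    rw [mem_skew, map_sub, H.map_Ad, hx, map_neg]
    abel
  exact congrArg Subtype.val (τ.skewPart_of_mem ⟨_, this⟩)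

/-- The kernel consists of skew elements of the commutant. These are scalars, and scalars are fixed
by the involution, so a skew one is zero. -/
theorem orbitDeriv_injective (H : τ.IsUnitaryModel ι) (A : I → G)
    (hA : ∀ z : M, (∀ i, z * ι (A i) = ι (A i) * z) → ∃ t : ℝ, z = t • (1 : M)) :
    Function.Injective (orbitDeriv τ ι A) := by
  rw [injective_iff_map_eq_zero]
  intro x hx
  obtain ⟨t, ht⟩ := hA x (by
    intro i
    apply commute_of_Ad_eq
    have := H.coe_orbitDeriv A x i
    rw [hx] at this
    exact (sub_eq_zero.1 this.symm).symm)
  have h1 := τ.mem_skew.1 x.2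
  rw [ht, map_smul, τ.map_one, eq_neg_iff_add_eq_zero, ← two_smul ℝ, ← ht] at h1
  ext
  simpa using h1

/-- Coordinates of tuples near `A`. -/
noncomputable def coord (τ : AntiInvolution M) (ι : G →* M) (A : I → G) (a : I → G) (i : I) :
    τ.skew :=
  τ.skewPart (ι (a i * (A i)⁻¹))

theorem exists_injOn_coord [IsTopologicalGroup G] [Finite I] (H : τ.IsUnitaryModel ι) (A : I → G) :
    ∃ U : Set (I → G), IsOpen U ∧ A ∈ U ∧ InjOn (coord τ ι A) U := by
  obtain ⟨U, hU, h1, hinj⟩ := H.exists_injOn_skewPart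
  refine ⟨{a | ∀ i, a i * (A i)⁻¹ ∈ U}, ?_, fun i => by simpa using h1, ?_⟩
  · rw [ofPred_forall]
    exact isOpen_iInter_of_finite fun i =>
      hU.preimage ((continuous_apply i).mul continuous_const)
  · intro a ha b hb hab
    ext i
    exact mul_right_cancel (hinj (ha i) (hb i) (congrFun hab i))

variable [FiniteDimensional ℝ M]

theorem continuous_skewPart (τ : AntiInvolution M) : Continuous τ.skewPart :=
  τ.skewPart.continuous_of_finiteDimensional

theorem continuous_coord [IsTopologicalGroup G] (H : τ.IsUnitaryModel ι) (A : I → G) :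
    Continuous (coord τ ι A) :=
  continuous_pi fun i => (continuous_skewPart τ).comp (H.isInducing.continuous.comp
    ((continuous_apply i).mul continuous_const))

/-- If two tuples close to `A` are conjugate, they are conjugate by an element close to `1`. -/
theorem exists_conj_mem_nhds (H : τ.IsUnitaryModel ι) (A : I → G)
    (hA : ∀ z : M, (∀ i, z * ι (A i) = ι (A i) * z) → ∃ t : ℝ, z = t • (1 : M))
    {N : Set G} (hN : N ∈ 𝓝 1) :
    ∀ᶠ p : (I → G) × (I → G) in 𝓝 (A, A), ∀ h, (∀ i, p.2 i = h * p.1 i * h⁻¹) →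
      ∃ k ∈ N, ∀ a, k * a * k⁻¹ = h * a * h⁻¹ := by
  -- A failure at every neighbourhood of `(A, A)` gives an ultrafilter of bad triples (tuple,
  -- conjugate tuple, conjugator) along which both tuples tend to `A`. The conjugators are not known
  -- to stay bounded.
  by_contra hcon
  set bad : Set ((I → G) × (I → G) × G) := {q | (∀ i, q.2.1 i = q.2.2 * q.1 i * q.2.2⁻¹) ∧
    ¬ ∃ k ∈ N, ∀ a, k * a * k⁻¹ = q.2.2 * a * q.2.2⁻¹} with hbad
  have hne : (comap (fun q : (I → G) × (I → G) × G => (q.1, q.2.1)) (𝓝 (A, A)) ⊓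
      𝓟 bad).NeBot := by
    rw [← frequently_mem_iff_neBot]
    rw [not_eventually] at hcon
    rw [frequently_comap]
    refine hcon.mono fun p hp => ?_
    push Not at hp
    obtain ⟨h, hh, hk⟩ := hp
    exact ⟨(p.1, p.2, h), rfl, hh, by push Not; exact hk⟩
  set u := Ultrafilter.of (comap (fun q : (I → G) × (I → G) × G => (q.1, q.2.1)) (𝓝 (A, A)) ⊓
      𝓟 bad) with hu
  have hle : (u : Filter _) ≤ comap (fun q : (I → G) × (I → G) × G => (q.1, q.2.1)) (𝓝 (A, A)) ⊓
      𝓟 bad := Ultrafilter.of_le _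
  have ht : Tendsto (fun q : (I → G) × (I → G) × G => (q.1, q.2.1)) u (𝓝 (A, A)) :=
    tendsto_comap.mono_left (hle.trans inf_le_left)
  have hb : ∀ᶠ q in (u : Filter _), q ∈ bad := (hle.trans inf_le_right) (mem_principal_self _)
  have ht1 : ∀ i, Tendsto (fun q : (I → G) × (I → G) × G => ι (q.1 i)) u (𝓝 (ι (A i))) := fun i =>
    (H.isInducing.continuous.tendsto _).comp
      (((continuous_apply i).tendsto _).comp ((continuous_fst.tendsto _).comp ht))
  have ht2 : ∀ i, Tendsto (fun q : (I → G) × (I → G) × G => ι (q.2.1 i)) u (𝓝 (ι (A i))) :=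
    fun i => (H.isInducing.continuous.tendsto _).comp
      (((continuous_apply i).tendsto _).comp ((continuous_snd.tendsto _).comp ht))
  have hnt : Nontrivial M := by
    by_contra hs
    rw [not_nontrivial_iff_subsingleton] at hs
    obtain ⟨q, -, hq⟩ := hb.exists
    exact hq ⟨1, mem_of_mem_nhds hN, fun a => H.injective (Subsingleton.elim _ _)⟩
  have hpos : ∀ h : G, 0 < ‖ι h‖ := fun h => norm_pos_iff.2 fun h0 => by
    have : ι h * ι h⁻¹ = 1 := by rw [← _root_.map_mul, mul_inv_cancel, _root_.map_one]
    rw [h0, zero_mul] at this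
    exact zero_ne_one this
  -- Normalized conjugators lie on a compact sphere. Their limit intertwines `A` with itself, so it
  -- is a nonzero scalar `t`.
  let k : (I → G) × (I → G) × G → M := fun q => ‖ι q.2.2‖⁻¹ • ι q.2.2
  have hksph : ∀ q, k q ∈ Metric.sphere (0 : M) 1 := by
    intro q
    have := hpos q.2.2
    simp [k, norm_smul, this.ne']
  have : ProperSpace M := FiniteDimensional.proper ℝ M
  obtain ⟨z, hz, hkz⟩ := (isCompact_sphere (0 : M) 1).ultrafilter_le_nhds (u.map k)
    (le_principal_iff.2 (mem_map.2 (Eventually.of_forall hksph)))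
  have hkz : Tendsto k u (𝓝 z) := hkz
  obtain ⟨t, rfl⟩ := hA z (by
    intro i
    refine tendsto_nhds_unique_of_eventuallyEq (hkz.mul (ht1 i)) ((ht2 i).mul hkz) ?_
    filter_upwards [hb] with q hq
    simp only [k, smul_mul_assoc, mul_smul_comm, ← _root_.map_mul]
    rw [hq.1 i, inv_mul_cancel_right])
  have hz1 : ‖t • (1 : M)‖ = 1 := by simpa using hz
  have ht0 : t ≠ 0 := by
    rintro rfl
    simp at hz1
  -- Here unitarity prevents escape to infinity: `τ(k) k` equals `‖ι h‖⁻² • 1` for the conjugator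
  -- `h` and tends to `t² • 1`, so `‖ι h‖` tends to `|t|⁻¹` and `ι h` itself to `±1`.
  have hn : Tendsto (fun q : (I → G) × (I → G) × G => ‖ι q.2.2‖⁻¹ ^ 2 • (1 : M)) u
      (𝓝 (t ^ 2 • (1 : M))) := by
    have h1 := ((τ.continuous_toLin.tendsto _).comp hkz).mul hkz
    have e1 : τ.toLin (t • (1 : M)) * t • (1 : M) = t ^ 2 • (1 : M) := by
      rw [map_smul, τ.map_one, smul_mul_smul_comm, one_mul, sq]
    rw [e1] at h1
    refine h1.congr fun q => ?_
    simp only [k, Function.comp_apply, map_smul, H.unitary, smul_mul_smul_comm, ← _root_.map_mul,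
      inv_mul_cancel, _root_.map_one, sq]
  have h1pos : 0 < ‖(1 : M)‖ := norm_pos_iff.2 one_ne_zero
  have hn2 : Tendsto (fun q : (I → G) × (I → G) × G => ‖ι q.2.2‖) u (𝓝 |t|⁻¹) := by
    have h1 := (hn.norm).div_const ‖(1 : M)‖
    simp only [norm_smul, mul_div_cancel_right₀ _ h1pos.ne'] at h1
    have h2 := (h1.sqrt).inv₀ (by rw [Real.norm_of_nonneg (sq_nonneg t)]; positivity)
    have e2 : √‖t ^ 2‖ = |t| := by rw [Real.norm_of_nonneg (sq_nonneg t), Real.sqrt_sq_eq_abs]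
    rw [e2] at h2
    refine h2.congr fun q => ?_
    have := hpos q.2.2
    rw [Real.norm_of_nonneg (by positivity), Real.sqrt_sq (by positivity), inv_inv]
  have hι : Tendsto (fun q : (I → G) × (I → G) × G => ι q.2.2) u (𝓝 ((|t|⁻¹ * t) • (1 : M))) := by
    have h1 := hn2.smul hkz
    rw [smul_smul] at h1
    refine h1.congr fun q => ?_
    have := hpos q.2.2
    simp only [k, smul_smul, mul_inv_cancel₀ this.ne', one_smul]
  obtain ⟨N', hN', hNN'⟩ := (H.isInducing.nhds_eq_comap 1).symm ▸ hN |> mem_comap.1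
  rw [_root_.map_one] at hN'
  -- If the limit is `-1`, the conjugator is replaced by its negative, which is again unitary and
  -- induces the same conjugation.
  rcases lt_or_gt_of_ne ht0 with hlt | hgt
  · have e : (|t|⁻¹ * t) • (1 : M) = -1 := by
      rw [abs_of_neg hlt, inv_neg, neg_mul, inv_mul_cancel₀ ht0, neg_smul, one_smul]
    rw [e] at hι
    have h2 := hι.neg
    rw [neg_neg] at h2
    obtain ⟨q, hq, hqN⟩ := (hb.and (h2.eventually hN')).exists
    have hunit : ι q.2.2 * ι q.2.2⁻¹ = 1 := by
      rw [← _root_.map_mul, mul_inv_cancel, _root_.map_one]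
    have hunit' : ι q.2.2⁻¹ * ι q.2.2 = 1 := by
      rw [← _root_.map_mul, inv_mul_cancel, _root_.map_one]
    obtain ⟨h', hh'⟩ := H.exists_of_unitary (-ι q.2.2) (by simp [H.unitary, hunit'])
      (by simp [H.unitary, hunit])
    refine hq.2 ⟨h', hNN' (by rwa [mem_preimage, hh']), fun a => H.injective ?_⟩
    have hinv : ι h'⁻¹ = -ι q.2.2⁻¹ := by rw [← H.unitary, hh', map_neg, H.unitary]
    simp only [_root_.map_mul, hh', hinv]
    simp
  · have e : (|t|⁻¹ * t) • (1 : M) = 1 := by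
      rw [abs_of_pos hgt, inv_mul_cancel₀ ht0, one_smul]
    rw [e] at hι
    obtain ⟨q, hq, hqN⟩ := (hb.and (hι.eventually hN')).exists
    exact hq.2 ⟨q.2.2, hNN' hqN, fun a => rfl⟩

variable [CompleteSpace M]

/-- The exponential map is open at `0`. -/
theorem image_exp_mem_nhds (H : τ.IsUnitaryModel ι) {N : Set τ.skew} (hN : N ∈ 𝓝 0) :
    H.exp '' N ∈ 𝓝 1 := by
  obtain ⟨U, hU, h1, hinj⟩ := H.exists_injOn_skewPart
  have hd : HasStrictFDerivAt (fun x : τ.skew => τ.skewPart (ι (H.exp x)))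
      ((ContinuousLinearEquiv.refl ℝ τ.skew : τ.skew ≃L[ℝ] τ.skew) : τ.skew →L[ℝ] τ.skew) 0 := by
    have h := (LinearMap.toContinuousLinearMap τ.skewPart).hasStrictFDerivAt.comp (0 : τ.skew)
      H.hasStrictFDerivAt_exp
    refine h.congr_fderiv ?_
    ext x
    simp [τ.skewPart_of_mem]
  rw [← H.exp_zero]
  refine image_mem_nhds_of_comp (κ := fun h => τ.skewPart (ι h)) H.continuous_exp
    ((continuous_skewPart τ).comp H.isInducing.continuous) hU hinj
    (hd.toOpenPartialHomeomorph _) (fun z => rfl) hd.mem_toOpenPartialHomeomorph_source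
    (by rwa [H.exp_zero]) hN

/-- The tuple with parameter `p.2`, conjugated by the exponential of `p.1`. -/
noncomputable def conjTuple (H : τ.IsUnitaryModel ι) (A : I → G) (p : τ.skew × (I → τ.skew))
    (i : I) : G :=
  H.exp p.1 * H.tuple A p.2 i * (H.exp p.1)⁻¹

theorem continuous_conjTuple [IsTopologicalGroup G] (H : τ.IsUnitaryModel ι) (A : I → G) :
    Continuous (H.conjTuple A) :=
  continuous_pi fun i => ((H.continuous_exp.comp continuous_fst).mul
    ((continuous_apply i).comp ((H.continuous_tuple A).comp continuous_snd))).mul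
    (H.continuous_exp.comp continuous_fst).inv

/-- To first order, `exp x · exp u · A · (exp x)⁻¹ · A⁻¹` is `1 + (x - Ad A x) + u`. The factor
`(exp x)⁻¹` is differentiated as the image of `exp x` under the linear involution. -/
theorem hasStrictFDerivAt_coord_conjTuple [Fintype I] (H : τ.IsUnitaryModel ι) (A : I → G) :
    HasStrictFDerivAt (fun p => coord τ ι A (H.conjTuple A p))
      (LinearMap.toContinuousLinearMap
        ((orbitDeriv τ ι A).coprod (LinearMap.id : (I → τ.skew) →ₗ[ℝ] (I → τ.skew)))) 0 := by
  refine hasStrictFDerivAt_pi'' (𝕜 := ℝ) (E := τ.skew × (I → τ.skew))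
    (F' := fun _ : I => τ.skew) fun i => ?_
  have h1 : HasStrictFDerivAt (fun p : τ.skew × (I → τ.skew) => ι (H.exp p.1))
      (τ.skew.subtypeL ∘L ContinuousLinearMap.fst ℝ τ.skew (I → τ.skew)) 0 :=
    HasStrictFDerivAt.comp (g := fun x : τ.skew => ι (H.exp x))
      (f := fun p : τ.skew × (I → τ.skew) => p.1) 0 H.hasStrictFDerivAt_exp
      (ContinuousLinearMap.fst ℝ τ.skew (I → τ.skew)).hasStrictFDerivAt
  have h2 : HasStrictFDerivAt (fun p : τ.skew × (I → τ.skew) => ι (H.exp (p.2 i)))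
      (τ.skew.subtypeL ∘L (ContinuousLinearMap.proj (R := ℝ) (φ := fun _ : I => τ.skew) i) ∘L
        ContinuousLinearMap.snd ℝ τ.skew (I → τ.skew)) 0 :=
    HasStrictFDerivAt.comp (g := fun x : τ.skew => ι (H.exp x))
      (f := fun p : τ.skew × (I → τ.skew) => p.2 i) 0 H.hasStrictFDerivAt_exp
      ((ContinuousLinearMap.proj (R := ℝ) (φ := fun _ : I => τ.skew) i) ∘L
        ContinuousLinearMap.snd ℝ τ.skew (I → τ.skew)).hasStrictFDerivAt
  have h3 := HasStrictFDerivAt.comp (g := τ.toLin) (0 : τ.skew × (I → τ.skew))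
    (LinearMap.toContinuousLinearMap τ.toLin).hasStrictFDerivAt h1
  have h4 := (HasStrictFDerivAt.mul' (𝕜 := ℝ) (HasStrictFDerivAt.mul' (𝕜 := ℝ) h1 h2)
    ((h3.const_mul (ι (A i))).mul_const' (ι (A i)⁻¹)))
  have h5 := HasStrictFDerivAt.comp (g := τ.skewPart) (0 : τ.skew × (I → τ.skew))
    (LinearMap.toContinuousLinearMap τ.skewPart).hasStrictFDerivAt h4
  refine (h5.congr_of_eventuallyEq (Eventually.of_forall fun p => ?_)).congr_fderiv ?_
  · simp [coord, conjTuple, tuple, H.unitary, mul_assoc]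
  · refine ContinuousLinearMap.ext fun p => ?_
    have h6 := τ.skewPart_of_mem (orbitDeriv τ ι A p.1 i + p.2 i)
    rw [Submodule.coe_add, H.coe_orbitDeriv] at h6
    refine Eq.trans (congrArg τ.skewPart ?_) h6
    have hA : ι (A i) * ι (A i)⁻¹ = 1 := by
      rw [← _root_.map_mul, mul_inv_cancel, _root_.map_one]
    simp [H.exp_zero, Ad_apply, τ.map_one, τ.mem_skew.1 p.1.2, hA, -_root_.map_inv]
    abel

end AntiInvolution.IsUnitaryModel

/-! ### Charts of the space of solutions modulo conjugation -/

theorem continuous_freeGroup_lift {I G : Type*} [Group G] [TopologicalSpace G]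
    [IsTopologicalGroup G] (w : FreeGroup I) : Continuous fun a : I → G => FreeGroup.lift a w := by
  induction w using FreeGroup.induction_on with
  | C1 => simpa using continuous_const
  | of i => simpa using continuous_apply i
  | inv_of i hi =>
    simp only [_root_.map_inv, FreeGroup.lift_apply_of]
    exact (continuous_apply i).inv
  | mul v w hv hw =>
    simp only [_root_.map_mul]
    exact hv.mul hw

/-- A chart of a space of tuples modulo conjugation, obtained from a slice for the conjugation
action on which the tuples in question are described by an implicit function. -/
theorem exists_chart_of_slice {I L E K G X D : Type*} [Group G] [TopologicalSpace G]
    [IsTopologicalGroup G] [TopologicalSpace L] [Zero L] [TopologicalSpace E] [TopologicalSpace K]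
    [TopologicalSpace X] [TopologicalSpace D] {ev : X → I → G} (hev : IsInducing ev)
    {rel : (I → G) → Prop} (hrange : ∀ a, (∃ x, ev x = a) ↔ rel a)
    (hconj : ∀ a b h, (∀ i, b i = h * a i * h⁻¹) → rel b → rel a)
    {q : X → D} (hq : IsQuotientMap q)
    (hqq : ∀ x y, q x = q y ↔ ∃ h, ∀ i, ev y i = h * ev x i * h⁻¹)
    {tup : E → I → G} (htup : Continuous tup) {N : Set E} (hNo : IsOpen N)
    (hinj : ∀ u ∈ N, ∀ u' ∈ N, ∀ h, (∀ i, tup u' i = h * tup u i * h⁻¹) → u = u')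
    (hopen : ∀ u ∈ N, ∀ W ∈ 𝓝 u, ∃ Z ∈ 𝓝 (tup u), ∀ a ∈ Z, ∃ u' ∈ W, ∃ h,
      ∀ i, a i = h * tup u' i * h⁻¹)
    (ef : OpenPartialHomeomorph E (L × K)) (hNef : N ⊆ ef.source)
    (hrel : ∀ u ∈ N, rel (tup u) ↔ (ef u).1 = 0) {u₀ : E} (hu₀ : u₀ ∈ N) {x₀ : X}
    (hx₀ : ev x₀ = tup u₀) :
    ∃ e : OpenPartialHomeomorph D K, q x₀ ∈ e.source := by
  -- The chart domain is the part of the zero fibre of the relation that lies in `N`, seen in the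
  -- second factor of the straightening `ef`; `par` is its inverse parametrization.
  have hVo : IsOpen ((fun k : K => ((0 : L), k)) ⁻¹' (ef.target ∩ ef.symm ⁻¹' N)) :=
    (ef.isOpen_inter_preimage_symm hNo).preimage (continuous_const.prodMk continuous_id)
  set V : TopologicalSpace.Opens K := ⟨_, hVo⟩ with hV
  have hVmem : ∀ k, k ∈ V ↔ ((0 : L), k) ∈ ef.target ∧ ef.symm ((0 : L), k) ∈ N := fun k => Iff.rfl
  have hmemV : ∀ u ∈ N, (ef u).1 = 0 → (ef u).2 ∈ V := by
    intro u hu h0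
    have h1 : ((0 : L), (ef u).2) = ef u := Prod.ext h0.symm rfl
    rw [hVmem, h1, ef.left_inv (hNef hu)]
    exact ⟨ef.map_source (hNef hu), hu⟩
  let par : V → E := fun k => ef.symm ((0 : L), (k : K))
  have hparN : ∀ k, par k ∈ N := fun k => ((hVmem k).1 k.2).2
  have hefpar : ∀ k : V, ef (par k) = (0, (k : K)) := fun k => ef.right_inv ((hVmem k).1 k.2).1
  have hparef : ∀ u (hu : u ∈ N) (h0 : (ef u).1 = 0), par ⟨_, hmemV u hu h0⟩ = u := by
    intro u hu h0
    have h1 : ((0 : L), (ef u).2) = ef u := Prod.ext h0.symm rfl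
    change ef.symm ((0 : L), (ef u).2) = u
    rw [h1, ef.left_inv (hNef hu)]
  have hparc : Continuous par := by
    have h1 := ef.continuousOn_symm.comp (f := fun k : K => ((0 : L), k)) (s := V)
      (continuous_const.prodMk continuous_id).continuousOn (fun k hk => ((hVmem k).1 hk).1)
    exact continuousOn_iff_continuous_domRestrict.1 h1
  have hx : ∀ k : V, ∃ x, ev x = tup (par k) := fun k => by
    rw [hrange, hrel _ (hparN k), hefpar]
  choose s hs using hx
  have hsc : Continuous s := by
    rw [hev.continuous_iff]
    have : ev ∘ s = fun k => tup (par k) := funext hs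
    rw [this]
    exact htup.comp hparc
  have hsinj : Function.Injective (q ∘ s) := by
    intro k k' hkk'
    obtain ⟨h, hh⟩ := (hqq _ _).1 hkk'
    rw [hs, hs] at hh
    have h4 := hefpar k
    rw [hinj _ (hparN k) _ (hparN k') h hh, hefpar k'] at h4
    exact Subtype.ext (Prod.ext_iff.1 h4).2.symm
  have hsopen : IsOpenMap (q ∘ s) := by
    intro O hO
    rw [← hq.isOpen_preimage, isOpen_iff_mem_nhds]
    rintro x ⟨k, hkO, hkx⟩
    obtain ⟨h, hh⟩ := (hqq _ _).1 hkx
    obtain ⟨O', hO'o, rfl⟩ := isOpen_induced_iff.1 hO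
    -- For openness, points near `x` are conjugated back near the slice and then moved onto it by
    -- `hopen`, within the prescribed part of `N`.
    have hW : N ∩ (ef.source ∩ ef ⁻¹' (univ ×ˢ O')) ∈ 𝓝 (par k) := by
      refine (hNo.inter (ef.isOpen_inter_preimage (isOpen_univ.prod hO'o))).mem_nhds
        ⟨hparN k, hNef (hparN k), ?_⟩
      rw [mem_preimage, hefpar]
      exact ⟨trivial, hkO⟩
    obtain ⟨Z, hZ, hZW⟩ := hopen _ (hparN k) _ hW
    have hc : Continuous fun y : X => fun i => h⁻¹ * ev y i * h :=
      continuous_pi fun i => (continuous_const.mul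
        ((continuous_apply i).comp hev.continuous)).mul continuous_const
    have hcx : (fun i => h⁻¹ * ev x i * h) = tup (par k) := by
      ext i
      rw [hh i, hs]
      group
    have hZx : ∀ᶠ y in 𝓝 x, (fun i => h⁻¹ * ev y i * h) ∈ Z :=
      hc.continuousAt.preimage_mem_nhds (by rwa [hcx])
    filter_upwards [hZx] with y hy
    obtain ⟨u, ⟨huN, hus, -, huO⟩, l, hl⟩ := hZW _ hy
    have hyu : ∀ i, ev y i = (h * l) * tup u i * (h * l)⁻¹ := by
      intro i
      have h1 : ev y i = h * (h⁻¹ * ev y i * h) * h⁻¹ := by group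
      rw [h1, hl i]
      group
    -- The slice point is conjugate to a solution, and the relation is invariant under conjugation,
    -- so it lies in the zero fibre.
    have h0 : (ef u).1 = 0 :=
      (hrel u huN).1 (hconj _ _ _ hyu ((hrange (ev y)).1 ⟨y, rfl⟩))
    refine ⟨⟨_, hmemV u huN h0⟩, huO, (hqq _ _).2 ⟨h * l, fun i => ?_⟩⟩
    rw [hyu i, hs, hparef u huN h0]
  have hemb : IsOpenEmbedding (q ∘ s) :=
    IsOpenEmbedding.of_continuous_injective_isOpenMap (hq.continuous.comp hsc) hsinj hsopen
  have h0 : (ef u₀).1 = 0 := by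
    rw [← hrel u₀ hu₀, ← hrange]
    exact ⟨x₀, hx₀⟩
  have hne : Nonempty V := ⟨⟨_, hmemV u₀ hu₀ h0⟩⟩
  refine ⟨(hemb.toOpenPartialHomeomorph (q ∘ s)).symm.trans
    (V.openPartialHomeomorphSubtypeCoe hne), ?_⟩
  have hmem : q x₀ ∈ range (q ∘ s) := by
    refine ⟨⟨_, hmemV u₀ hu₀ h0⟩, (hqq _ _).2 ⟨1, fun i => ?_⟩⟩
    rw [hs, hparef u₀ hu₀ h0, hx₀]
    simp
  simpa using hmem

namespace AntiInvolution.IsUnitaryModel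

variable {M : Type*} [NormedRing M] [NormedAlgebra ℝ M] [CompleteSpace M] [FiniteDimensional ℝ M]
  {τ : AntiInvolution M} {G : Type*} [Group G] [TopologicalSpace G] {ι : G →* M}

/-- A proper image would be killed by a nonzero functional on the skew elements. Composed with
`skewPart` it becomes an odd functional on the whole algebra, which `eq_zero_of_annihilates` forces
to vanish. -/
theorem relatorDeriv_surjective {g : ℕ} (H : τ.IsUnitaryModel ι) (A : Fin g × Bool → G)
    (hA : ∀ z : M, (∀ i, z * ι (A i) = ι (A i) * z) → ∃ t : ℝ, z = t • (1 : M))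
    (T : M →ₗ[ℝ] ℝ) (hT : ∀ m n, T (m * n) = T (n * m)) (hTτ : ∀ m, T (τ.toLin m) = T m)
    (hT0 : ∀ z, (∀ m, T (z * m) = 0) → z = 0) :
    LinearMap.range (τ.skewPart ∘ₗ H.logDeriv A (relator g)) = ⊤ := by
  by_contra hne
  obtain ⟨ξ, hξ0, hξ⟩ := Submodule.exists_le_ker_of_lt_top _ (lt_top_iff_ne_top.2 hne)
  have h := H.eq_zero_of_annihilates A hA T hT hTτ hT0 (ξ ∘ₗ τ.skewPart)
    (fun m => by simp [skewPart_map]) (fun u => hξ ⟨u, rfl⟩)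
  refine hξ0 (LinearMap.ext fun x => ?_)
  have := LinearMap.congr_fun h (x : M)
  rwa [LinearMap.comp_apply, skewPart_of_mem] at this

/-- The set of tuples with trivial surface relator has, modulo conjugation, a Euclidean chart near
each tuple whose commutant consists of scalars. -/
theorem exists_chart [IsTopologicalGroup G] {g : ℕ} (H : τ.IsUnitaryModel ι)
    (A : Fin g × Bool → G) (hR : FreeGroup.lift A (relator g) = 1)
    (hA : ∀ z : M, (∀ i, z * ι (A i) = ι (A i) * z) → ∃ t : ℝ, z = t • (1 : M))
    (T : M →ₗ[ℝ] ℝ) (hT : ∀ m n, T (m * n) = T (n * m)) (hTτ : ∀ m, T (τ.toLin m) = T m)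
    (hT0 : ∀ z, (∀ m, T (z * m) = 0) → z = 0)
    {X D : Type*} [TopologicalSpace X] [TopologicalSpace D] {ev : X → Fin g × Bool → G}
    (hev : IsInducing ev) (hrange : ∀ a, (∃ x, ev x = a) ↔ FreeGroup.lift a (relator g) = 1)
    {q : X → D} (hq : IsQuotientMap q)
    (hqq : ∀ x y, q x = q y ↔ ∃ h, ∀ i, ev y i = h * ev x i * h⁻¹) {x₀ : X} (hx₀ : ev x₀ = A)
    {n : ℕ} (hn : n + 2 * Module.finrank ℝ τ.skew = 2 * g * Module.finrank ℝ τ.skew) :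
    ∃ e : OpenPartialHomeomorph D (EuclideanSpace ℝ (Fin n)), q x₀ ∈ e.source := by
  set R := relator g
  -- the complement of the tangent space of the orbit
  obtain ⟨E₀, hE₀⟩ := Submodule.exists_isCompl (LinearMap.range (orbitDeriv τ ι A))
  have hoinj := H.orbitDeriv_injective A hA
  let L : (τ.skew × E₀) →ₗ[ℝ] (Fin g × Bool → τ.skew) := (orbitDeriv τ ι A).coprod E₀.subtype
  have hLinj : Function.Injective L := by
    rw [injective_iff_map_eq_zero]
    rintro ⟨x, u⟩ hxu
    have hxu' : orbitDeriv τ ι A x + (u : Fin g × Bool → τ.skew) = 0 := by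
      simpa [L] using hxu
    have hmem : (u : Fin g × Bool → τ.skew) ∈ LinearMap.range (orbitDeriv τ ι A) :=
      ⟨-x, by rw [map_neg]; exact (eq_neg_of_add_eq_zero_right hxu').symm⟩
    have hu0 : (u : Fin g × Bool → τ.skew) = 0 :=
      (Submodule.disjoint_def.1 hE₀.disjoint) _ hmem u.2
    rw [hu0, add_zero] at hxu'
    exact Prod.ext (hoinj (by simpa using hxu')) (Subtype.ext hu0)
  have hLsurj : Function.Surjective L := by
    intro y
    obtain ⟨y₁, ⟨x, rfl⟩, y₂, hy₂, rfl⟩ := Submodule.mem_sup.1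
      (hE₀.sup_eq_top ▸ Submodule.mem_top : y ∈ LinearMap.range (orbitDeriv τ ι A) ⊔ E₀)
    exact ⟨(x, ⟨y₂, hy₂⟩), by simp [L]⟩
  have : CompleteSpace τ.skew := FiniteDimensional.complete ℝ τ.skew
  have : CompleteSpace E₀ := FiniteDimensional.complete ℝ E₀
  let Le : (τ.skew × E₀) ≃ₗ[ℝ] (Fin g × Bool → τ.skew) := LinearEquiv.ofBijective L ⟨hLinj, hLsurj⟩
  -- the conjugated slice
  let Θ : τ.skew × E₀ → Fin g × Bool → G := fun p => H.conjTuple A (p.1, p.2)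
  have hΘc : Continuous Θ := (H.continuous_conjTuple A).comp
    (continuous_fst.prodMk (continuous_subtype_val.comp continuous_snd))
  have hΘd : HasStrictFDerivAt (fun p => coord τ ι A (Θ p))
      (Le.toContinuousLinearEquiv : (τ.skew × E₀) →L[ℝ] (Fin g × Bool → τ.skew)) 0 := by
    have h1 : HasStrictFDerivAt (fun p : τ.skew × E₀ => (p.1, (p.2 : Fin g × Bool → τ.skew)))
        ((ContinuousLinearMap.id ℝ τ.skew).prodMap E₀.subtypeL) 0 :=
      ((ContinuousLinearMap.id ℝ τ.skew).prodMap E₀.subtypeL).hasStrictFDerivAt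
    have h2 := HasStrictFDerivAt.comp (𝕜 := ℝ) (E := τ.skew × E₀)
      (F := τ.skew × (Fin g × Bool → τ.skew)) (g := fun p => coord τ ι A (H.conjTuple A p))
      (f := fun p : τ.skew × E₀ => (p.1, (p.2 : Fin g × Bool → τ.skew))) (0 : τ.skew × E₀)
      (H.hasStrictFDerivAt_coord_conjTuple A) h1
    refine h2.congr_fderiv (ContinuousLinearMap.ext fun p => ?_)
    change (orbitDeriv τ ι A) p.1 + (p.2 : Fin g × Bool → τ.skew) = L p
    simp [L]
  let eΘ := HasStrictFDerivAt.toOpenPartialHomeomorph (𝕜 := ℝ) (E := τ.skew × E₀)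
    (F := Fin g × Bool → τ.skew) (fun p => coord τ ι A (Θ p)) hΘd
  have heΘ : ∀ p, eΘ p = coord τ ι A (Θ p) := fun p => rfl
  obtain ⟨U, hUo, hAU, hUinj⟩ := H.exists_injOn_coord A
  obtain ⟨U₁, hU₁o, h1U₁, hU₁inj⟩ := H.exists_injOn_skewPart
  have hΘ0 : Θ 0 = A := by
    ext i
    simp [Θ, conjTuple, H.exp_zero, tuple]
  have hΘu : ∀ u : E₀, Θ (0, u) = H.tuple A u := by
    intro u
    ext i
    simp [Θ, conjTuple, H.exp_zero]
  have hN0 : eΘ.source ∩ Θ ⁻¹' U ∈ 𝓝 ((0, 0) : τ.skew × E₀) :=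
    inter_mem (eΘ.open_source.mem_nhds hΘd.mem_toOpenPartialHomeomorph_source)
      ((hUo.preimage hΘc).mem_nhds (by
        change Θ 0 ∈ U
        rwa [hΘ0]))
  obtain ⟨N₁, N₂, hN₁o, hN₁0, hN₂o, hN₂0, hN₁₂⟩ := mem_nhds_prod_iff'.1 hN0
  have hprop := H.exists_conj_mem_nhds A hA (H.image_exp_mem_nhds (hN₁o.mem_nhds hN₁0))
  obtain ⟨S₁, S₂, hS₁o, hS₁A, hS₂o, hS₂A, hS⟩ := mem_nhds_prod_iff'.1 hprop
  -- the surface relation on the slice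
  let f : E₀ → τ.skew := fun u => τ.skewPart (H.wordMap A R u)
  let f' : E₀ →L[ℝ] τ.skew := LinearMap.toContinuousLinearMap τ.skewPart ∘L
    (fderiv ℝ (H.wordMap A R) 0) ∘L E₀.subtypeL
  have hfd : HasStrictFDerivAt f f' 0 := by
    have h1 := HasStrictFDerivAt.comp (𝕜 := ℝ) (E := E₀) (F := Fin g × Bool → τ.skew)
      (g := H.wordMap A R) (f := E₀.subtypeL) (0 : E₀) (H.hasStrictFDerivAt_wordMap A R)
      E₀.subtypeL.hasStrictFDerivAt
    exact HasStrictFDerivAt.comp (𝕜 := ℝ) (E := E₀) (F := M) (g := τ.skewPart) (0 : E₀)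
      (LinearMap.toContinuousLinearMap τ.skewPart).hasStrictFDerivAt h1
  have hf'apply : ∀ u : E₀, f' u = τ.skewPart (H.logDeriv A R u) := by
    intro u
    rw [logDeriv_apply, hR, inv_one, _root_.map_one, mul_one]
    rfl
  have hf'surj : f'.range = ⊤ := by
    rw [LinearMap.range_eq_top]
    intro y
    have hy : y ∈ LinearMap.range (τ.skewPart ∘ₗ H.logDeriv A R) := by
      rw [H.relatorDeriv_surjective A hA T hT hTτ hT0]
      trivial
    obtain ⟨u, rfl⟩ := hy
    -- Orbit directions do not contribute: the relator is `1` at `A`, so its derivative vanishes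
    -- along the orbit. The complement `E₀` therefore already maps onto the Lie algebra.
    obtain ⟨⟨x, v⟩, rfl⟩ := hLsurj u
    refine ⟨v, ?_⟩
    have h0 : H.logDeriv A R (orbitDeriv τ ι A x) = 0 := by
      rw [H.logDeriv_orbit A x _ (H.coe_orbitDeriv A x), hR, Ad_one, sub_self]
    change f' v = _
    rw [hf'apply]
    simp [L, h0]
  let ef := hfd.implicitToOpenPartialHomeomorph f f' hf'surj
  have hef : ∀ u, (ef u).1 = f u := fun u => rfl
  have htup : Continuous fun u : E₀ => H.tuple A u :=
    (H.continuous_tuple A).comp continuous_subtype_val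
  have hword : Continuous fun a : Fin g × Bool → G => FreeGroup.lift a R :=
    continuous_freeGroup_lift R
  -- The conditions serve, in turn, local injectivity of the conjugated slice, closeness of
  -- conjugators to `1`, the implicit function chart, and the equivalence of "relator is `1`" with
  -- "skew part of the relator is `0`".
  let N : Set E₀ := N₂ ∩ ((fun u : E₀ => H.tuple A u) ⁻¹' (S₁ ∩ S₂)) ∩ ef.source ∩
    ((fun u : E₀ => FreeGroup.lift (H.tuple A u) R) ⁻¹' U₁)
  have hNo : IsOpen N := ((hN₂o.inter ((hS₁o.inter hS₂o).preimage htup)).inter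
    ef.open_source).inter (hU₁o.preimage (hword.comp htup))
  have hN0 : (0 : E₀) ∈ N := by
    refine ⟨⟨⟨hN₂0, ?_⟩, hfd.mem_implicitToOpenPartialHomeomorph_source hf'surj⟩, ?_⟩
    · rw [mem_preimage, ZeroMemClass.coe_zero, tuple_zero]
      exact ⟨hS₁A, hS₂A⟩
    · rwa [mem_preimage, ZeroMemClass.coe_zero, tuple_zero, hR]
  have hrel : ∀ u ∈ N, FreeGroup.lift (H.tuple A u) R = 1 ↔ (ef u).1 = 0 := by
    intro u hu
    have h1 : τ.skewPart (ι 1) = 0 := by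
      ext
      simp [coe_skewPart, τ.map_one]
    rw [hef, ← h1]
    exact ⟨fun h => congrArg (fun x => τ.skewPart (ι x)) h, fun h => hU₁inj hu.2 h1U₁ h⟩
  -- With `d` the dimension of the Lie algebra, the slice has dimension `2gd - d`, and the
  -- submersion onto the Lie algebra removes another `d`.
  have hdim : Module.finrank ℝ f'.ker = Module.finrank ℝ (EuclideanSpace ℝ (Fin n)) := by
    have d1 := LinearMap.finrank_range_add_finrank_ker (f' : E₀ →ₗ[ℝ] τ.skew)
    rw [hf'surj, finrank_top] at d1
    have d2 := Le.finrank_eq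
    rw [Module.finrank_prod, Module.finrank_pi_fintype, Finset.sum_const, Finset.card_univ,
      Fintype.card_prod, Fintype.card_fin, Fintype.card_bool, smul_eq_mul, mul_comm g 2] at d2
    rw [finrank_euclideanSpace_fin]
    omega
  have hNinj : ∀ u ∈ N, ∀ u' ∈ N, ∀ h,
      (∀ i, H.tuple A u' i = h * H.tuple A u i * h⁻¹) → u = u' := by
    intro u hu u' hu' h hh
    -- The arbitrary conjugator is exchanged for a small one `exp x`; then `(x, u)` and `(0, u')`
    -- have the same image under the local homeomorphism `eΘ`.
    obtain ⟨_, ⟨x, hx, rfl⟩, hxh⟩ := hS (show (H.tuple A u, H.tuple A u') ∈ S₁ ×ˢ S₂ from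
      ⟨hu.1.1.2.1, hu'.1.1.2.2⟩) h hh
    have hΘeq : Θ (x, u) = Θ (0, u') := by
      rw [hΘu]
      ext i
      rw [hh i, ← hxh]
      rfl
    have h1 : eΘ (x, u) = eΘ (0, u') := by rw [heΘ, heΘ, hΘeq]
    exact (Prod.ext_iff.1 (eΘ.injOn (hN₁₂ ⟨hx, hu.1.1.1⟩).1 (hN₁₂ ⟨hN₁0, hu'.1.1.1⟩).1 h1)).2
  have hNopen : ∀ u ∈ N, ∀ W ∈ 𝓝 u, ∃ Z ∈ 𝓝 (H.tuple A u), ∀ a ∈ Z, ∃ u' ∈ W, ∃ h,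
      ∀ i, a i = h * H.tuple A u' i * h⁻¹ := by
    intro u hu W hW
    refine ⟨Θ '' (N₁ ×ˢ W), ?_, ?_⟩
    · rw [← hΘu]
      exact image_mem_nhds_of_comp hΘc (H.continuous_coord A) hUo hUinj eΘ heΘ
        (hN₁₂ ⟨hN₁0, hu.1.1.1⟩).1 (hN₁₂ ⟨hN₁0, hu.1.1.1⟩).2
        (prod_mem_nhds (hN₁o.mem_nhds hN₁0) hW)
    · rintro _ ⟨⟨x, u'⟩, ⟨-, hu'⟩, rfl⟩
      exact ⟨u', hu', H.exp x, fun i => rfl⟩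
  have hRconj : ∀ (a b : Fin g × Bool → G) (h : G), (∀ i, b i = h * a i * h⁻¹) →
      FreeGroup.lift b R = 1 → FreeGroup.lift a R = 1 := by
    intro a b h hab hb
    have h2 : FreeGroup.lift b = (MulAut.conj h).toMonoidHom.comp (FreeGroup.lift a) := by
      ext i
      simp [hab i]
    rw [h2] at hb
    simpa using hb
  obtain ⟨e, he⟩ := exists_chart_of_slice (tup := fun u : E₀ => H.tuple A u) hev hrange hRconj hq
    hqq htup hNo hNinj hNopen ef (fun u hu => hu.1.2) hrel hN0
    (by rw [hx₀, ZeroMemClass.coe_zero, tuple_zero])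
  exact ⟨e.trans (ContinuousLinearEquiv.ofFinrankEq (𝕜 := ℝ)
    hdim).toHomeomorph.toOpenPartialHomeomorph, by simpa using he⟩

end AntiInvolution.IsUnitaryModel

namespace SpOneOne

/-! ### Vectors and the Hermitian form -/

theorem rmul_rmul (v : Vec) (a b : ℍ[ℝ]) : rmul (rmul v a) b = rmul v (a * b) := by
  ext1 i
  exact mul_assoc _ _ _

theorem rmul_one (v : Vec) : rmul v 1 = v := by
  ext1 i
  exact mul_one _

theorem rmul_coe (v : Vec) (r : ℝ) : rmul v (r : ℍ[ℝ]) = r • v := by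
  ext1 i
  simp [rmul, Quaternion.mul_coe_eq_smul]

theorem rmul_ne_zero {v : Vec} (hv : v ≠ 0) {q : ℍ[ℝ]} (hq : q ≠ 0) : rmul v q ≠ 0 := by
  intro h
  refine hv (funext fun i => ?_)
  exact (mul_eq_zero.1 (congrFun h i)).resolve_right hq

theorem rmul_right_cancel {v : Vec} (hv : v ≠ 0) {a b : ℍ[ℝ]} (h : rmul v a = rmul v b) :
    a = b := by
  obtain ⟨i, hi⟩ := Function.ne_iff.1 hv
  exact mul_left_cancel₀ hi (congrFun h i)

theorem mulVec_rmul (m : Matrix (Fin 2) (Fin 2) ℍ[ℝ]) (v : Vec) (q : ℍ[ℝ]) :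
    m *ᵥ rmul v q = rmul (m *ᵥ v) q :=
  Matrix.mulVec_smul m (MulOpposite.op q) v

theorem act_rmul (A : Sp11) (v : Vec) (q : ℍ[ℝ]) : act A (rmul v q) = rmul (act A v) q :=
  mulVec_rmul _ v q

theorem act_mul (A B : Sp11) (v : Vec) : act (A * B) v = act A (act B v) :=
  (Matrix.mulVec_mulVec v A.val.val B.val.val).symm

theorem act_one (v : Vec) : act 1 v = v := Matrix.one_mulVec v

theorem act_add (A : Sp11) (v w : Vec) : act A (v + w) = act A v + act A w :=
  Matrix.mulVec_add _ v w

theorem act_inv_act (A : Sp11) (v : Vec) : act A⁻¹ (act A v) = v := by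
  rw [← act_mul, inv_mul_cancel, act_one]

theorem act_act_inv (A : Sp11) (v : Vec) : act A (act A⁻¹ v) = v := by
  rw [← act_mul, mul_inv_cancel, act_one]

theorem act_ne_zero (A : Sp11) {v : Vec} (hv : v ≠ 0) : act A v ≠ 0 := by
  intro h
  apply hv
  rw [← act_inv_act A v, h]
  exact Matrix.mulVec_zero _

theorem herm_act (A : Sp11) (z w : Vec) : herm (act A z) (act A w) = herm z w := A.2 z w

theorem star_herm (z w : Vec) : star (herm z w) = herm w z := by
  simp [herm, add_comm]

theorem herm_rmul_left (z w : Vec) (a : ℍ[ℝ]) : herm (rmul z a) w = herm z w * a := by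
  simp [herm, rmul, mul_assoc, add_mul]

theorem herm_rmul_right (z w : Vec) (a : ℍ[ℝ]) : herm z (rmul w a) = star a * herm z w := by
  simp [herm, rmul, mul_assoc, mul_add]

theorem herm_add_left (x y w : Vec) : herm (x + y) w = herm x w + herm y w := by
  simp [herm, mul_add]
  abel

theorem herm_add_right (x y w : Vec) : herm w (x + y) = herm w x + herm w y := by
  simp [herm, add_mul]
  abel

theorem herm_sub_left (x y w : Vec) : herm (x - y) w = herm x w - herm y w := by
  simp [herm, mul_sub]
  abel

theorem herm_smul_left (r : ℝ) (x w : Vec) : herm (r • x) w = r • herm x w := by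
  simp [herm]

theorem herm_smul_right (r : ℝ) (x w : Vec) : herm w (r • x) = r • herm w x := by
  simp [herm]

theorem herm_self (v : Vec) : herm v v = ((herm v v).re : ℍ[ℝ]) :=
  Quaternion.star_eq_self.1 (star_herm v v)

theorem herm_self_rmul (v : Vec) (q : ℍ[ℝ]) :
    herm (rmul v q) (rmul v q) = ((Quaternion.normSq q * (herm v v).re : ℝ) : ℍ[ℝ]) := by
  rw [herm_rmul_left, herm_rmul_right, herm_self v, ← Quaternion.coe_commutes, mul_assoc,
    Quaternion.star_mul_self, ← Quaternion.coe_mul, mul_comm, Quaternion.re_coe]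

/-- The orthogonal complement of a null vector is the line it spans. -/
theorem eq_rmul_of_herm_eq_zero {v w : Vec} (hv : v ≠ 0) (hv0 : herm v v = 0)
    (h : herm w v = 0) : ∃ c, w = rmul v c := by
  simp only [herm] at hv0 h
  by_cases h1 : v 1 = 0
  · have h0 : v 0 ≠ 0 := by
      intro h0
      exact hv (funext fun i => by fin_cases i <;> simp [h0, h1])
    have hw : w 1 = 0 := by simpa [h1, h0] using h
    refine ⟨(v 0)⁻¹ * w 0, funext fun i => ?_⟩
    fin_cases i
    · simp [rmul, h0]
    · simp [rmul, h1, hw]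
  · have h1' : star (v 1) ≠ 0 := by simpa using h1
    have e1 : v 0 = -((star (v 1))⁻¹ * star (v 0) * v 1) := by
      rw [eq_neg_iff_add_eq_zero, ← mul_right_inj' h1', mul_add, mul_assoc,
        mul_inv_cancel_left₀ h1', mul_zero]
      exact hv0
    have e2 : w 0 = -((star (v 1))⁻¹ * star (v 0) * w 1) := by
      rw [eq_neg_iff_add_eq_zero, ← mul_right_inj' h1', mul_add, mul_assoc,
        mul_inv_cancel_left₀ h1', mul_zero]
      exact h
    refine ⟨(v 1)⁻¹ * w 1, funext fun i => ?_⟩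
    fin_cases i
    · change w 0 = v 0 * ((v 1)⁻¹ * w 1)
      rw [e1, e2, neg_mul, mul_assoc _ (v 1), mul_inv_cancel_left₀ h1]
    · simp [rmul, h1]

/-- On the orthogonal complement of a vector the form has the opposite sign. -/
theorem herm_self_of_orthogonal {y z : Vec} (hz : (herm z z).re ≠ 0) (h : herm y z = 0) :
    (herm y y).re * Quaternion.normSq (z 1) = -(Quaternion.normSq (y 1) * (herm z z).re) ∧
      0 < Quaternion.normSq (z 1) ∧ (y 1 = 0 → y = 0) := by
  have h1 : z 1 ≠ 0 := by
    intro h1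
    simp [herm, h1] at hz
  have h1' : star (z 1) ≠ 0 := by simpa using h1
  have hpos : 0 < Quaternion.normSq (z 1) :=
    lt_of_le_of_ne Quaternion.normSq_nonneg (Ne.symm (Quaternion.normSq_ne_zero.2 h1))
  have h' : star (z 1) * y 0 + star (z 0) * y 1 = 0 := h
  have e : star (z 1) * y 0 = -(star (z 0) * y 1) := eq_neg_of_add_eq_zero_left h'
  refine ⟨?_, hpos, fun hy => funext fun i => ?_⟩
  · have e2 : ((Quaternion.normSq (z 1) : ℝ) : ℍ[ℝ]) * y 0 = -(z 1 * star (z 0) * y 1) := by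
      rw [← Quaternion.self_mul_star, mul_assoc, e, mul_neg, mul_assoc]
    have e3 : star (y 1) * (((Quaternion.normSq (z 1) : ℝ) : ℍ[ℝ]) * y 0) =
        -(star (y 1) * (z 1 * star (z 0)) * y 1) := by
      rw [e2, mul_neg]
      simp only [mul_assoc]
    -- Taking real parts suffices, since `Re ⟨y, y⟩ = 2 Re (ȳ₁ y₀)` and likewise for `z`.
    have e4 := congrArg (fun q : ℍ[ℝ] => q.re) e3
    simp at e4
    simp only [herm, Quaternion.normSq_def'] at e4 ⊢
    simp
    linear_combination 2 * e4
  · have h0 : y 0 = 0 := by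
      rw [hy, mul_zero, add_zero] at h'
      exact (mul_eq_zero.1 h').resolve_left h1'
    fin_cases i
    · exact h0
    · exact hy

/-- The signature is `(1,1)`: a nonzero vector orthogonal to a negative one is positive, and one
orthogonal to a positive one is negative. -/
theorem eq_zero_of_orthogonal {y z z' : Vec} (hz : (herm z z).re < 0) (hz' : 0 < (herm z' z').re)
    (h : herm y z = 0) (h' : herm y z' = 0) : y = 0 := by
  obtain ⟨e1, p1, h0⟩ := herm_self_of_orthogonal hz.ne h
  obtain ⟨e2, p2, -⟩ := herm_self_of_orthogonal hz'.ne' h'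
  have hn := Quaternion.normSq_nonneg (a := y 1)
  apply h0
  rw [← Quaternion.normSq_eq_zero]
  by_contra hne
  have hpos := lt_of_le_of_ne hn (Ne.symm hne)
  have h1 : 0 < (herm y y).re := by
    by_contra hle
    nlinarith [mul_pos hpos (neg_pos.2 hz), mul_nonneg p1.le (neg_nonneg.2 (not_lt.1 hle))]
  nlinarith [mul_pos hpos hz', mul_pos h1 p2]

theorem herm_ne_zero_of_neg {x y : Vec} (hx : (herm x x).re < 0) (hy : (herm y y).re < 0) :
    herm x y ≠ 0 := by
  intro h
  obtain ⟨e1, p1, -⟩ := herm_self_of_orthogonal hy.ne h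
  have hn := Quaternion.normSq_nonneg (a := x 1)
  nlinarith [mul_nonneg hn (neg_nonneg.2 hy.le), mul_pos p1 (neg_pos.2 hx)]

/-! ### Points of the projective line -/

theorem mk_eq_mk_iff {v w : Vec} (hv : v ≠ 0) (hw : w ≠ 0) :
    Projectivization.mk ℍ[ℝ]ᵐᵒᵖ v hv = Projectivization.mk ℍ[ℝ]ᵐᵒᵖ w hw ↔ ∃ q, rmul w q = v := by
  rw [Projectivization.mk_eq_mk_iff']
  exact ⟨fun ⟨a, ha⟩ => ⟨a.unop, ha⟩, fun ⟨q, hq⟩ => ⟨MulOpposite.op q, hq⟩⟩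

theorem exists_rep_eq {v : Vec} (hv : v ≠ 0) :
    ∃ q, q ≠ 0 ∧ (Projectivization.mk ℍ[ℝ]ᵐᵒᵖ v hv).rep = rmul v q := by
  obtain ⟨q, hq⟩ := (mk_eq_mk_iff (Projectivization.rep_nonzero _) hv).1
    (Projectivization.mk_rep (Projectivization.mk ℍ[ℝ]ᵐᵒᵖ v hv))
  refine ⟨q, ?_, hq.symm⟩
  rintro rfl
  apply Projectivization.rep_nonzero (Projectivization.mk ℍ[ℝ]ᵐᵒᵖ v hv)
  rw [← hq]
  ext1 i
  exact mul_zero _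

theorem mk_mem_hypSpace {v : Vec} (hv : v ≠ 0) :
    Projectivization.mk ℍ[ℝ]ᵐᵒᵖ v hv ∈ hypSpace ↔ (herm v v).re < 0 := by
  obtain ⟨q, hq, h⟩ := exists_rep_eq hv
  have hpos : 0 < Quaternion.normSq q :=
    lt_of_le_of_ne Quaternion.normSq_nonneg (Ne.symm (Quaternion.normSq_ne_zero.2 hq))
  change (herm _ _).re < 0 ↔ _
  rw [h, herm_self_rmul, Quaternion.re_coe]
  exact ⟨fun h => by by_contra h'; nlinarith, fun h => by nlinarith⟩

theorem mk_mem_bdry {v : Vec} (hv : v ≠ 0) :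
    Projectivization.mk ℍ[ℝ]ᵐᵒᵖ v hv ∈ bdry ↔ herm v v = 0 := by
  obtain ⟨q, hq, h⟩ := exists_rep_eq hv
  change herm _ _ = 0 ↔ _
  rw [h, herm_rmul_left, herm_rmul_right]
  simp [hq]

theorem move_mk (A : Sp11) {v : Vec} (hv : v ≠ 0) :
    move A (Projectivization.mk ℍ[ℝ]ᵐᵒᵖ v hv) =
      Projectivization.mk ℍ[ℝ]ᵐᵒᵖ (act A v) (act_ne_zero A hv) := rfl

theorem move_mk_eq_iff (A : Sp11) {v : Vec} (hv : v ≠ 0) :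
    move A (Projectivization.mk ℍ[ℝ]ᵐᵒᵖ v hv) = Projectivization.mk ℍ[ℝ]ᵐᵒᵖ v hv ↔
      ∃ μ, act A v = rmul v μ := by
  rw [move_mk, mk_eq_mk_iff]
  exact ⟨fun ⟨q, h⟩ => ⟨q, h.symm⟩, fun ⟨q, h⟩ => ⟨q, h.symm⟩⟩

/-! ### The adjoint and frames -/

/-- The adjoint with respect to the Hermitian form. -/
def adj (m : Matrix (Fin 2) (Fin 2) ℍ[ℝ]) : Matrix (Fin 2) (Fin 2) ℍ[ℝ] :=
  !![star (m 1 1), star (m 0 1); star (m 1 0), star (m 0 0)]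

theorem herm_mulVec_left (m : Matrix (Fin 2) (Fin 2) ℍ[ℝ]) (z w : Vec) :
    herm (m *ᵥ z) w = herm z (adj m *ᵥ w) := by
  simp [herm, adj, Matrix.mulVec, dotProduct, Fin.sum_univ_two, mul_add, add_mul, mul_assoc]
  abel

theorem adj_mul (m n : Matrix (Fin 2) (Fin 2) ℍ[ℝ]) : adj (m * n) = adj n * adj m := by
  refine Matrix.ext fun i j => ?_
  fin_cases i <;> fin_cases j <;>
    simp [adj, Matrix.mul_apply, Fin.sum_univ_two, add_comm]

theorem adj_adj (m : Matrix (Fin 2) (Fin 2) ℍ[ℝ]) : adj (adj m) = m := by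
  refine Matrix.ext fun i j => ?_
  fin_cases i <;> fin_cases j <;> simp [adj]

/-- The adjoint as an anti-involution. -/
def adjoint : AntiInvolution (Matrix (Fin 2) (Fin 2) ℍ[ℝ]) where
  toLin :=
    { toFun := adj
      map_add' := by
        intro m n
        refine Matrix.ext fun i j => ?_
        fin_cases i <;> fin_cases j <;> simp [adj]
      map_smul' := by
        intro r m
        refine Matrix.ext fun i j => ?_
        fin_cases i <;> fin_cases j <;> simp [adj] }
  map_mul := adj_mul
  invol := adj_adj

theorem vec_ext {m n : Matrix (Fin 2) (Fin 2) ℍ[ℝ]} (h0 : m *ᵥ ![1, 0] = n *ᵥ ![1, 0])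
    (h1 : m *ᵥ ![0, 1] = n *ᵥ ![0, 1]) : m = n := by
  refine Matrix.ext fun i j => ?_
  have e0 := congrFun h0 i
  have e1 := congrFun h1 i
  fin_cases j
  · simpa [Matrix.mulVec, dotProduct, Fin.sum_univ_two] using e0
  · simpa [Matrix.mulVec, dotProduct, Fin.sum_univ_two] using e1

theorem sp_ext {A B : Sp11} (h0 : act A ![1, 0] = act B ![1, 0])
    (h1 : act A ![0, 1] = act B ![0, 1]) : A = B :=
  Subtype.ext (Units.ext (vec_ext h0 h1))

theorem eq_of_herm_eq {x y : Vec} (h : ∀ z, herm z x = herm z y) : x = y := by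
  have a0 := h ![1, 0]
  have a1 := h ![0, 1]
  ext1 i
  fin_cases i
  · simpa [herm] using a1
  · simpa [herm] using a0

theorem adj_mul_self (A : Sp11) : adj A.val.val * A.val.val = 1 := by
  have h2 : ∀ w, (adj A.val.val * A.val.val) *ᵥ w = w := by
    intro w
    refine eq_of_herm_eq fun z => ?_
    rw [← Matrix.mulVec_mulVec, ← herm_mulVec_left]
    exact A.2 z w
  exact vec_ext (by rw [h2, Matrix.one_mulVec]) (by rw [h2, Matrix.one_mulVec])

theorem adj_coe (A : Sp11) : adj A.val.val = (A⁻¹).val.val := by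
  have h := congrArg (fun m => m * (A⁻¹).val.val) (adj_mul_self A)
  simp only [mul_assoc, one_mul] at h
  have h2 : A.val.val * (A⁻¹).val.val = 1 := A.val.mul_inv
  rwa [h2, mul_one] at h

/-- An element of `Sp(1,1)` from a matrix inverse to its adjoint. -/
def ofUnitary (m : Matrix (Fin 2) (Fin 2) ℍ[ℝ]) (h : adj m * m = 1) (h' : m * adj m = 1) : Sp11 :=
  ⟨⟨m, adj m, h', h⟩, fun z w => by
    change herm (m *ᵥ z) (m *ᵥ w) = _
    rw [herm_mulVec_left, Matrix.mulVec_mulVec, h, Matrix.one_mulVec]⟩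

/-- The element of `Sp(1,1)` that maps the standard null vectors to `p` and `q`. -/
theorem exists_act_eq {p q : Vec} (hp : herm p p = 0) (hq : herm q q = 0) (hpq : herm p q = 1) :
    ∃ F : Sp11, act F ![1, 0] = p ∧ act F ![0, 1] = q := by
  have hqp : herm q p = 1 := by rw [← star_herm, hpq, star_one]
  have h : adj !![p 0, q 0; p 1, q 1] * !![p 0, q 0; p 1, q 1] = 1 := by
    refine Matrix.ext fun i j => ?_
    fin_cases i <;> fin_cases j <;> simp [adj, Matrix.mul_apply, Fin.sum_univ_two]
    · exact hpq
    · exact hq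
    · exact hp
    · exact hqp
  refine ⟨ofUnitary _ h (mul_eq_one_comm.1 h), ?_, ?_⟩
  · ext1 i
    fin_cases i <;> simp [act, ofUnitary, Matrix.mulVec, dotProduct, Fin.sum_univ_two]
  · ext1 i
    fin_cases i <;> simp [act, ofUnitary, Matrix.mulVec, dotProduct, Fin.sum_univ_two]

/-! ### Fixed points of hyperbolic elements -/

theorem star_mul_mul_of_eigen {A : Sp11} {p q : Vec} {μ ν : ℍ[ℝ]} (hp : act A p = rmul p μ)
    (hq : act A q = rmul q ν) : star ν * herm p q * μ = herm p q := by
  have h := herm_act A p q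
  rwa [hp, hq, herm_rmul_left, herm_rmul_right] at h

theorem norm_mul_norm_of_eigen {A : Sp11} {p q : Vec} {μ ν : ℍ[ℝ]} (hp : act A p = rmul p μ)
    (hq : act A q = rmul q ν) (hpq : herm p q ≠ 0) : ‖ν‖ * ‖μ‖ = 1 := by
  have h := congrArg norm (star_mul_mul_of_eigen hp hq)
  rw [norm_mul, norm_mul, norm_star] at h
  have := norm_pos_iff.2 hpq
  field_simp at h
  exact h

/-- Eigenvalues at nonorthogonal eigenvectors have reciprocal moduli. Two moduli below `1` therefore
force orthogonality, and a null vector orthogonal to a null vector lies on its line. -/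
theorem IsAttracting.unique {A : Sp11} {v v' : Vec} (h : IsAttracting A v)
    (h' : IsAttracting A v') : ∃ c, v' = rmul v c := by
  obtain ⟨hv, hv0, μ, hμ, e⟩ := h
  obtain ⟨hv', hv0', μ', hμ', e'⟩ := h'
  refine eq_rmul_of_herm_eq_zero hv hv0 ?_
  by_contra hne
  have := norm_mul_norm_of_eigen e' e hne
  nlinarith [norm_nonneg μ, norm_nonneg μ']

theorem IsRepelling.unique {A : Sp11} {v v' : Vec} (h : IsRepelling A v)
    (h' : IsRepelling A v') : ∃ c, v' = rmul v c := by
  obtain ⟨hv, hv0, μ, hμ, e⟩ := h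
  obtain ⟨hv', hv0', μ', hμ', e'⟩ := h'
  refine eq_rmul_of_herm_eq_zero hv hv0 ?_
  by_contra hne
  have := norm_mul_norm_of_eigen e' e hne
  nlinarith [norm_nonneg μ, norm_nonneg μ']

theorem eq_conj_of_eigen {A : Sp11} {v : Vec} {c μ ν : ℍ[ℝ]} (hv : v ≠ 0) (h : act A v = rmul v μ)
    (h' : act A (rmul v c) = rmul (rmul v c) ν) : μ * c = c * ν := by
  rw [act_rmul, h, rmul_rmul, rmul_rmul] at h'
  exact rmul_right_cancel hv h'

theorem norm_eq_of_eigen {A : Sp11} {v : Vec} {c μ ν : ℍ[ℝ]} (hv : v ≠ 0) (hc : c ≠ 0)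
    (h : act A v = rmul v μ) (h' : act A (rmul v c) = rmul (rmul v c) ν) : ‖μ‖ = ‖ν‖ := by
  have e := congrArg norm (eq_conj_of_eigen hv h h')
  rw [norm_mul, norm_mul, mul_comm] at e
  exact mul_left_cancel₀ (norm_ne_zero_iff.2 hc) e

theorem rmul_zero (v : Vec) : rmul v 0 = 0 := by
  ext1 i
  exact mul_zero _

theorem herm_ne_zero_of_attracting_repelling {A : Sp11} {v w : Vec} (hv : IsAttracting A v)
    (hw : IsRepelling A w) : herm w v ≠ 0 := by
  intro h
  obtain ⟨hv, hv0, μ, hμ, e⟩ := hv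
  obtain ⟨hw, hw0, ν, hν, e'⟩ := hw
  obtain ⟨c, rfl⟩ := eq_rmul_of_herm_eq_zero hv hv0 h
  have hc : c ≠ 0 := by
    rintro rfl
    exact hw (rmul_zero v)
  have := norm_eq_of_eigen hv hc e e'
  linarith

/-- Two null vectors that are not orthogonal can be moved to the standard ones. -/
theorem exists_frame {v w : Vec} (hv : herm v v = 0) (hw : herm w w = 0) (hwv : herm w v ≠ 0) :
    ∃ F : Sp11, act F ![0, 1] = v ∧ ∃ c, c ≠ 0 ∧ act F ![1, 0] = rmul w c := by
  obtain ⟨F, h0, h1⟩ := exists_act_eq (p := rmul w (herm w v)⁻¹) (q := v)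
    (by rw [herm_rmul_left, herm_rmul_right, hw]; simp) hv
    (by rw [herm_rmul_left, mul_inv_cancel₀ hwv])
  exact ⟨F, h1, _, inv_ne_zero hwv, h0⟩

theorem vec_eq_add (x : Vec) : x = rmul ![1, 0] (x 0) + rmul ![0, 1] (x 1) := by
  ext1 i
  fin_cases i <;> simp [rmul]

theorem diag_mulVec (a b : ℍ[ℝ]) (x : Vec) : !![a, 0; 0, b] *ᵥ x = ![a * x 0, b * x 1] := by
  ext1 i
  fin_cases i <;> simp [Matrix.mulVec, dotProduct, Fin.sum_univ_two]

theorem eq_diag_of_eigen {A F : Sp11} {μ ν : ℍ[ℝ]}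
    (h1 : act A (act F ![0, 1]) = rmul (act F ![0, 1]) μ)
    (h0 : act A (act F ![1, 0]) = rmul (act F ![1, 0]) ν) :
    (F⁻¹ * A * F).val.val = !![ν, 0; 0, μ] ∧ star μ * ν = 1 := by
  have e0 : act (F⁻¹ * A * F) ![1, 0] = rmul ![1, 0] ν := by
    rw [act_mul, act_mul, h0, act_rmul, act_inv_act]
  have e1 : act (F⁻¹ * A * F) ![0, 1] = rmul ![0, 1] μ := by
    rw [act_mul, act_mul, h1, act_rmul, act_inv_act]
  refine ⟨vec_ext ?_ ?_, ?_⟩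
  · refine e0.trans ?_
    rw [diag_mulVec]
    ext1 i
    fin_cases i <;> simp [rmul]
  · refine e1.trans ?_
    rw [diag_mulVec]
    ext1 i
    fin_cases i <;> simp [rmul]
  · have := star_mul_mul_of_eigen e0 e1
    simpa [herm] using this

/-- Diagonalization of an element with an attracting and a repelling fixed point. -/
theorem exists_diag {A : Sp11} {v w : Vec} (hv : IsAttracting A v) (hw : IsRepelling A w) :
    ∃ (F : Sp11) (μ ν : ℍ[ℝ]), act F ![0, 1] = v ∧ (∃ c, c ≠ 0 ∧ act F ![1, 0] = rmul w c) ∧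
      (F⁻¹ * A * F).val.val = !![ν, 0; 0, μ] ∧ ‖μ‖ < 1 ∧ 1 < ‖ν‖ ∧ star μ * ν = 1 ∧
      act A v = rmul v μ := by
  obtain ⟨F, h1, c, hc, h0⟩ := exists_frame hv.2.1 hw.2.1
    (herm_ne_zero_of_attracting_repelling hv hw)
  obtain ⟨hv, hv0, μ, hμ, e⟩ := hv
  obtain ⟨hw, hw0, ν, hν, e'⟩ := hw
  have e'' : act A (rmul w c) = rmul (rmul w c) (c⁻¹ * ν * c) := by
    rw [act_rmul, e', rmul_rmul, rmul_rmul, mul_assoc, mul_inv_cancel_left₀ hc]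
  obtain ⟨hd, hs⟩ := eq_diag_of_eigen (A := A) (F := F) (μ := μ) (ν := c⁻¹ * ν * c)
    (by rw [h1, e]) (by rw [h0, e''])
  refine ⟨F, μ, c⁻¹ * ν * c, h1, ⟨c, hc, h0⟩, hd, hμ, ?_, hs, e⟩
  rwa [← norm_eq_of_eigen hw hc e' e'']

theorem exists_imaginary_commuting (μ : ℍ[ℝ]) : ∃ z : ℍ[ℝ], z ≠ 0 ∧ z.re = 0 ∧ μ * z = z * μ := by
  by_cases h : μ.im = 0
  · refine ⟨⟨0, 1, 0, 0⟩, ?_, rfl, ?_⟩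
    · intro h0
      have := congrArg (fun q : ℍ[ℝ] => q.imI) h0
      simp at this
    · have : μ = (μ.re : ℍ[ℝ]) := by
        conv_lhs => rw [← Quaternion.re_add_im μ, h, add_zero]
      rw [this]
      exact Quaternion.coe_commutes _ _
  · refine ⟨μ.im, h, by simp, ?_⟩
    have : μ = (μ.re : ℍ[ℝ]) + μ.im := (Quaternion.re_add_im μ).symm
    conv_lhs => rw [this]
    conv_rhs => rw [this]
    simp only [Quaternion.im_add, Quaternion.im_coe, zero_add, Quaternion.im_idem, add_mul, mul_add]
    rw [Quaternion.coe_commutes]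

/-- The moduli at the two fixed points are reciprocal, so only modulus `1` must be excluded. In that
case the element is `diag(μ, μ)` in a suitable frame, and `(z, 1)` with `z ≠ 0` imaginary and
commuting with `μ` is a third null fixed line. -/
theorem IsHyperbolic.exists_attracting_repelling {A : Sp11} (hA : IsHyperbolic A) :
    ∃ v w, IsAttracting A v ∧ IsRepelling A w := by
  obtain ⟨P, Q, hPQ, hS⟩ := Set.ncard_eq_two.1 hA
  have hP : P ∈ {p | p ∈ bdry ∧ move A p = p} := by simp [hS]
  have hQ : Q ∈ {p | p ∈ bdry ∧ move A p = p} := by simp [hS]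
  induction P using Projectivization.ind with | _ v hv
  induction Q using Projectivization.ind with | _ w hw
  obtain ⟨hv0, hμ⟩ := hP
  obtain ⟨hw0, hν⟩ := hQ
  rw [mk_mem_bdry] at hv0 hw0
  obtain ⟨μ, hμ⟩ := (move_mk_eq_iff A hv).1 hμ
  obtain ⟨ν, hν⟩ := (move_mk_eq_iff A hw).1 hν
  have hne : herm w v ≠ 0 := by
    intro h
    obtain ⟨c, hc⟩ := eq_rmul_of_herm_eq_zero hv hv0 h
    exact hPQ ((mk_eq_mk_iff hw hv).2 ⟨c, hc.symm⟩).symm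
  have hn := norm_mul_norm_of_eigen hν hμ hne
  rcases lt_trichotomy ‖μ‖ 1 with hlt | heq | hgt
  · refine ⟨v, w, ⟨hv, hv0, μ, hlt, hμ⟩, ⟨hw, hw0, ν, ?_, hν⟩⟩
    nlinarith [norm_nonneg μ, norm_nonneg ν]
  · exfalso
    obtain ⟨F, h1, c, hc, h0⟩ := exists_frame hv0 hw0 hne
    have e'' : act A (rmul w c) = rmul (rmul w c) (c⁻¹ * ν * c) := by
      rw [act_rmul, hν, rmul_rmul, rmul_rmul, mul_assoc, mul_inv_cancel_left₀ hc]
    obtain ⟨hd, hs⟩ := eq_diag_of_eigen (A := A) (F := F) (μ := μ) (ν := c⁻¹ * ν * c)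
      (by rw [h1, hμ]) (by rw [h0, e''])
    have hμμ : star μ * μ = 1 := by
      rw [Quaternion.star_mul_self, Quaternion.normSq_eq_norm_mul_self, heq]
      simp
    have hνμ : c⁻¹ * ν * c = μ := by
      have : star μ ≠ 0 := by
        intro h
        rw [h, zero_mul] at hμμ
        exact zero_ne_one hμμ
      exact mul_left_cancel₀ this (hs.trans hμμ.symm)
    obtain ⟨z, hz, hzre, hzμ⟩ := exists_imaginary_commuting μ
    set x : Vec := ![z, 1] with hxdef
    have hx : x ≠ 0 := fun h => by simpa [hxdef] using congrFun h 1
    have hAx : act A (act F x) = rmul (act F x) μ := by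
      rw [vec_eq_add x, act_add, act_rmul, act_rmul, h1, h0, act_add, act_rmul A (rmul w c),
        act_rmul A v, hμ, e'', hνμ]
      ext1 i
      simp [rmul, hxdef, add_mul, mul_assoc, hzμ]
    have hmem : Projectivization.mk ℍ[ℝ]ᵐᵒᵖ (act F x) (act_ne_zero F hx) ∈
        {p | p ∈ bdry ∧ move A p = p} := by
      refine ⟨(mk_mem_bdry _).2 ?_, (move_mk_eq_iff A _).2 ⟨μ, hAx⟩⟩
      rw [herm_act]
      simp only [herm, hxdef]
      ext <;> simp [hzre]
    rw [hS] at hmem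
    rcases hmem with hmem | hmem
    · obtain ⟨a, ha⟩ := (mk_eq_mk_iff _ _).1 hmem
      rw [← h1, ← act_rmul] at ha
      have := congrFun (toLin_injective F ha) 0
      simp only [rmul, hxdef] at this
      simp at this
      exact hz this.symm
    · obtain ⟨a, ha⟩ := (mk_eq_mk_iff _ _).1 hmem
      have hw' : w = rmul (act F ![1, 0]) c⁻¹ := by
        rw [h0, rmul_rmul, mul_inv_cancel₀ hc, rmul_one]
      rw [hw', rmul_rmul, ← act_rmul] at ha
      have := congrFun (toLin_injective F ha) 1
      simp [rmul, hxdef] at this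
  · refine ⟨w, v, ⟨hw, hw0, ν, ?_, hν⟩, ⟨hv, hv0, μ, hgt, hμ⟩⟩
    nlinarith [norm_nonneg μ, norm_nonneg ν]

/-! ### The commutant of an irreducible pair -/

/-- Each off-diagonal entry intertwines `μ` and `ν`; as their norms differ, it vanishes. -/
theorem eq_diag_of_commute_diag {m : Matrix (Fin 2) (Fin 2) ℍ[ℝ]} {μ ν : ℍ[ℝ]} (h : ‖μ‖ < ‖ν‖)
    (hm : m * !![ν, 0; 0, μ] = !![ν, 0; 0, μ] * m) : m = !![m 0 0, 0; 0, m 1 1] := by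
  have e01 := congrFun (congrFun hm 0) 1
  have e10 := congrFun (congrFun hm 1) 0
  simp [Matrix.mul_apply, Fin.sum_univ_two] at e01 e10
  have z01 : m 0 1 = 0 := by
    by_contra hne
    have := congrArg norm e01
    rw [norm_mul, norm_mul, mul_comm] at this
    exact h.ne (mul_right_cancel₀ (norm_ne_zero_iff.2 hne) this)
  have z10 : m 1 0 = 0 := by
    by_contra hne
    have := congrArg norm e10
    rw [norm_mul, norm_mul, mul_comm] at this
    exact h.ne' (mul_right_cancel₀ (norm_ne_zero_iff.2 hne) this)
  refine Matrix.ext fun i j => ?_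
  fin_cases i <;> fin_cases j <;> simp [z01, z10]

/-- An invariant subset cut out by a condition on lifts. -/
def cutOut (C : Vec → Prop) : Set HP1 :=
  {p | ∃ (v : Vec) (hv : v ≠ 0), p = Projectivization.mk ℍ[ℝ]ᵐᵒᵖ v hv ∧ (herm v v).re < 0 ∧ C v}

theorem mk_mem_cutOut {C : Vec → Prop} (hC : ∀ v q, q ≠ 0 → C v → C (rmul v q)) {v : Vec}
    (hv : v ≠ 0) :
    Projectivization.mk ℍ[ℝ]ᵐᵒᵖ v hv ∈ cutOut C ↔ (herm v v).re < 0 ∧ C v := by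
  constructor
  · rintro ⟨w, hw, h, hneg, hCw⟩
    refine ⟨?_, ?_⟩
    · rwa [← mk_mem_hypSpace hv, h, mk_mem_hypSpace]
    · obtain ⟨q, rfl⟩ := (mk_eq_mk_iff _ _).1 h
      refine hC _ _ ?_ hCw
      rintro rfl
      exact hv (rmul_zero w)
  · rintro ⟨h1, h2⟩
    exact ⟨v, hv, rfl, h1, h2⟩

theorem move_image_cutOut {C : Vec → Prop} (A : Sp11) (hC : ∀ v, C v ↔ C (act A v)) :
    move A '' cutOut C = cutOut C := by
  ext p
  constructor
  · rintro ⟨_, ⟨v, hv, rfl, hneg, hCv⟩, rfl⟩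
    exact ⟨act A v, act_ne_zero A hv, rfl, by rwa [herm_act], (hC v).1 hCv⟩
  · rintro ⟨v, hv, rfl, hneg, hCv⟩
    refine ⟨Projectivization.mk ℍ[ℝ]ᵐᵒᵖ (act A⁻¹ v) (act_ne_zero _ hv),
      ⟨_, _, rfl, by rwa [herm_act], ?_⟩, ?_⟩
    · rw [hC, act_act_inv]
      exact hCv
    · rw [move_mk]
      congr 1
      exact act_act_inv A v

/-- If a condition on lifts is invariant and passes to real combinations of lifts with real
product, an irreducible pair satisfies it on all negative vectors or on none. -/
theorem IsIrreduciblePair.cutOut_false {A B : Sp11} (h : IsIrreduciblePair A B) {C : Vec → Prop}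
    (hC : ∀ v q, q ≠ 0 → C v → C (rmul v q)) (hA : ∀ v, C v ↔ C (act A v))
    (hB : ∀ v, C v ↔ C (act B v))
    (hgeo : ∀ (x y : Vec) (r a b : ℝ), (herm x x).re < 0 → (herm y y).re < 0 → C x → C y →
      herm x y = (r : ℍ[ℝ]) → C (a • x + b • y))
    {x y : Vec} (hx : (herm x x).re < 0) (hCx : C x) (hy : (herm y y).re < 0) (hCy : ¬ C y) :
    False := by
  have ne_zero_of_neg : ∀ {v : Vec}, (herm v v).re < 0 → v ≠ 0 := by
    rintro v hv rfl
    simp [herm] at hv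
  refine h.2 ⟨cutOut C, ⟨_, x, ne_zero_of_neg hx, rfl, hx, hCx⟩, ?_, ⟨?_, ?_⟩,
    move_image_cutOut A hA, move_image_cutOut B hB⟩
  · intro heq
    have : Projectivization.mk ℍ[ℝ]ᵐᵒᵖ y (ne_zero_of_neg hy) ∈ cutOut C := by
      rw [heq]
      exact (mk_mem_hypSpace _).2 hy
    exact hCy ((mk_mem_cutOut hC _).1 this).2
  · rintro _ ⟨v, hv, rfl, hneg, -⟩
    exact (mk_mem_hypSpace _).2 hneg
  · rintro x y z hx hy hz r a b hxS hyS hxy rfl hzh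
    rw [mk_mem_cutOut hC] at hxS hyS ⊢
    exact ⟨(mk_mem_hypSpace _).1 hzh, hgeo x y r a b hxS.1 hyS.1 hxS.2 hyS.2 hxy⟩

theorem coe_ne_zero {r : ℝ} (hr : r ≠ 0) : (r : ℍ[ℝ]) ≠ 0 := fun h =>
  hr (by simpa using congrArg (fun q : ℍ[ℝ] => q.re) h)

theorem quaternion_two_ne_zero : (2 : ℍ[ℝ]) ≠ 0 := coe_ne_zero (r := 2) two_ne_zero

theorem adj_add (m n : Matrix (Fin 2) (Fin 2) ℍ[ℝ]) : adj (m + n) = adj m + adj n :=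
  adjoint.toLin.map_add m n

theorem adj_sub (m n : Matrix (Fin 2) (Fin 2) ℍ[ℝ]) : adj (m - n) = adj m - adj n :=
  adjoint.toLin.map_sub m n

theorem adj_smul (r : ℝ) (m : Matrix (Fin 2) (Fin 2) ℍ[ℝ]) : adj (r • m) = r • adj m :=
  adjoint.toLin.map_smul r m

theorem adj_one : adj (1 : Matrix (Fin 2) (Fin 2) ℍ[ℝ]) = 1 := by
  refine Matrix.ext fun i j => ?_
  fin_cases i <;> fin_cases j <;> simp [adj]

theorem mulVec_act_of_commute {m : Matrix (Fin 2) (Fin 2) ℍ[ℝ]} {A : Sp11}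
    (h : m * A.val.val = A.val.val * m) (v : Vec) : m *ᵥ act A v = act A (m *ᵥ v) := by
  rw [act, act, Matrix.mulVec_mulVec, Matrix.mulVec_mulVec, h]

theorem commute_adj {m : Matrix (Fin 2) (Fin 2) ℍ[ℝ]} {A : Sp11}
    (h : m * A.val.val = A.val.val * m) : adj m * A.val.val = A.val.val * adj m := by
  have e := congrArg adj h
  rw [adj_mul, adj_mul, adj_coe] at e
  have e1 : A.val.val * (A⁻¹).val.val = 1 := A.val.mul_inv
  have e2 : (A⁻¹).val.val * A.val.val = 1 := A.val.inv_mul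
  calc adj m * A.val.val = A.val.val * (A⁻¹).val.val * adj m * A.val.val := by rw [e1, one_mul]
    _ = A.val.val * (adj m * (A⁻¹).val.val) * A.val.val := by rw [← e]; simp only [mul_assoc]
    _ = A.val.val * adj m := by simp only [mul_assoc, e2, mul_one]

/-- Since `s` is self-adjoint, `⟨s v, v⟩` is real, so its vanishing is one real equation on the
hyperbolic line, viewed as real hyperbolic 4-space. It cuts out an invariant hyperplane; `s² = -c`
is what makes it totally geodesic. -/
theorem IsIrreduciblePair.not_symmetric_complex {A B : Sp11} (h : IsIrreduciblePair A B)
    {s : Matrix (Fin 2) (Fin 2) ℍ[ℝ]} (hs : adj s = s) (hA : s * A.val.val = A.val.val * s)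
    (hB : s * B.val.val = B.val.val * s) {c : ℝ} (hc : 0 < c) (hsq : ∀ v, s *ᵥ s *ᵥ v = -(c • v))
    {x y : Vec} (hx : (herm x x).re < 0) (hCx : herm (s *ᵥ x) x = 0) (hy : (herm y y).re < 0)
    (hCy : herm (s *ᵥ y) y ≠ 0) : False := by
  have sym : ∀ v w, herm (s *ᵥ v) w = herm v (s *ᵥ w) := fun v w => by
    rw [herm_mulVec_left, hs]
  refine h.cutOut_false (C := fun v => herm (s *ᵥ v) v = 0) ?_ ?_ ?_ ?_ hx hCx hy hCy
  · intro v q _ hv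
    rw [mulVec_rmul, herm_rmul_left, herm_rmul_right, hv]
    simp
  · intro v
    rw [mulVec_act_of_commute hA, herm_act]
  · intro v
    rw [mulVec_act_of_commute hB, herm_act]
  · intro x y r a b hx hy hCx hCy hxy
    set n := (herm x x).re with hn
    have hyx : herm y x = (r : ℍ[ℝ]) := by rw [← star_herm, hxy, Quaternion.star_coe]
    have hr : r ≠ 0 := by
      rintro rfl
      exact herm_ne_zero_of_neg hx hy (by rw [hxy]; simp)
    have hss : herm (s *ᵥ x) (s *ᵥ x) = ((-(c * n) : ℝ) : ℍ[ℝ]) := by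
      have := herm_smul_right (-c) x x
      rw [sym, hsq, ← neg_smul, this, herm_self x, ← hn, ← Quaternion.coe_smul]
      simp
    have hcn : 0 < -(c * n) := by nlinarith
    set k : ℝ := (-(c * n))⁻¹ with hk
    set β : ℍ[ℝ] := (k : ℍ[ℝ]) * herm y (s *ᵥ x) with hβ
    -- The vectors `x` and `s x` are orthogonal, with negative and positive norm, hence form a
    -- basis; this is the expansion of `y` in it.
    have hy' : y - (r / n) • x - rmul (s *ᵥ x) β = 0 := by
      refine eq_zero_of_orthogonal (z := x) (z' := s *ᵥ x) hx ?_ ?_ ?_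
      · rw [hss, Quaternion.re_coe]
        exact hcn
      · rw [herm_sub_left, herm_sub_left, herm_smul_left, herm_rmul_left, hCx, hyx, herm_self x,
          ← hn, ← Quaternion.coe_smul]
        have : r / n * n = r := div_mul_cancel₀ r hx.ne
        simp [this]
      · rw [herm_sub_left, herm_sub_left, herm_smul_left, herm_rmul_left, hss, ← sym x, hCx, hβ,
          ← mul_assoc, ← Quaternion.coe_mul, hk, mul_inv_cancel₀ hcn.ne']
        simp
    have hyeq : y = (r / n) • x + rmul (s *ᵥ x) β := by
      rw [sub_sub, sub_eq_zero] at hy'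
      exact hy'
    have hsy : s *ᵥ y = (r / n) • (s *ᵥ x) + rmul (-(c • x)) β := by
      conv_lhs => rw [hyeq]
      rw [Matrix.mulVec_add, mulVec_rmul, hsq, Matrix.mulVec_smul]
    -- In this basis the condition on `y` says that `β` is imaginary. So `⟨s x, y⟩` is imaginary,
    -- and the two mixed terms of a real combination, conjugate to each other, cancel.
    have hβre : β.re = 0 := by
      rw [hsy] at hCy
      conv_lhs at hCy => rw [hyeq]
      have e1 : herm (-(c • x)) (s *ᵥ x) = 0 := by
        rw [← neg_smul, herm_smul_left, ← sym, hCx, smul_zero]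
      have e2 : herm (-(c • x)) x = ((-(c * n) : ℝ) : ℍ[ℝ]) := by
        rw [← neg_smul, herm_smul_left, herm_self x, ← hn, ← Quaternion.coe_smul]
        simp
      rw [herm_add_left, herm_add_right, herm_add_right, herm_smul_left, herm_smul_right,
        hCx, herm_smul_left, herm_rmul_right, hss, herm_rmul_left, herm_smul_right, e2,
        herm_rmul_left, herm_rmul_right, e1] at hCy
      have := congrArg (fun q : ℍ[ℝ] => q.re) hCy
      simp at this
      have h3 : (r / n) * (c * n) * (2 * β.re) = 0 := by linear_combination -this
      have h4 : (r / n) * (c * n) ≠ 0 :=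
        mul_ne_zero (div_ne_zero hr hx.ne) (mul_ne_zero hc.ne' hx.ne)
      have := (mul_eq_zero.1 h3).resolve_left h4
      linarith
    have hre : (herm y (s *ᵥ x)).re = 0 := by
      rw [hβ] at hβre
      have hk0 : k ≠ 0 := inv_ne_zero hcn.ne'
      simpa [hk0] using hβre
    have e3 : herm (s *ᵥ y) x = star (herm (s *ᵥ x) y) := by rw [star_herm, sym]
    have e4 : (herm (s *ᵥ x) y).re = 0 := by
      rw [← star_herm, Quaternion.re_star, hre]
    change herm (s *ᵥ (a • x + b • y)) (a • x + b • y) = 0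
    rw [Matrix.mulVec_add, Matrix.mulVec_smul, Matrix.mulVec_smul, herm_add_left, herm_add_right,
      herm_add_right]
    simp only [herm_smul_left, herm_smul_right, hCx, hCy, e3]
    generalize herm (s *ᵥ x) y = q at e4
    ext <;> simp [e4] <;> ring

/-- The negative eigenlines of `s` form an invariant set. Skewness gives `a = -b̄` for the
eigenvalues at lifts with nonzero real product; comparison of `y` with itself gives `b = -b̄`. So
both lifts have the same eigenvalue, and real combinations are again eigenvectors. -/
theorem IsIrreduciblePair.not_skew_complex {A B : Sp11} (h : IsIrreduciblePair A B)
    {s : Matrix (Fin 2) (Fin 2) ℍ[ℝ]} (hs : adj s = -s) (hA : s * A.val.val = A.val.val * s)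
    (hB : s * B.val.val = B.val.val * s)
    {x y : Vec} (hx : (herm x x).re < 0) (hCx : ∃ a, s *ᵥ x = rmul x a) (hy : (herm y y).re < 0)
    (hCy : ¬ ∃ a, s *ᵥ y = rmul y a) : False := by
  have key : ∀ {x y : Vec} {a b : ℍ[ℝ]} {r : ℝ}, r ≠ 0 → s *ᵥ x = rmul x a → s *ᵥ y = rmul y b →
      herm x y = (r : ℍ[ℝ]) → a = - star b := by
    intro x y a b r hr hxa hyb hxy
    have e : herm (s *ᵥ x) y = -herm x (s *ᵥ y) := by
      have := herm_smul_right (-1) (s *ᵥ y) x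
      rw [herm_mulVec_left, hs, Matrix.neg_mulVec, ← neg_one_smul ℝ (s *ᵥ y), this]
      simp
    rw [hxa, hyb, herm_rmul_left, herm_rmul_right, hxy, ← neg_mul,
      ← Quaternion.coe_commutes r (-star b)] at e
    exact mul_left_cancel₀ (coe_ne_zero hr) e
  have inv : ∀ {A : Sp11}, s * A.val.val = A.val.val * s →
      ∀ v, (∃ a, s *ᵥ v = rmul v a) ↔ ∃ a, s *ᵥ act A v = rmul (act A v) a := by
    intro A hA v
    refine exists_congr fun a => ?_
    rw [mulVec_act_of_commute hA, ← act_rmul]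
    exact ⟨fun h => by rw [h], fun h => toLin_injective A h⟩
  refine h.cutOut_false (C := fun v => ∃ a, s *ᵥ v = rmul v a) ?_ (inv hA) (inv hB) ?_ hx hCx hy hCy
  · rintro v q hq ⟨a, ha⟩
    exact ⟨q⁻¹ * a * q, by rw [mulVec_rmul, ha, rmul_rmul, rmul_rmul, mul_assoc,
      mul_inv_cancel_left₀ hq]⟩
  · rintro x y r t u hx hy ⟨a, ha⟩ ⟨b, hb⟩ hxy
    have hr : r ≠ 0 := by
      rintro rfl
      exact herm_ne_zero_of_neg hx hy (by rw [hxy]; simp)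
    have h1 := key hr ha hb hxy
    have h2 := key hy.ne hb hb (herm_self y)
    have hab : a = b := h1.trans h2.symm
    refine ⟨a, ?_⟩
    rw [Matrix.mulVec_add, Matrix.mulVec_smul, Matrix.mulVec_smul, ha, hb, hab]
    ext1 i
    simp [rmul, add_mul]

theorem exists_imaginary_not_commuting {p : ℍ[ℝ]} (hp : p.im ≠ 0) :
    ∃ w : ℍ[ℝ], w.re = 0 ∧ p * w ≠ w * p := by
  by_contra! hcon
  obtain ⟨i, hi0, hi1, hi2, hi3⟩ : ∃ i : ℍ[ℝ], i.re = 0 ∧ i.imI = 1 ∧ i.imJ = 0 ∧ i.imK = 0 :=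
    ⟨⟨0, 1, 0, 0⟩, rfl, rfl, rfl, rfl⟩
  obtain ⟨j, hj0, hj1, hj2, hj3⟩ : ∃ i : ℍ[ℝ], i.re = 0 ∧ i.imI = 0 ∧ i.imJ = 1 ∧ i.imK = 0 :=
    ⟨⟨0, 0, 1, 0⟩, rfl, rfl, rfl, rfl⟩
  have e1 := congrArg (fun q : ℍ[ℝ] => q.imJ) (hcon i hi0)
  have e2 := congrArg (fun q : ℍ[ℝ] => q.imK) (hcon i hi0)
  have e3 := congrArg (fun q : ℍ[ℝ] => q.imK) (hcon j hj0)
  simp [hi0, hi1, hi2, hi3, hj0, hj1, hj2, hj3] at e1 e2 e3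
  apply hp
  ext
  · simp
  · simp
    linarith
  · simp
    linarith
  · simp
    linarith

theorem quaternion_im_sq (p : ℍ[ℝ]) : p.im * p.im = ((-Quaternion.normSq p.im : ℝ) : ℍ[ℝ]) := by
  have : star p.im = -p.im := by ext <;> simp
  rw [Quaternion.coe_neg, ← Quaternion.self_mul_star, this]
  simp

section Commutant

variable {A B F : Sp11} {μ ν : ℍ[ℝ]}

theorem exists_mul_eq_mul_diag (hd : (F⁻¹ * A * F).val.val = !![ν, 0; 0, μ]) (hμν : ‖μ‖ < ‖ν‖)
    {m : Matrix (Fin 2) (Fin 2) ℍ[ℝ]} (hA : m * A.val.val = A.val.val * m) :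
    ∃ p t, m * F.val.val = F.val.val * !![p, 0; 0, t] := by
  have e1 : F.val.val * (F⁻¹).val.val = 1 := F.val.mul_inv
  have hd' : (F⁻¹).val.val * A.val.val * F.val.val = !![ν, 0; 0, μ] := hd
  set n := (F⁻¹).val.val * m * F.val.val with hn
  have hn' : F.val.val * n = m * F.val.val := by
    rw [hn, mul_assoc, ← mul_assoc, e1, one_mul]
  have hcomm : n * !![ν, 0; 0, μ] = !![ν, 0; 0, μ] * n := by
    rw [← hd', hn]
    calc _ = (F⁻¹).val.val * m * (F.val.val * (F⁻¹).val.val) * A.val.val * F.val.val := by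
          simp only [mul_assoc]
      _ = (F⁻¹).val.val * (m * A.val.val) * F.val.val := by
          rw [e1]
          simp only [mul_assoc, one_mul]
      _ = (F⁻¹).val.val * A.val.val * (F.val.val * (F⁻¹).val.val) * m * F.val.val := by
          rw [e1, hA]
          simp only [mul_assoc, one_mul]
      _ = _ := by simp only [mul_assoc]
  refine ⟨n 0 0, n 1 1, ?_⟩
  rw [← eq_diag_of_commute_diag hμν hcomm, hn']

theorem adj_mul_eq_mul_diag {m : Matrix (Fin 2) (Fin 2) ℍ[ℝ]} {p t : ℍ[ℝ]}
    (h : m * F.val.val = F.val.val * !![p, 0; 0, t]) :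
    adj m * F.val.val = F.val.val * !![star t, 0; 0, star p] := by
  have e1 : F.val.val * (F⁻¹).val.val = 1 := F.val.mul_inv
  have e2 : (F⁻¹).val.val * F.val.val = 1 := F.val.inv_mul
  have e := congrArg adj h
  rw [adj_mul, adj_mul, adj_coe] at e
  have e3 : adj !![p, 0; 0, t] = !![star t, 0; 0, star p] := by simp [adj]
  rw [e3] at e
  calc adj m * F.val.val = F.val.val * ((F⁻¹).val.val * adj m) * F.val.val := by
        rw [← mul_assoc, e1, one_mul]
    _ = _ := by rw [e, mul_assoc, mul_assoc, e2, mul_one]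

theorem diag_eq_of_mul_eq {m n : Matrix (Fin 2) (Fin 2) ℍ[ℝ]}
    (h : F.val.val * m = F.val.val * n) : m = n := by
  have e2 : (F⁻¹).val.val * F.val.val = 1 := F.val.inv_mul
  rw [← one_mul m, ← e2, mul_assoc, h, ← mul_assoc, e2, one_mul]

theorem eq_of_mul_eq {m n : Matrix (Fin 2) (Fin 2) ℍ[ℝ]}
    (h : m * F.val.val = n * F.val.val) : m = n := by
  have e2 : F.val.val * (F⁻¹).val.val = 1 := F.val.mul_inv
  rw [← mul_one m, ← e2, ← mul_assoc, h, mul_assoc, e2, mul_one]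

theorem mulVec_act_diag {m : Matrix (Fin 2) (Fin 2) ℍ[ℝ]} {p t : ℍ[ℝ]}
    (h : m * F.val.val = F.val.val * !![p, 0; 0, t]) (u w : ℍ[ℝ]) :
    m *ᵥ act F ![u, w] = act F ![p * u, t * w] := by
  rw [act, Matrix.mulVec_mulVec, h, ← Matrix.mulVec_mulVec, diag_mulVec]
  rfl

/-- In the frame that diagonalizes `A` a self-adjoint commuting `s` is `diag(p, p̄)`. Minus the real
part of `p` it squares to `-|Im p|²`, and `Im p ≠ 0` would produce an invariant hyperplane. -/
theorem IsIrreduciblePair.symmetric_eq_smul_one (hirr : IsIrreduciblePair A B)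
    (hd : (F⁻¹ * A * F).val.val = !![ν, 0; 0, μ]) (hμν : ‖μ‖ < ‖ν‖)
    {s : Matrix (Fin 2) (Fin 2) ℍ[ℝ]} (hs : adj s = s) (hA : s * A.val.val = A.val.val * s)
    (hB : s * B.val.val = B.val.val * s) : ∃ r : ℝ, s = r • 1 := by
  obtain ⟨p, t, hp⟩ := exists_mul_eq_mul_diag hd hμν hA
  have ht : t = star p := by
    have h1 := adj_mul_eq_mul_diag hp
    rw [hs, hp] at h1
    have := congrFun (congrFun (diag_eq_of_mul_eq h1) 1) 1
    simpa using this
  have hs1 : (s - p.re • 1) * F.val.val = F.val.val * !![p.im, 0; 0, -p.im] := by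
    have e : !![p.im, 0; 0, -p.im] = !![p, 0; 0, t] - p.re • (1 : Matrix (Fin 2) (Fin 2) ℍ[ℝ]) := by
      refine Matrix.ext fun i j => ?_
      fin_cases i <;> fin_cases j <;> simp [ht] <;> ext <;> simp
    rw [e, sub_mul, mul_sub, hp]
    simp
  by_cases him : p.im = 0
  · refine ⟨p.re, ?_⟩
    rw [← sub_eq_zero]
    apply eq_of_mul_eq (F := F)
    rw [hs1, him]
    refine Matrix.ext fun i j => ?_
    fin_cases i <;> fin_cases j <;> simp [Matrix.mul_apply, Fin.sum_univ_two]
  · exfalso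
    have hc : 0 < Quaternion.normSq p.im :=
      lt_of_le_of_ne Quaternion.normSq_nonneg (Ne.symm (Quaternion.normSq_ne_zero.2 him))
    have hst : star p.im = -p.im := by ext <;> simp
    have hsq : ∀ v, (s - p.re • 1) *ᵥ (s - p.re • 1) *ᵥ v = -(Quaternion.normSq p.im • v) := by
      intro v
      have hv : v = act F ![(act F⁻¹ v) 0, (act F⁻¹ v) 1] := by
        conv_lhs => rw [← act_act_inv F v]
        congr 1
        ext1 i
        fin_cases i <;> simp
      rw [hv, mulVec_act_diag hs1, mulVec_act_diag hs1, ← mul_assoc, ← mul_assoc, neg_mul_neg,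
        quaternion_im_sq, ← neg_smul, ← rmul_coe, ← act_rmul]
      congr 1
      ext1 i
      fin_cases i <;> simp [rmul, Quaternion.coe_commutes]
    -- For a lift `(-1 + w, 1)` with `w` imaginary the condition reads `(Im p) w + w (Im p) = 0`: it
    -- holds for `w = 0` and fails for `w = Im p`.
    refine hirr.not_symmetric_complex (s := s - p.re • 1) ?_ ?_ ?_ hc hsq
      (x := act F ![-1, 1]) (y := act F ![-1 + p.im, 1]) ?_ ?_ ?_ ?_
    · rw [adj_sub, adj_smul, adj_one, hs]
    · rw [sub_mul, mul_sub, hA]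
      simp
    · rw [sub_mul, mul_sub, hB]
      simp
    · rw [herm_act]
      simp [herm]
    · rw [mulVec_act_diag hs1, herm_act]
      simp [herm]
    · rw [herm_act]
      simp [herm]
    · rw [mulVec_act_diag hs1, herm_act]
      have : herm ![p.im * (-1 + p.im), -p.im * 1] ![-1 + p.im, 1] = 2 * (p.im * p.im) := by
        simp [herm, mul_add, add_mul, hst]
        noncomm_ring
      rw [this]
      exact mul_ne_zero quaternion_two_ne_zero (mul_ne_zero him him)

/-- In the diagonalizing frame `z` is `diag(p, -p̄)`. Its square is self-adjoint and in the
commutant, so `p²` is real and `p` is real or imaginary. If `p` is real and nonzero, the two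
eigenlines of `z` are distinguished by the eigenvalues `±p`, and `B` must fix the fixed points of
`A`; if `p` is imaginary and nonzero, the eigenlines of `diag(p, p)` fill an invariant proper
subspace. -/
theorem IsIrreduciblePair.skew_eq_zero (hirr : IsIrreduciblePair A B)
    (hd : (F⁻¹ * A * F).val.val = !![ν, 0; 0, μ]) (hμν : ‖μ‖ < ‖ν‖)
    {z : Matrix (Fin 2) (Fin 2) ℍ[ℝ]} (hz : adj z = -z) (hA : z * A.val.val = A.val.val * z)
    (hB : z * B.val.val = B.val.val * z) : z = 0 := by
  obtain ⟨p, t, hp⟩ := exists_mul_eq_mul_diag hd hμν hA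
  have ht : t = -star p := by
    have h1 := adj_mul_eq_mul_diag hp
    rw [hz, neg_mul, hp, ← mul_neg] at h1
    have := congrFun (congrFun (diag_eq_of_mul_eq h1) 1) 1
    simp at this
    rw [← this, neg_neg]
  obtain ⟨r, hr⟩ := hirr.symmetric_eq_smul_one hd hμν (s := z * z)
    (by rw [adj_mul, hz, neg_mul_neg]) (by rw [mul_assoc, hA, ← mul_assoc, hA, mul_assoc])
    (by rw [mul_assoc, hB, ← mul_assoc, hB, mul_assoc])
  have hpp : p * p = (r : ℍ[ℝ]) := by
    have h1 : F.val.val * (!![p, 0; 0, t] * !![p, 0; 0, t]) = F.val.val * (r • 1) := by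
      rw [← mul_assoc, ← hp, mul_assoc, ← hp, ← mul_assoc, hr]
      simp
    have := congrFun (congrFun (diag_eq_of_mul_eq h1) 0) 0
    rw [← mul_one ((r : ℝ) : ℍ[ℝ]), Quaternion.coe_mul_eq_smul]
    simpa [Matrix.mul_apply, Fin.sum_univ_two] using this
  by_cases him : p.im = 0
  · have hpre : p = (p.re : ℍ[ℝ]) := by
      conv_lhs => rw [← Quaternion.re_add_im p, him, add_zero]
    by_cases hp0 : p = 0
    · apply eq_of_mul_eq (F := F)
      rw [hp, ht, hp0]
      refine Matrix.ext fun i j => ?_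
      fin_cases i <;> fin_cases j <;> simp [Matrix.mul_apply, Fin.sum_univ_two]
    · exfalso
      have ht' : t = -p := by
        rw [ht, hpre, Quaternion.star_coe]
      set v := act F ![0, 1] with hv
      have hv0 : v ≠ 0 := act_ne_zero F fun h => by simpa using congrFun h 1
      have hAv : act A v = rmul v μ := by
        have e : act (F⁻¹ * A * F) ![0, 1] = rmul ![0, 1] μ := by
          rw [act, hd, diag_mulVec]
          ext1 i
          fin_cases i <;> simp [rmul]
        rw [act_mul, act_mul, ← hv] at e
        rw [← act_act_inv F (act A v), e, act_rmul]
      have hBv : ∃ b, act B v = rmul v b := by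
        set u := act F⁻¹ (act B v) with hu
        have hBu : act B v = act F u := by rw [hu, act_act_inv]
        have hu' : u = ![u 0, u 1] := by
          ext1 i
          fin_cases i <;> simp
        have e1 : z *ᵥ act B v = act F ![p * u 0, t * u 1] := by
          rw [hBu, hu', mulVec_act_diag hp]
          simp
        have e2 : z *ᵥ act B v = act F (rmul u t) := by
          rw [mulVec_act_of_commute hB, hv, mulVec_act_diag hp, act_rmul, ← hBu, ← act_rmul]
          congr 1
          rw [hv, ← act_rmul]
          congr 1
          ext1 i
          fin_cases i <;> simp [rmul]
        have e3 := congrFun (toLin_injective F (e1.symm.trans e2)) 0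
        have hu0 : u 0 = 0 := by
          simp only [Matrix.cons_val_zero, rmul, ht'] at e3
          rw [hpre, ← Quaternion.coe_neg, ← Quaternion.coe_commutes, Quaternion.coe_neg, neg_mul,
            eq_neg_iff_add_eq_zero, ← two_mul, ← hpre] at e3
          have e4 := (mul_eq_zero.1 e3).resolve_left quaternion_two_ne_zero
          exact (mul_eq_zero.1 e4).resolve_left hp0
        refine ⟨u 1, ?_⟩
        rw [hBu, hv, ← act_rmul]
        congr 1
        ext1 i
        fin_cases i <;> simp [rmul, hu0]
      obtain ⟨b, hb⟩ := hBv
      refine hirr.1 ⟨Projectivization.mk ℍ[ℝ]ᵐᵒᵖ v hv0, Or.inr ((mk_mem_bdry hv0).2 ?_),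
        (move_mk_eq_iff A hv0).2 ⟨μ, hAv⟩, (move_mk_eq_iff B hv0).2 ⟨b, hb⟩⟩
      rw [hv, herm_act]
      simp [herm]
  · exfalso
    have hre : p.re = 0 := by
      have h2 : (2 * p.re) • p.im = 0 := by
        have : (p * p).im = 0 := by rw [hpp, Quaternion.im_coe]
        rw [← this]
        ext <;> simp <;> ring
      have := (smul_eq_zero.1 h2).resolve_right him
      linarith
    have hst : star p = -p := by ext <;> simp [hre]
    have ht' : t = p := by rw [ht, hst, neg_neg]
    -- A lift `(u, 1)` is an eigenvector of `diag(p, p)` exactly if `u` commutes with `p`; this is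
    -- true of `-1` and false for `-1 + w`.
    obtain ⟨w, hw, hwp⟩ := exists_imaginary_not_commuting him
    refine hirr.not_skew_complex hz hA hB (x := act F ![-1, 1])
      (y := act F ![-1 + w, 1]) ?_ ?_ ?_ ?_
    · rw [herm_act]
      simp [herm]
    · refine ⟨p, ?_⟩
      rw [mulVec_act_diag hp, ← act_rmul]
      congr 1
      ext1 i
      fin_cases i <;> simp [rmul, ht']
    · rw [herm_act]
      simp [herm, hw]
    · rintro ⟨a, ha⟩
      rw [mulVec_act_diag hp, ← act_rmul, ht'] at ha
      have h := toLin_injective F ha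
      have h1 := congrFun h 1
      have h0 := congrFun h 0
      simp [rmul] at h0 h1
      rw [← h1] at h0
      apply hwp
      rw [mul_add, add_mul] at h0
      simpa using h0

/-- The commutant of an irreducible pair with a hyperbolic first element consists of the real
scalars. -/
theorem IsIrreduciblePair.eq_smul_one_of_commute (hirr : IsIrreduciblePair A B)
    (hhyp : IsHyperbolic A) {z : Matrix (Fin 2) (Fin 2) ℍ[ℝ]} (hA : z * A.val.val = A.val.val * z)
    (hB : z * B.val.val = B.val.val * z) : ∃ r : ℝ, z = r • 1 := by
  obtain ⟨v, w, hv, hw⟩ := hhyp.exists_attracting_repelling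
  obtain ⟨F, μ, ν, -, -, hd, hμ, hν, -, -⟩ := exists_diag hv hw
  have hμν := hμ.trans hν
  have hA' := commute_adj hA
  have hB' := commute_adj hB
  obtain ⟨r, hr⟩ := hirr.symmetric_eq_smul_one hd hμν (s := z + adj z)
    (by rw [adj_add, adj_adj, add_comm]) (by rw [add_mul, mul_add, hA, hA'])
    (by rw [add_mul, mul_add, hB, hB'])
  have h0 := hirr.skew_eq_zero hd hμν (z := z - adj z)
    (by rw [adj_sub, adj_adj, neg_sub]) (by rw [sub_mul, mul_sub, hA, hA'])
    (by rw [sub_mul, mul_sub, hB, hB'])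
  refine ⟨r / 2, ?_⟩
  rw [sub_eq_zero] at h0
  rw [← h0, ← two_smul ℝ] at hr
  rw [div_eq_inv_mul, mul_smul, ← hr, smul_smul]
  norm_num

end Commutant

/-! ### The local structure of the deformation space -/

section Chart

attribute [local instance] Matrix.linftyOpNormedRing Matrix.linftyOpNormedAlgebra

/-- The inclusion of `Sp(1,1)` into the matrix algebra. -/
noncomputable def toMatrix : Sp11 →* Matrix (Fin 2) (Fin 2) ℍ[ℝ] :=
  (Units.coeHom (Matrix (Fin 2) (Fin 2) ℍ[ℝ])).comp Sp11.subtype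

theorem isUnitaryModel_adjoint : adjoint.IsUnitaryModel toMatrix where
  isInducing := (Units.isOpenEmbedding_val.isInducing).comp IsInducing.subtypeVal
  injective := fun _ _ h => Subtype.ext (Units.ext h)
  unitary := adj_coe
  exists_of_unitary := fun a h h' => ⟨ofUnitary a h h', rfl⟩

/-- The real part of the trace. -/
noncomputable def reTrace : Matrix (Fin 2) (Fin 2) ℍ[ℝ] →ₗ[ℝ] ℝ where
  toFun m := (m 0 0).re + (m 1 1).re
  map_add' m n := by
    simp
    ring
  map_smul' r m := by
    simp
    ring

theorem reTrace_mul_comm (m n : Matrix (Fin 2) (Fin 2) ℍ[ℝ]) :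
    reTrace (m * n) = reTrace (n * m) := by
  simp [reTrace, Matrix.mul_apply, Fin.sum_univ_two]
  ring

theorem reTrace_adj (m : Matrix (Fin 2) (Fin 2) ℍ[ℝ]) : reTrace (adj m) = reTrace m := by
  simp [reTrace, adj]
  ring

/-- Tested against the conjugate transpose of `z`, the trace form gives the sum of the squared norms
of the entries. -/
theorem eq_zero_of_reTrace_mul {z : Matrix (Fin 2) (Fin 2) ℍ[ℝ]}
    (h : ∀ m, reTrace (z * m) = 0) : z = 0 := by
  have h1 := h zᴴ
  have e : reTrace (z * zᴴ) = Quaternion.normSq (z 0 0) + Quaternion.normSq (z 0 1) +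
      (Quaternion.normSq (z 1 0) + Quaternion.normSq (z 1 1)) := by
    simp [reTrace, Matrix.mul_apply, Fin.sum_univ_two, Quaternion.self_mul_star]
  rw [e] at h1
  have n00 := Quaternion.normSq_nonneg (a := z 0 0)
  have n01 := Quaternion.normSq_nonneg (a := z 0 1)
  have n10 := Quaternion.normSq_nonneg (a := z 1 0)
  have n11 := Quaternion.normSq_nonneg (a := z 1 1)
  refine Matrix.ext fun i j => ?_
  fin_cases i <;> fin_cases j
  · exact Quaternion.normSq_eq_zero.1 (show Quaternion.normSq (z 0 0) = 0 by linarith)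
  · exact Quaternion.normSq_eq_zero.1 (show Quaternion.normSq (z 0 1) = 0 by linarith)
  · exact Quaternion.normSq_eq_zero.1 (show Quaternion.normSq (z 1 0) = 0 by linarith)
  · exact Quaternion.normSq_eq_zero.1 (show Quaternion.normSq (z 1 1) = 0 by linarith)

/-- The imaginary quaternion with given coordinates. -/
def imag (x : Fin 3 → ℝ) : ℍ[ℝ] := ⟨0, x 0, x 1, x 2⟩

theorem star_imag (x : Fin 3 → ℝ) : star (imag x) = -imag x := by
  refine Quaternion.ext _ _ ?_ ?_ ?_ ?_
  · rw [Quaternion.re_star, Quaternion.re_neg]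
    exact neg_zero.symm
  all_goals rfl

/-- The Lie algebra of `Sp(1,1)` in coordinates. -/
noncomputable def skewEquiv : adjoint.skew ≃ₗ[ℝ] ℍ[ℝ] × (Fin 3 → ℝ) × (Fin 3 → ℝ) where
  toFun m := (m.1 0 0, ![(m.1 0 1).imI, (m.1 0 1).imJ, (m.1 0 1).imK],
    ![(m.1 1 0).imI, (m.1 1 0).imJ, (m.1 1 0).imK])
  map_add' m n := by
    refine Prod.ext rfl (Prod.ext ?_ ?_) <;> ext i <;> fin_cases i <;> simp
  map_smul' r m := by
    refine Prod.ext rfl (Prod.ext ?_ ?_) <;> ext i <;> fin_cases i <;> simp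
  invFun x := ⟨!![x.1, imag x.2.1; imag x.2.2, -star x.1], adjoint.mem_skew.2 (by
    refine Matrix.ext fun i j => ?_
    fin_cases i <;> fin_cases j <;> simp [adjoint, adj, star_imag])⟩
  left_inv m := by
    have h : adj m.1 = -m.1 := adjoint.mem_skew.1 m.2
    have h01 : star (m.1 0 1) = -m.1 0 1 := congrFun (congrFun h 0) 1
    have h10 : star (m.1 1 0) = -m.1 1 0 := congrFun (congrFun h 1) 0
    have h11 : star (m.1 0 0) = -m.1 1 1 := congrFun (congrFun h 1) 1
    have r01 : (m.1 0 1).re = 0 := by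
      have := congrArg (fun q : ℍ[ℝ] => q.re) h01
      simp at this
      linarith
    have r10 : (m.1 1 0).re = 0 := by
      have := congrArg (fun q : ℍ[ℝ] => q.re) h10
      simp at this
      linarith
    refine Subtype.ext (Matrix.ext fun i j => ?_)
    fin_cases i <;> fin_cases j
    · rfl
    · change imag _ = m.1 0 1
      exact Quaternion.ext _ _ r01.symm rfl rfl rfl
    · change imag _ = m.1 1 0
      exact Quaternion.ext _ _ r10.symm rfl rfl rfl
    · change -star (m.1 0 0) = m.1 1 1
      rw [h11, neg_neg]
  right_inv x := by
    refine Prod.ext rfl (Prod.ext ?_ ?_) <;> ext i <;> fin_cases i <;> simp [imag]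

theorem finrank_skew : Module.finrank ℝ adjoint.skew = 10 := by
  rw [skewEquiv.finrank_eq, Module.finrank_prod, Module.finrank_prod, Quaternion.finrank_eq_four]
  simp

end Chart

/-! ### Representations of surface groups -/

theorem move_mul (A B : Sp11) (p : HP1) : move (A * B) p = move A (move B p) := by
  induction p using Projectivization.ind with | _ v hv
  rw [move_mk, move_mk, move_mk]
  congr 1
  exact act_mul A B v

theorem move_one (p : HP1) : move 1 p = p := by
  induction p using Projectivization.ind with | _ v hv
  rw [move_mk]
  congr 1
  exact act_one v

theorem move_mem_bdry (A : Sp11) (p : HP1) : move A p ∈ bdry ↔ p ∈ bdry := by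
  induction p using Projectivization.ind with | _ v hv
  rw [move_mk, mk_mem_bdry, mk_mem_bdry, herm_act]

theorem move_inv_eq_iff (A : Sp11) (p : HP1) : move A⁻¹ p = p ↔ move A p = p := by
  constructor
  · intro h
    conv_lhs => rw [← h]
    rw [← move_mul, mul_inv_cancel, move_one]
  · intro h
    conv_lhs => rw [← h]
    rw [← move_mul, inv_mul_cancel, move_one]

theorem IsLoxodromic.inv {A : Sp11} (h : IsLoxodromic A) : IsLoxodromic A⁻¹ := by
  refine ⟨?_, ?_⟩
  · have := h.1
    rw [IsHyperbolic] at this ⊢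
    simpa only [move_inv_eq_iff] using this
  · rintro μ ⟨v, hv, e⟩ r rfl
    have hr : r ≠ 0 := by
      rintro rfl
      refine act_ne_zero A⁻¹ hv ?_
      rw [e, rmul_coe, zero_smul]
    refine h.2 ((r⁻¹ : ℝ) : ℍ[ℝ]) ⟨v, hv, ?_⟩ r⁻¹ rfl
    have : v = rmul (act A v) (r : ℍ[ℝ]) := by rw [← act_rmul, ← e, act_act_inv]
    conv_rhs => rw [this]
    rw [rmul_rmul, ← Quaternion.coe_mul, mul_inv_cancel₀ hr, Quaternion.coe_one, rmul_one]

theorem IsLoxodromic.conj {A : Sp11} (h : IsLoxodromic A) (k : Sp11) :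
    IsLoxodromic (k * A * k⁻¹) := by
  have kinj : Function.Injective (move k) := fun p q hpq => by
    have := congrArg (move k⁻¹) hpq
    rwa [← move_mul, ← move_mul, inv_mul_cancel, move_one, move_one] at this
  refine ⟨?_, ?_⟩
  · have : {p | p ∈ bdry ∧ move (k * A * k⁻¹) p = p} = move k '' {p | p ∈ bdry ∧ move A p = p} := by
      ext p
      constructor
      · rintro ⟨h1, h2⟩
        refine ⟨move k⁻¹ p, ⟨(move_mem_bdry _ _).2 h1, ?_⟩, ?_⟩
        · apply kinj
          rw [← move_mul, ← move_mul, h2, ← move_mul, mul_inv_cancel, move_one]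
        · rw [← move_mul, mul_inv_cancel, move_one]
      · rintro ⟨q, ⟨h1, h2⟩, rfl⟩
        refine ⟨(move_mem_bdry _ _).2 h1, ?_⟩
        rw [← move_mul, inv_mul_cancel_right, move_mul, h2]
    rw [IsHyperbolic, this, Set.ncard_image_of_injective _ kinj]
    exact h.1
  · rintro μ ⟨v, hv, e⟩ r hr
    refine h.2 μ ⟨act k⁻¹ v, act_ne_zero _ hv, ?_⟩ r hr
    rw [act_mul, act_mul] at e
    rw [← act_inv_act k (act A (act k⁻¹ v)), e, act_rmul]

section Representations

variable {g : ℕ} (P : CurveSystem g)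

theorem CurveSystem.bdryLoop_mul (v : Fin (2 * g - 2)) :
    P.bdryLoop (v, 0) * P.bdryLoop (v, 1) * P.bdryLoop (v, 2) = 1 :=
  PresentedGroup.one_of_mem (rels := P.rels) (Or.inl (Or.inl ⟨v, rfl⟩))

theorem CurveSystem.crossing_mul (j : Fin (3 * g - 3)) :
    P.crossing j * P.bdryLoop (P.sides (j, true)) * (P.crossing j)⁻¹ *
      P.bdryLoop (P.sides (j, false)) = 1 :=
  PresentedGroup.one_of_mem (rels := P.rels) (Or.inl (Or.inr ⟨j, rfl⟩))

theorem CurveSystem.crossing_of_mem {j : Fin (3 * g - 3)} (hj : j ∈ P.tree) : P.crossing j = 1 :=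
  PresentedGroup.one_of_mem (rels := P.rels) (Or.inr ⟨j, hj, rfl⟩)

variable {P}
variable {φ : P.Grp ≃* SurfaceGroup g} {ρ : SurfaceGroup g →* Sp11}

theorem map_crossing_conj (φ : P.Grp ≃* SurfaceGroup g) (ρ : SurfaceGroup g →* Sp11)
    (j : Fin (3 * g - 3)) :
    ρ (φ (P.crossing j)) * ρ (φ (P.bdryLoop (P.sides (j, true)))) * (ρ (φ (P.crossing j)))⁻¹ =
      (ρ (φ (P.bdryLoop (P.sides (j, false)))))⁻¹ := by
  have h := congrArg (fun x => ρ (φ x)) (P.crossing_mul j)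
  simp only [map_mul, map_inv, map_one] at h
  exact eq_inv_of_mul_eq_one_left h

/-- The definition covers one side of each curve. The loop on the other side is conjugate to the
inverse, and every boundary circle is a side of some curve. -/
theorem IsGeometric.isLoxodromic (h : IsGeometric P φ ρ) (x : Fin (2 * g - 2) × Fin 3) :
    IsLoxodromic (ρ (φ (P.bdryLoop x))) := by
  obtain ⟨⟨j, b⟩, rfl⟩ := P.sides.surjective x
  cases b
  · exact h.2.2.1 j
  · have e := map_crossing_conj φ ρ j
    have : ρ (φ (P.bdryLoop (P.sides (j, true)))) = (ρ (φ (P.crossing j)))⁻¹ *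
        (ρ (φ (P.bdryLoop (P.sides (j, false)))))⁻¹ * ((ρ (φ (P.crossing j)))⁻¹)⁻¹ := by
      rw [← e]
      group
    rw [this]
    exact (h.2.2.1 j).inv.conj _

/-- The values of a representation on the standard generators. -/
noncomputable def genValues (ρ : RepSpace (SurfaceGroup g)) (i : Fin g × Bool) : Sp11 :=
  (show SurfaceGroup g →* Sp11 from ρ) (PresentedGroup.of i)

theorem map_mk_eq_lift (ρ : SurfaceGroup g →* Sp11) (w : FreeGroup (Fin g × Bool)) :
    ρ (PresentedGroup.mk _ w) = FreeGroup.lift (genValues ρ) w := by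
  have : ρ.comp (PresentedGroup.mk _) = FreeGroup.lift (genValues ρ) := by
    refine FreeGroup.ext_hom _ _ fun i => ?_
    rw [FreeGroup.lift_apply_of]
    rfl
  exact DFunLike.congr_fun this w

/-- Every group element is a word in the generators, and word maps are continuous; so convergence on
the generators is pointwise convergence. -/
theorem isInducing_genValues : IsInducing (genValues (g := g)) := by
  have hc : Continuous (genValues (g := g)) := by
    refine continuous_pi fun i => ?_
    exact (continuous_apply (PresentedGroup.of i)).comp continuous_induced_dom
  refine ⟨le_antisymm hc.le_induced ?_⟩
  refine continuous_iff_le_induced.1 ?_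
  let _ := TopologicalSpace.induced (genValues (g := g)) inferInstance
  refine continuous_pi fun x => ?_
  obtain ⟨w, rfl⟩ := PresentedGroup.mk_surjective _ x
  have e : (fun ρ : SurfaceGroup g →* Sp11 => ρ (PresentedGroup.mk _ w)) =
      (fun a => FreeGroup.lift a w) ∘ genValues := funext fun ρ => map_mk_eq_lift ρ w
  exact e ▸ (continuous_freeGroup_lift w).comp continuous_induced_dom

theorem exists_genValues_eq_iff (a : Fin g × Bool → Sp11) :
    (∃ ρ, genValues ρ = a) ↔
      FreeGroup.lift a (AntiInvolution.IsUnitaryModel.relator g) = 1 := by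
  constructor
  · rintro ⟨ρ, rfl⟩
    refine (map_mk_eq_lift ρ _).symm.trans ?_
    have : PresentedGroup.mk _ (AntiInvolution.IsUnitaryModel.relator g) = (1 : SurfaceGroup g) :=
      PresentedGroup.one_of_mem rfl
    exact (congrArg _ this).trans (map_one _)
  · intro h
    refine ⟨PresentedGroup.toGroup (f := a) ?_, ?_⟩
    · rintro r rfl
      exact h
    · funext i
      exact PresentedGroup.toGroup.of _

theorem repClass_eq_iff {Γ : Type} [Group Γ] (ρ ρ' : Γ →* Sp11) :
    repClass ρ = repClass ρ' ↔ ∃ h : Sp11, ∀ x, ρ' x = h * ρ x * h⁻¹ := Quotient.eq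

theorem conj_iff_genValues (ρ ρ' : SurfaceGroup g →* Sp11) (h : Sp11) :
    (∀ x, ρ' x = h * ρ x * h⁻¹) ↔ ∀ i, genValues ρ' i = h * genValues ρ i * h⁻¹ := by
  constructor
  · intro H i
    exact H _
  · intro H
    have : ρ' = (MulAut.conj h).toMonoidHom.comp ρ := PresentedGroup.ext fun i => H i
    intro x
    rw [this]
    rfl

theorem IsGeometric.commutant (hg : 2 ≤ g) (h : IsGeometric P φ ρ)
    {z : Matrix (Fin 2) (Fin 2) ℍ[ℝ]}
    (hz : ∀ i, z * (genValues ρ i).val.val = (genValues ρ i).val.val * z) :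
    ∃ r : ℝ, z = r • 1 := by
  have key : ∀ x, z * (ρ x).val.val = (ρ x).val.val * z := by
    intro x
    obtain ⟨w, rfl⟩ := PresentedGroup.mk_surjective _ x
    rw [map_mk_eq_lift]
    induction w using FreeGroup.induction_on with
    | C1 => simp
    | of i => simpa using hz i
    | inv_of i hi =>
      rw [map_inv]
      exact (Commute.units_inv_right (u := (FreeGroup.lift (genValues ρ) (FreeGroup.of i)).val) hi)
    | mul a b ha hb =>
      rw [map_mul]
      exact Commute.mul_right (show Commute z _ from ha) (show Commute z _ from hb)
  have v : Fin (2 * g - 2) := ⟨0, by omega⟩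
  exact (h.2.2.2 v).eq_smul_one_of_commute (h.isLoxodromic (v, 0)).1 (key _) (key _)

theorem IsGeometric.exists_chart (hg : 2 ≤ g) (h : IsGeometric P φ ρ) :
    ∃ e : OpenPartialHomeomorph (DeformationSpace (SurfaceGroup g))
        (EuclideanSpace ℝ (Fin (20 * g - 20))), repClass ρ ∈ e.source := by
  let _ : NormedRing (Matrix (Fin 2) (Fin 2) ℍ[ℝ]) := Matrix.linftyOpNormedRing
  let _ : NormedAlgebra ℝ (Matrix (Fin 2) (Fin 2) ℍ[ℝ]) := Matrix.linftyOpNormedAlgebra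
  have : FiniteDimensional ℝ (Matrix (Fin 2) (Fin 2) ℍ[ℝ]) := inferInstance
  have : CompleteSpace (Matrix (Fin 2) (Fin 2) ℍ[ℝ]) := FiniteDimensional.complete ℝ _
  refine isUnitaryModel_adjoint.exists_chart (genValues ρ) ((exists_genValues_eq_iff _).1 ⟨ρ, rfl⟩)
    (fun z hz => h.commutant hg hz) reTrace reTrace_mul_comm reTrace_adj
    (fun z hz => eq_zero_of_reTrace_mul hz) isInducing_genValues exists_genValues_eq_iff
    (q := fun ρ : RepSpace (SurfaceGroup g) => repClass ρ) (isQuotientMap_quotient_mk')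
    ?_ rfl ?_
  · intro ρ ρ'
    exact (repClass_eq_iff _ _).trans (exists_congr fun k => conj_iff_genValues ρ ρ' k)
  · rw [finrank_skew]
    omega

end Representations

/-! ### Conjugation of quaternions into the complex numbers -/

/-- An imaginary quaternion is conjugate to a nonnegative multiple of `i`. -/
theorem exists_mul_eq_mul_I {z : ℍ[ℝ]} (hz : z.re = 0) :
    ∃ q : ℍ[ℝ], q ≠ 0 ∧ z * q = q * (‖z‖ • ((Complex.I : ℂ) : ℍ[ℝ])) := by
  have hzz : z * z = ((-(‖z‖ * ‖z‖) : ℝ) : ℍ[ℝ]) := by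
    have : star z = -z := by ext <;> simp [hz]
    rw [Quaternion.coe_neg, ← Quaternion.normSq_eq_norm_mul_self, ← Quaternion.self_mul_star, this]
    simp
  set i : ℍ[ℝ] := ((Complex.I : ℂ) : ℍ[ℝ]) with hi
  have hii : i * i = -1 := by
    ext <;> simp [hi]
  -- The element `‖z‖ - z i` intertwines `z` with `‖z‖ i`. It vanishes only for `z = -‖z‖ i`, where
  -- `j` does the job.
  by_cases h : (‖z‖ : ℍ[ℝ]) - z * i = 0
  · obtain ⟨j, hj0, hj1, hj2, hj3⟩ : ∃ j : ℍ[ℝ], j.re = 0 ∧ j.imI = 0 ∧ j.imJ = 1 ∧ j.imK = 0 :=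
      ⟨⟨0, 0, 1, 0⟩, rfl, rfl, rfl, rfl⟩
    have hzi : z = -(‖z‖ • i) := by
      rw [sub_eq_zero] at h
      have := congrArg (fun q => q * i) h
      simp only [mul_assoc, hii, Quaternion.coe_mul_eq_smul] at this
      rw [this]
      simp
    refine ⟨j, fun h => by simp [h] at hj2, ?_⟩
    have : i * j = -(j * i) := by
      ext <;> simp [hi, hj0, hj1, hj2, hj3]
    conv_lhs => rw [hzi]
    rw [neg_mul, smul_mul_assoc, this, mul_smul_comm, smul_neg, neg_neg]
  · refine ⟨_, h, ?_⟩
    rw [mul_sub, ← mul_assoc, hzz, sub_mul, mul_smul_comm, mul_smul_comm, mul_assoc z, hii,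
      ← Quaternion.coe_commutes, Quaternion.coe_mul_eq_smul, Quaternion.coe_mul_eq_smul,
      Quaternion.coe_mul_eq_smul, smul_smul]
    simp
    abel

/-- A nonreal quaternion is conjugate to a complex number in the upper half plane. -/
theorem exists_mul_eq_mul_coe {μ : ℍ[ℝ]} (hμ : ∀ r : ℝ, μ ≠ (r : ℍ[ℝ])) :
    ∃ (q : ℍ[ℝ]ˣ) (l : ℂ), 0 < l.im ∧ μ * q = q * (l : ℍ[ℝ]) := by
  have him : μ.im ≠ 0 := by
    intro h
    refine hμ μ.re ?_
    conv_lhs => rw [← Quaternion.re_add_im μ, h, add_zero]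
  obtain ⟨q, hq, e⟩ := exists_mul_eq_mul_I (z := μ.im) (by simp)
  refine ⟨Units.mk0 q hq, ⟨μ.re, ‖μ.im‖⟩, norm_pos_iff.2 him, ?_⟩
  have : (((⟨μ.re, ‖μ.im‖⟩ : ℂ)) : ℍ[ℝ]) = (μ.re : ℍ[ℝ]) + ‖μ.im‖ • ((Complex.I : ℂ) : ℍ[ℝ]) := by
    ext <;> simp
  rw [this, Units.val_mk0, mul_add, ← e, ← Quaternion.coe_commutes, ← add_mul,
    Quaternion.re_add_im]

theorem exists_mul_I_mul_star {z : ℍ[ℝ]} (hz : z.re = 0) (hz0 : z ≠ 0) :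
    ∃ q : ℍ[ℝ], q ≠ 0 ∧ q * ((Complex.I : ℂ) : ℍ[ℝ]) * star q = z := by
  obtain ⟨q, hq, e⟩ := exists_mul_eq_mul_I hz
  have hr : 0 < ‖z‖ := norm_pos_iff.2 hz0
  have hn : 0 < Quaternion.normSq q :=
    lt_of_le_of_ne Quaternion.normSq_nonneg (Ne.symm (Quaternion.normSq_ne_zero.2 hq))
  set s := √(‖z‖ / Quaternion.normSq q) with hs
  have hs0 : 0 < s := Real.sqrt_pos.2 (div_pos hr hn)
  have hss : s * s = ‖z‖ / Quaternion.normSq q := Real.mul_self_sqrt (div_pos hr hn).le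
  refine ⟨s • q, smul_ne_zero hs0.ne' hq, ?_⟩
  have e' : q * ((Complex.I : ℂ) : ℍ[ℝ]) = ‖z‖⁻¹ • (z * q) := by
    rw [e, mul_smul_comm, smul_smul, inv_mul_cancel₀ hr.ne', one_smul]
  rw [Quaternion.star_smul, smul_mul_assoc, smul_mul_assoc, mul_smul_comm, smul_smul, e',
    smul_mul_assoc, smul_smul, mul_assoc z, Quaternion.self_mul_star, Quaternion.mul_coe_eq_smul,
    smul_smul, hss]
  have : ‖z‖ / Quaternion.normSq q * ‖z‖⁻¹ * Quaternion.normSq q = 1 := by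
    field_simp
  rw [this, one_smul]

theorem exists_rotation {y : ℍ[ℝ]} (hy : y.re = 0) :
    ∃ w y' : ℍ[ℝ], w ≠ 0 ∧ w * ((Complex.I : ℂ) : ℍ[ℝ]) * star w = ((Complex.I : ℂ) : ℍ[ℝ]) ∧
      y'.re = 0 ∧ y'.imK = 0 ∧ 0 ≤ y'.imJ ∧ w * y' * star w = y := by
  by_cases h : (⟨y.imJ, y.imK⟩ : ℂ) = 0
  · have h1 : y.imJ = 0 := congrArg Complex.re h
    have h2 : y.imK = 0 := congrArg Complex.im h
    exact ⟨1, y, one_ne_zero, by simp, hy, h2, h1.ge, by simp⟩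
  -- A unit complex number `w` fixes `i` and acts on the plane of `j` and `k` as multiplication by
  -- `w²`. Hence `w` is the normalized square root of the `j`, `k` part of `y`.
  · obtain ⟨s, hs⟩ := IsAlgClosed.exists_pow_nat_eq (⟨y.imJ, y.imK⟩ : ℂ) two_pos
    have hs0 : s ≠ 0 := by
      rintro rfl
      apply h
      rw [← hs]
      simp
    have e1 : y.imJ = s.re * s.re - s.im * s.im := by
      have := congrArg Complex.re hs
      simpa [sq] using this.symm
    have e2 : y.imK = 2 * (s.re * s.im) := by
      have := congrArg Complex.im hs
      simp [sq] at this
      linarith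
    have hm : 0 < s.re * s.re + s.im * s.im := by
      have := Complex.normSq_pos.2 hs0
      rwa [Complex.normSq_apply] at this
    set m := √(s.re * s.re + s.im * s.im) with hmdef
    have hm0 : 0 < m := Real.sqrt_pos.2 hm
    have hmm : m * m = s.re * s.re + s.im * s.im := Real.mul_self_sqrt hm.le
    obtain ⟨w, w0, w1, w2, w3⟩ : ∃ w : ℍ[ℝ], w.re = s.re / m ∧ w.imI = s.im / m ∧ w.imJ = 0 ∧
      w.imK = 0 := ⟨⟨s.re / m, s.im / m, 0, 0⟩, rfl, rfl, rfl, rfl⟩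
    obtain ⟨y', y0, y1, y2, y3⟩ : ∃ y' : ℍ[ℝ], y'.re = 0 ∧ y'.imI = y.imI ∧ y'.imJ = m * m ∧
      y'.imK = 0 := ⟨⟨0, y.imI, m * m, 0⟩, rfl, rfl, rfl, rfl⟩
    have key : s.re / m * (s.re / m) + s.im / m * (s.im / m) = 1 := by
      field_simp
      linarith
    have hre : m * m * (s.re / m * (s.re / m) - s.im / m * (s.im / m)) = y.imJ := by
      rw [e1]
      field_simp
    have him : m * m * (2 * (s.re / m * (s.im / m))) = y.imK := by
      rw [e2]
      field_simp
    refine ⟨w, y', ?_, ?_, y0, y3, by rw [y2]; positivity, ?_⟩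
    · rintro rfl
      simp at w0 w1
      rw [← w0, ← w1] at key
      simp at key
    · ext <;> simp [w0, w1, w2, w3]
      · ring
      · linarith
    · ext
      · simp [w0, w1, w2, w3, y0, y1, y2, y3, hy]
        ring
      · simp [w0, w1, w2, w3, y0, y1, y2, y3]
        linear_combination y.imI * key
      · simp [w0, w1, w2, w3, y0, y1, y2, y3]
        linear_combination hre
      · simp [w0, w1, w2, w3, y0, y1, y2, y3]
        linear_combination him

/-! ### Normal forms of pairs -/

theorem IsAttracting.rmul {A : Sp11} {v : Vec} (h : IsAttracting A v) {c : ℍ[ℝ]} (hc : c ≠ 0) :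
    IsAttracting A (rmul v c) := by
  obtain ⟨hv, h0, μ, hμ, e⟩ := h
  refine ⟨rmul_ne_zero hv hc, ?_, c⁻¹ * μ * c, ?_, ?_⟩
  · rw [herm_rmul_left, herm_rmul_right, h0]
    simp
  · rw [norm_mul, norm_mul, norm_inv]
    have := norm_pos_iff.2 hc
    field_simp
    exact hμ
  · rw [act_rmul, e, rmul_rmul, rmul_rmul, mul_assoc, mul_inv_cancel_left₀ hc]

theorem IsRepelling.rmul {A : Sp11} {v : Vec} (h : IsRepelling A v) {c : ℍ[ℝ]} (hc : c ≠ 0) :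
    IsRepelling A (rmul v c) := by
  obtain ⟨hv, h0, μ, hμ, e⟩ := h
  refine ⟨rmul_ne_zero hv hc, ?_, c⁻¹ * μ * c, ?_, ?_⟩
  · rw [herm_rmul_left, herm_rmul_right, h0]
    simp
  · rw [norm_mul, norm_mul, norm_inv]
    have := norm_pos_iff.2 hc
    field_simp
    exact hμ
  · rw [act_rmul, e, rmul_rmul, rmul_rmul, mul_assoc, mul_inv_cancel_left₀ hc]

theorem act_conj_eq_iff (A F : Sp11) (v : Vec) (μ : ℍ[ℝ]) :
    act (F⁻¹ * A * F) v = rmul v μ ↔ act A (act F v) = rmul (act F v) μ := by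
  rw [act_mul, act_mul]
  constructor
  · intro h
    rw [← act_act_inv F (act A (act F v)), h, act_rmul]
  · intro h
    rw [h, act_rmul, act_inv_act]

theorem act_ne_zero_iff (F : Sp11) (v : Vec) : act F v ≠ 0 ↔ v ≠ 0 := by
  refine ⟨?_, act_ne_zero F⟩
  rintro h rfl
  exact h (Matrix.mulVec_zero _)

theorem isAttracting_conj_iff (A F : Sp11) (v : Vec) :
    IsAttracting (F⁻¹ * A * F) v ↔ IsAttracting A (act F v) := by
  simp only [IsAttracting, act_conj_eq_iff, act_ne_zero_iff, herm_act]

theorem isRepelling_conj_iff (A F : Sp11) (v : Vec) :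
    IsRepelling (F⁻¹ * A * F) v ↔ IsRepelling A (act F v) := by
  simp only [IsRepelling, act_conj_eq_iff, act_ne_zero_iff, herm_act]

theorem IsIrreduciblePair.herm_ne_zero {A B : Sp11} (h : IsIrreduciblePair A B) {x y : Vec}
    {μ ν : ℍ[ℝ]} (hx : x ≠ 0) (hx0 : herm x x = 0) (hAx : act A x = rmul x μ) (hy : y ≠ 0)
    (hBy : act B y = rmul y ν) : herm y x ≠ 0 := by
  intro h0
  obtain ⟨c, rfl⟩ := eq_rmul_of_herm_eq_zero hx hx0 h0
  have hc : c ≠ 0 := by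
    rintro rfl
    exact hy (rmul_zero x)
  refine h.1 ⟨Projectivization.mk ℍ[ℝ]ᵐᵒᵖ x hx, Or.inr ((mk_mem_bdry hx).2 hx0),
    (move_mk_eq_iff A hx).2 ⟨μ, hAx⟩, (move_mk_eq_iff B hx).2 ⟨c * ν * c⁻¹, ?_⟩⟩
  rw [act_rmul, rmul_rmul] at hBy
  rw [← rmul_rmul, ← hBy, rmul_rmul, mul_inv_cancel₀ hc, rmul_one]

theorem exists_act_diag {l : ℍ[ℝ]} (hl : l ≠ 0) :
    ∃ D : Sp11, act D ![1, 0] = rmul ![1, 0] l ∧ act D ![0, 1] = rmul ![0, 1] (star l)⁻¹ ∧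
      ∀ z, act D ![z, 1] = rmul ![l * z * star l, 1] (star l)⁻¹ := by
  have hl' : star l ≠ 0 := by simpa using hl
  obtain ⟨D, h0, h1⟩ := exists_act_eq (p := rmul ![1, 0] l) (q := rmul ![0, 1] (star l)⁻¹)
    (by simp [herm, rmul]) (by simp [herm, rmul]) (by simp [herm, rmul, hl])
  refine ⟨D, h0, h1, fun z => ?_⟩
  rw [vec_eq_add ![z, 1], act_add, act_rmul, act_rmul, h0, h1]
  ext1 k
  fin_cases k <;> simp [rmul, mul_assoc, hl']

/-- A null vector off the point `∞` is a multiple of a standard lift `(z, 1)` with `z`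
imaginary. -/
theorem exists_eq_rmul_standard {x : Vec} (hx0 : herm x x = 0) (h1 : x 1 ≠ 0) :
    ∃ z c : ℍ[ℝ], z.re = 0 ∧ c ≠ 0 ∧ x = rmul ![z, 1] c := by
  refine ⟨x 0 * (x 1)⁻¹, x 1, ?_, h1, ?_⟩
  · have hx : x = rmul ![x 0 * (x 1)⁻¹, 1] (x 1) := by
      ext1 k
      fin_cases k <;> simp [rmul, h1]
    rw [hx, herm_rmul_left, herm_rmul_right, mul_eq_zero, mul_eq_zero] at hx0
    have hs : star (x 1) ≠ 0 := by simpa using h1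
    have h := (hx0.resolve_right h1).resolve_left hs
    have := congrArg (fun q : ℍ[ℝ] => q.re) h
    simp only [herm, Matrix.cons_val_zero, Matrix.cons_val_one, star_one, one_mul, mul_one,
      Quaternion.re_add, Quaternion.re_star, Quaternion.re_zero] at this
    linarith
  · ext1 k
    fin_cases k <;> simp [rmul, h1]

/-- Irreducibility keeps the fixed points of `B` apart from those of `A`. After `o` and `∞` are
placed, the diagonal elements still act by `z ↦ l z l̄`: the factor `q` of `l` brings `a_B` to `i`,
and the factor `u`, a rotation about `i`, brings `r_B` into the half plane. -/
theorem IsIrreduciblePair.exists_isNormalized {A B : Sp11} (h : IsIrreduciblePair A B)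
    (hA : IsLoxodromic A) (hB : IsLoxodromic B) :
    ∃ F : Sp11, IsNormalized (F⁻¹ * A * F) (F⁻¹ * B * F) := by
  obtain ⟨v, w, hv, hw⟩ := hA.1.exists_attracting_repelling
  obtain ⟨v', w', hv', hw'⟩ := hB.1.exists_attracting_repelling
  obtain ⟨F, hF1, c, hc, hF0⟩ := exists_frame hv.2.1 hw.2.1
    (herm_ne_zero_of_attracting_repelling hv hw)
  have hwv : herm v' (act F ![1, 0]) ≠ 0 := by
    rw [hF0]
    obtain ⟨h1, h2, _, -, h3⟩ := hw.rmul hc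
    obtain ⟨h1', h2', _, -, h3'⟩ := hv'
    exact h.herm_ne_zero h1 h2 h3 h1' h3'
  have hww : herm w' (act F ![1, 0]) ≠ 0 := by
    rw [hF0]
    obtain ⟨h1, h2, _, -, h3⟩ := hw.rmul hc
    obtain ⟨h1', h2', _, -, h3'⟩ := hw'
    exact h.herm_ne_zero h1 h2 h3 h1' h3'
  have hvv : herm v' (act F ![0, 1]) ≠ 0 := by
    rw [hF1]
    obtain ⟨h1, h2, _, -, h3⟩ := hv
    obtain ⟨h1', h2', _, -, h3'⟩ := hv'
    exact h.herm_ne_zero h1 h2 h3 h1' h3'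
  rw [← act_act_inv F v', herm_act] at hwv hvv
  rw [← act_act_inv F w', herm_act] at hww
  obtain ⟨z, d, hz, hd, ez⟩ := exists_eq_rmul_standard (x := act F⁻¹ v')
    (by rw [herm_act]; exact hv'.2.1) (by simpa [herm] using hwv)
  obtain ⟨y, d', hy, hd', ey⟩ := exists_eq_rmul_standard (x := act F⁻¹ w')
    (by rw [herm_act]; exact hw'.2.1) (by simpa [herm] using hww)
  have hz0 : z ≠ 0 := by
    rintro rfl
    rw [ez] at hvv
    simp [herm, SpOneOne.rmul] at hvv
  obtain ⟨q, hq, eq⟩ := exists_mul_I_mul_star hz hz0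
  have hq' : star q ≠ 0 := by simpa using hq
  obtain ⟨u, y', hu, eu, hy0, hyK, hyJ, eu'⟩ := exists_rotation (y := q⁻¹ * y * (star q)⁻¹) (by
    have hst : star y = -y := by ext <;> simp [hy]
    have : star (q⁻¹ * y * (star q)⁻¹) = -(q⁻¹ * y * (star q)⁻¹) := by
      simp [hst, mul_assoc]
    have := congrArg (fun q : ℍ[ℝ] => q.re) this
    simp only [Quaternion.re_star, Quaternion.re_neg] at this
    linarith)
  obtain ⟨D, D0, D1, Dz⟩ := exists_act_diag (mul_ne_zero hq hu)
  have hqu : star (q * u) ≠ 0 := by simpa using ⟨hu, hq⟩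
  refine ⟨F * D, y', hy0, hyK, hyJ, ?_, ?_, ?_, ?_⟩
  · rw [isAttracting_conj_iff, act_mul, D1, act_rmul, hF1]
    exact hv.rmul (inv_ne_zero hqu)
  · rw [isRepelling_conj_iff, act_mul, D0, act_rmul, hF0]
    exact (hw.rmul hc).rmul (mul_ne_zero hq hu)
  · rw [isAttracting_conj_iff, act_mul, Dz, act_rmul]
    have e : q * u * ((Complex.I : ℂ) : ℍ[ℝ]) * star (q * u) = z := by
      have : q * u * ((Complex.I : ℂ) : ℍ[ℝ]) * star (q * u) =
          q * (u * ((Complex.I : ℂ) : ℍ[ℝ]) * star u) * star q := by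
        rw [star_mul]
        simp only [mul_assoc]
      rw [this, eu, eq]
    have e2 : act F ![z, 1] = SpOneOne.rmul v' d⁻¹ := by
      rw [← act_act_inv F v', ez, act_rmul, rmul_rmul, mul_inv_cancel₀ hd, rmul_one]
    rw [e, e2]
    exact (hv'.rmul (inv_ne_zero hd)).rmul (inv_ne_zero hqu)
  · rw [isRepelling_conj_iff, act_mul, Dz, act_rmul]
    have e : q * u * y' * star (q * u) = y := by
      have : q * u * y' * star (q * u) = q * (u * y' * star u) * star q := by
        rw [star_mul]
        simp only [mul_assoc]
      rw [this, eu']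
      simp [mul_assoc, hq]
    have e2 : act F ![y, 1] = SpOneOne.rmul w' d'⁻¹ := by
      rw [← act_act_inv F w', ey, act_rmul, rmul_rmul, mul_inv_cancel₀ hd', rmul_one]
    rw [e, e2]
    exact (hw'.rmul (inv_ne_zero hd')).rmul (inv_ne_zero hqu)

theorem exists_standard {x : Vec} (hx : x ≠ 0) : ∃ c, c ≠ 0 ∧ IsStandard (rmul x c) := by
  by_cases h1 : x 1 = 0
  · have h0 : x 0 ≠ 0 := by
      intro h0
      exact hx (funext fun i => by fin_cases i <;> simp [h0, h1])
    refine ⟨(x 0)⁻¹, inv_ne_zero h0, Or.inr ?_⟩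
    ext1 k
    fin_cases k <;> simp [rmul, h0, h1]
  · exact ⟨(x 1)⁻¹, inv_ne_zero h1, Or.inl (by simp [rmul, h1])⟩

theorem IsStandard.eq_of_rmul {v w : Vec} (hv : IsStandard v) (hw : IsStandard w) {c : ℍ[ℝ]}
    (h : w = rmul v c) : w = v := by
  rcases hv with hv | rfl <;> rcases hw with hw | rfl
  · have := congrFun h 1
    simp only [rmul, hv, hw, one_mul] at this
    rw [h, ← this, rmul_one]
  · have h1 := congrFun h 1
    have h0 := congrFun h 0
    simp [rmul, hv] at h1 h0
    simp [← h1] at h0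
  · have := congrFun h 1
    simp [rmul, hw] at this
  · rfl

theorem IsAttracting.eq_of_isStandard {A : Sp11} {v w : Vec} (hv : IsAttracting A v)
    (hv' : IsStandard v) (hw : IsAttracting A w) (hw' : IsStandard w) : w = v := by
  obtain ⟨c, hc⟩ := hv.unique hw
  exact hv'.eq_of_rmul hw' hc

theorem IsLoxodromic.exists_isProjectivePoint {A : Sp11} (hA : IsLoxodromic A) :
    ∃ k, IsProjectivePoint A k := by
  obtain ⟨v, -, hv, -⟩ := hA.1.exists_attracting_repelling
  obtain ⟨c, hc, hst⟩ := exists_standard hv.1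
  have hv' := hv.rmul hc
  obtain ⟨h1, -, μ, -, e⟩ := id hv'
  obtain ⟨q, l, hl, eq⟩ := exists_mul_eq_mul_coe (hA.2 μ ⟨_, h1, e⟩)
  exact ⟨_, _, q, l, hv', hst, hl, rfl, by rw [act_rmul, e, rmul_rmul, rmul_rmul _ (q : ℍ[ℝ]), eq]⟩

theorem exists_eigen_of_commute {A K : Sp11} (hK : K * A = A * K) {v : Vec}
    (hv : IsAttracting A v) : ∃ ν, act K v = rmul v ν := by
  refine hv.unique ⟨act_ne_zero K hv.1, by rw [herm_act]; exact hv.2.1, ?_⟩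
  obtain ⟨-, -, μ, hμ, e⟩ := hv
  exact ⟨μ, hμ, by rw [← act_mul, ← hK, act_mul, e, act_rmul]⟩

theorem exists_eigen_of_commute_repelling {A K : Sp11} (hK : K * A = A * K) {v : Vec}
    (hv : IsRepelling A v) : ∃ ν, act K v = rmul v ν := by
  refine hv.unique ⟨act_ne_zero K hv.1, by rw [herm_act]; exact hv.2.1, ?_⟩
  obtain ⟨-, -, μ, hμ, e⟩ := hv
  exact ⟨μ, hμ, by rw [← act_mul, ← hK, act_mul, e, act_rmul]⟩

theorem IsLoxodromic.exists_isTwistBend {A K : Sp11} (hA : IsLoxodromic A) (hK : K * A = A * K) :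
    ∃ κ, IsTwistBend A K κ := by
  obtain ⟨k, v, q, μ, hv, hst, hμ, rfl, e⟩ := hA.exists_isProjectivePoint
  obtain ⟨ν, hν⟩ := exists_eigen_of_commute hK hv
  -- A nonreal eigenvalue has a representative in the upper half plane and its own `q'`. For a real
  -- eigenvalue any `q'` works, and the convention requires the one from the projective point of
  -- `A`.
  have key : ∃ (q' : ℍ[ℝ]ˣ) (l : ℂ), 0 ≤ l.im ∧ l ≠ 0 ∧ ν * q' = q' * (l : ℍ[ℝ]) ∧
      (l.im = 0 → q' = q) := by
    have hν0 : ν ≠ 0 := by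
      rintro rfl
      rw [rmul_zero] at hν
      exact act_ne_zero K hv.1 hν
    by_cases hr : ∃ r : ℝ, ν = (r : ℍ[ℝ])
    · obtain ⟨r, rfl⟩ := hr
      have hr0 : r ≠ 0 := by
        rintro rfl
        simp at hν0
      refine ⟨q, (r : ℂ), by simp, by exact_mod_cast hr0, ?_, fun _ => rfl⟩
      rw [Quaternion.coe_commutes]
      congr 1
    · push Not at hr
      obtain ⟨q', l, hl, e'⟩ := exists_mul_eq_mul_coe hr
      refine ⟨q', l, hl.le, ?_, e', fun h => absurd h hl.ne'⟩
      rintro rfl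
      simp at hl
  obtain ⟨q', l, hl, hl0, e', hq⟩ := key
  have hexp : ((‖l‖ : ℝ) : ℂ) * Complex.exp ((l.arg : ℂ) * Complex.I) = l :=
    Complex.norm_mul_exp_arg_mul_I l
  refine ⟨⟨‖l‖, l.arg, (q' : CP1)⟩, hK, norm_pos_iff.2 hl0, Complex.arg_nonneg_iff.2 hl,
    Complex.arg_le_pi l, ⟨v, q', hv, hst, rfl, ?_⟩, ?_⟩
  · rw [hexp, act_rmul, hν, rmul_rmul, rmul_rmul, e']
  · intro hsin
    have him : l.im = 0 := by
      rw [← Complex.norm_mul_sin_arg l]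
      change Real.sin l.arg = 0 at hsin
      rw [hsin, mul_zero]
    exact ⟨v, q, μ, hv, hst, hμ, by rw [hq him], e⟩

/-! ### The real trace -/

theorem cpart_add (p q : ℍ[ℝ]) : cpart (p + q) = cpart p + cpart q := by
  apply Complex.ext <;> simp [cpart]

theorem jpart_add (p q : ℍ[ℝ]) : jpart (p + q) = jpart p + jpart q := by
  apply Complex.ext <;> simp [jpart]
  ring

theorem cpart_mul (p q : ℍ[ℝ]) :
    cpart (p * q) = cpart p * cpart q - star (jpart p) * jpart q := by
  apply Complex.ext <;> simp [cpart, jpart] <;> ring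

theorem jpart_mul (p q : ℍ[ℝ]) :
    jpart (p * q) = jpart p * cpart q + star (cpart p) * jpart q := by
  apply Complex.ext <;> simp [cpart, jpart] <;> ring

theorem complexify_mul (M N : Matrix (Fin 2) (Fin 2) ℍ[ℝ]) :
    complexify (M * N) = complexify M * complexify N := by
  rw [complexify, complexify, complexify, Matrix.fromBlocks_multiply]
  congr 1 <;> refine Matrix.ext fun i j => ?_ <;>
    simp only [Matrix.map_apply, Matrix.neg_apply, Matrix.add_apply, Matrix.mul_apply,
      Fin.sum_univ_two, cpart_add, jpart_add, cpart_mul, jpart_mul, star_add, star_sub, star_mul',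
      star_star] <;> ring

theorem charpoly_complexify_conj (A F : Sp11) :
    (complexify (F⁻¹ * A * F).val.val).charpoly = (complexify A.val.val).charpoly := by
  have e1 : (F⁻¹ * A * F).val.val = (F⁻¹).val.val * (A * F).val.val := by
    rw [mul_assoc]
    rfl
  have e2 : (A * F).val.val * (F⁻¹).val.val = A.val.val := by
    change (A * F * F⁻¹).val.val = _
    rw [mul_inv_cancel_right]
  rw [e1, complexify_mul, Matrix.charpoly_mul_comm, ← complexify_mul, e2]

theorem complexify_diag (a b : ℂ) : complexify !![(a : ℍ[ℝ]), 0; 0, (b : ℍ[ℝ])] =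
    Matrix.diagonal (Sum.elim ![a, b] ![star a, star b]) := by
  refine Matrix.ext fun i j => ?_
  rcases i with i | i <;> rcases j with j | j <;> fin_cases i <;> fin_cases j <;>
    apply Complex.ext <;> simp [complexify, cpart, jpart, Matrix.diagonal]

open Polynomial in
theorem coeff_prod_linear (a b c d : ℂ) :
    ((X - C a) * (X - C b) * ((X - C c) * (X - C d))).coeff 3 = -(a + b + c + d) ∧
    ((X - C a) * (X - C b) * ((X - C c) * (X - C d))).coeff 2 =
      a * b + c * d + (a + b) * (c + d) := by
  have e : (X - C a) * (X - C b) * ((X - C c) * (X - C d)) = X ^ 4 + C (-(a + b + c + d)) * X ^ 3 +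
      C (a * b + c * d + (a + b) * (c + d)) * X ^ 2 +
      C (-(a * b * (c + d) + c * d * (a + b))) * X + C (a * b * (c * d)) := by
    simp only [C_add, C_mul, C_neg]
    ring
  rw [e]
  constructor <;>
  · simp only [coeff_add, coeff_C_mul, coeff_X_pow, coeff_X, coeff_C]
    norm_num

/-- In a diagonalizing frame the complexified matrix has the eigenvalues `l`, its conjugate, and
their inverses, so both coefficients are functions of `Re l` and `|l|²` only. -/
theorem realTrace_eq {A : Sp11} {v w : Vec} {l : ℂ} (hv : IsAttracting A v) (hw : IsRepelling A w)
    (hl : act A v = rmul v (l : ℍ[ℝ])) :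
    realTrace A = (2 * l.re + 2 * (l.re / Complex.normSq l),
      Complex.normSq l + 1 / Complex.normSq l + 4 * (l.re ^ 2 / Complex.normSq l)) ∧
    0 < Complex.normSq l ∧ Complex.normSq l < 1 := by
  obtain ⟨F, μ, ν, hF1, -, hd, hμ, -, hμν, e⟩ := exists_diag hv hw
  obtain rfl : μ = (l : ℍ[ℝ]) := rmul_right_cancel hv.1 (e.symm.trans hl)
  have hl0 : l ≠ 0 := by
    rintro rfl
    simp at hμν
  have hpos : 0 < Complex.normSq l := Complex.normSq_pos.2 hl0
  have hν : ν = (((star l)⁻¹ : ℂ) : ℍ[ℝ]) := by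
    have hs : star (l : ℍ[ℝ]) = ((star l : ℂ) : ℍ[ℝ]) := by ext <;> simp
    have hs0 : star (l : ℍ[ℝ]) ≠ 0 := by
      intro h
      rw [h, zero_mul] at hμν
      exact zero_ne_one hμν
    apply mul_left_cancel₀ hs0
    have : star l ≠ 0 := by simpa using hl0
    rw [hμν, hs, ← Quaternion.coeComplex_mul, mul_inv_cancel₀ this, Quaternion.coeComplex_one]
  refine ⟨?_, hpos, ?_⟩
  · have hc : (complexify A.val.val).charpoly =
        (Polynomial.X - Polynomial.C ((star l)⁻¹)) * (Polynomial.X - Polynomial.C l) *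
        ((Polynomial.X - Polynomial.C (star (star l)⁻¹)) *
          (Polynomial.X - Polynomial.C (star l))) := by
      rw [← charpoly_complexify_conj A F, hd, hν, complexify_diag, Matrix.charpoly_diagonal,
        Fintype.prod_sum_type, Fin.prod_univ_two, Fin.prod_univ_two]
      rfl
    obtain ⟨h3, h2⟩ := coeff_prod_linear (star l)⁻¹ l (star (star l)⁻¹) (star l)
    rw [realTrace, hc, h3, h2]
    have hn := Complex.normSq_apply l
    refine Prod.ext ?_ ?_
    · simp [Complex.inv_re, Complex.normSq_conj]
      ring
    · simp [Complex.inv_re, Complex.inv_im, Complex.normSq_conj]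
      field_simp
      rw [hn]
      ring
  · have h1 : ‖(l : ℍ[ℝ])‖ * ‖(l : ℍ[ℝ])‖ = Complex.normSq l := by
      rw [← Quaternion.normSq_eq_norm_mul_self, Quaternion.normSq_def', Complex.normSq_apply]
      simp
      ring
    rw [← h1]
    nlinarith [norm_nonneg (l : ℍ[ℝ])]

/-- Put `T = n + 2 + 1/n` and `U = 4x²/n`. The two traces determine `T + U` and `TU`, hence the
unordered pair. As `T > 4` and `U' < 4`, the latter because the eigenvalue is nonreal, the larger
root is `T = T'`. Then `n n' = 1` is excluded by `n, n' < 1`. -/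
theorem eq_of_trace_eq {x n x' n' : ℝ} (hn : 0 < n) (hn1 : n < 1) (hn' : 0 < n')
    (hn1' : n' < 1) (hx' : x' ^ 2 < n')
    (ha : 2 * x + 2 * (x / n) = 2 * x' + 2 * (x' / n'))
    (hb : n + 1 / n + 4 * (x ^ 2 / n) = n' + 1 / n' + 4 * (x' ^ 2 / n')) : x = x' ∧ n = n' := by
  have hT : ∀ {m : ℝ}, 0 < m → m < 1 → 4 < m + 2 + 1 / m := by
    intro m h0 h1
    have : m + 2 + 1 / m - 4 = (m - 1) ^ 2 / m := by
      field_simp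
      ring
    have h2 : 0 < (m - 1) ^ 2 / m := div_pos (by nlinarith) h0
    linarith
  have hU : 4 * (x' ^ 2 / n') < 4 := by
    have : x' ^ 2 / n' < 1 := (div_lt_one hn').2 hx'
    linarith
  have hp : (n + 2 + 1 / n) * (4 * (x ^ 2 / n)) = (n' + 2 + 1 / n') * (4 * (x' ^ 2 / n')) := by
    have e : ∀ {m y : ℝ}, 0 < m →
        (m + 2 + 1 / m) * (4 * (y ^ 2 / m)) = (2 * y + 2 * (y / m)) ^ 2 := by
      intro m y hm
      field_simp
      ring
    rw [e hn, e hn', ha]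
  have hprod : ((n + 2 + 1 / n) - (n' + 2 + 1 / n')) *
      ((n + 2 + 1 / n) - 4 * (x' ^ 2 / n')) = 0 := by
    linear_combination (n + 2 + 1 / n) * hb - hp
  have h1 : (n + 2 + 1 / n) - (n' + 2 + 1 / n') = 0 :=
    (mul_eq_zero.1 hprod).resolve_right (by have := hT hn hn1; intro h; linarith)
  have hnn : n = n' := by
    have h2 : (n - n') * (n * n' - 1) = 0 := by
      field_simp at h1
      linear_combination h1
    rcases mul_eq_zero.1 h2 with h | h
    · linarith
    · nlinarith
  subst hnn
  refine ⟨?_, rfl⟩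
  field_simp at ha
  exact ha

/-! ### Elements are determined by their parameters -/

/-- Invariance of `⟨w, v⟩ ≠ 0` expresses the eigenvalue at `w` through that at `v`, and the two
lines span. -/
theorem eq_of_eigen_eq {A A' : Sp11} {v w : Vec} {μ ν ν' : ℍ[ℝ]} (hv : herm v v = 0)
    (hw : herm w w = 0) (hwv : herm w v ≠ 0) (h : act A v = rmul v μ) (h' : act A' v = rmul v μ)
    (hν : act A w = rmul w ν) (hν' : act A' w = rmul w ν') : A = A' := by
  have e := star_mul_mul_of_eigen hν h
  have e' := star_mul_mul_of_eigen hν' h'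
  have hne : star μ * herm w v ≠ 0 := by
    intro h0
    rw [h0, zero_mul] at e
    exact hwv e.symm
  obtain rfl : ν = ν' := mul_left_cancel₀ hne (e.trans e'.symm)
  obtain ⟨F, h1, c, -, h0⟩ := exists_frame hv hw hwv
  have : A * F = A' * F := by
    refine sp_ext ?_ ?_
    · rw [act_mul, act_mul, h0, act_rmul, act_rmul, hν, hν']
    · rw [act_mul, act_mul, h1, h, h']
  exact mul_right_cancel this

/-- Two representatives of a point of `CP1` differ by a complex factor on the right, which commutes
with `l`; so `q l q⁻¹` depends only on the point. -/
theorem eq_of_mk_eq {μ μ' : ℍ[ℝ]} {q q' : ℍ[ℝ]ˣ} {l : ℂ} (hq : (q : CP1) = (q' : CP1))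
    (h : μ * q = q * (l : ℍ[ℝ])) (h' : μ' * q' = q' * (l : ℍ[ℝ])) : μ = μ' := by
  obtain ⟨c, hc⟩ := QuotientGroup.eq.1 hq
  have hc' : (q' : ℍ[ℝ]) = q * ((c : ℂ) : ℍ[ℝ]) := by
    have : q' = q * Units.map (Quaternion.ofComplex : ℂ →ₐ[ℝ] ℍ[ℝ]).toMonoidHom c := by
      rw [hc, mul_inv_cancel_left]
    rw [this]
    rfl
  have e : μ * q' = q' * (l : ℍ[ℝ]) := by
    rw [hc', ← mul_assoc, h, mul_assoc, mul_assoc, ← Quaternion.coeComplex_mul,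
      ← Quaternion.coeComplex_mul, mul_comm]
  exact mul_right_cancel₀ q'.ne_zero (e.trans h'.symm)

theorem eq_of_realTrace_eq {A A' : Sp11} {v w : Vec} (hv : IsAttracting A v)
    (hv' : IsAttracting A' v) (hw : IsRepelling A w) (hw' : IsRepelling A' w) (hst : IsStandard v)
    (htr : realTrace A = realTrace A') {k : CP1} (hk : IsProjectivePoint A k)
    (hk' : IsProjectivePoint A' k) : A = A' := by
  obtain ⟨u, q, l, hu, hust, hl, rfl, e⟩ := hk
  obtain ⟨u', q', l', hu', hust', hl', hqq, e'⟩ := hk'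
  obtain rfl := hv.eq_of_isStandard hst hu hust
  obtain rfl := hv'.eq_of_isStandard hst hu' hust'
  obtain ⟨t, t0, t1⟩ := realTrace_eq (hv.rmul q.ne_zero) hw e
  obtain ⟨t', t0', t1'⟩ := realTrace_eq (hv'.rmul q'.ne_zero) hw' e'
  rw [t, t', Prod.mk.injEq] at htr
  have hlt : l'.re ^ 2 < Complex.normSq l' := by
    rw [Complex.normSq_apply]
    nlinarith
  obtain ⟨hre, hn⟩ := eq_of_trace_eq t0 t1 t0' t1' hlt htr.1 htr.2
  have hll : l = l' := by
    refine Complex.ext hre ?_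
    rw [Complex.normSq_apply, Complex.normSq_apply, hre] at hn
    nlinarith
  subst hll
  obtain ⟨-, -, μ, -, hμ⟩ := id hv
  obtain ⟨-, -, μ', -, hμ'⟩ := id hv'
  obtain rfl : μ = μ' := eq_of_mk_eq hqq (eq_conj_of_eigen hv.1 hμ e) (eq_conj_of_eigen hv.1 hμ' e')
  obtain ⟨-, -, ν, -, hν⟩ := id hw
  obtain ⟨-, -, ν', -, hν'⟩ := id hw'
  exact eq_of_eigen_eq hv.2.1 hw.2.1 (herm_ne_zero_of_attracting_repelling hv hw) hμ hμ' hν hν'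

theorem IsTwistBend.unique {A K K' : Sp11} (hA : IsHyperbolic A) {κ : TwistBend}
    (h : IsTwistBend A K κ) (h' : IsTwistBend A K' κ) : K = K' := by
  obtain ⟨-, w, -, hw⟩ := hA.exists_attracting_repelling
  obtain ⟨hc, -, -, -, ⟨v, q, hv, hst, hk, e⟩, -⟩ := h
  obtain ⟨hc', -, -, -, ⟨v', q', hv', hst', hk', e'⟩, -⟩ := h'
  obtain rfl := hv.eq_of_isStandard hst hv' hst'
  obtain ⟨μ, hμ⟩ := exists_eigen_of_commute hc hv
  obtain ⟨μ', hμ'⟩ := exists_eigen_of_commute hc' hv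
  obtain rfl : μ = μ' := eq_of_mk_eq (hk.symm.trans hk') (eq_conj_of_eigen hv.1 hμ e)
    (eq_conj_of_eigen hv.1 hμ' e')
  obtain ⟨ν, hν⟩ := exists_eigen_of_commute_repelling hc hw
  obtain ⟨ν', hν'⟩ := exists_eigen_of_commute_repelling hc' hw
  exact eq_of_eigen_eq hv.2.1 hw.2.1 (herm_ne_zero_of_attracting_repelling hv hw) hμ hμ' hν hν'

theorem crossRatio_eq {A B : Sp11} {y X : ℍ[ℝ]} (h1 : IsAttracting A ![0, 1])
    (h2 : IsRepelling A ![1, 0]) (h3 : IsAttracting B ![((Complex.I : ℂ) : ℍ[ℝ]), 1])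
    (h4 : IsRepelling B ![y, 1]) (hX : IsCrossRatio A B X) :
    ∃ c, c ≠ 0 ∧ X = c * (((Complex.I : ℂ) : ℍ[ℝ]) * y⁻¹) * c⁻¹ := by
  obtain ⟨z₁, z₂, z₃, z₄, k1, k2, k3, k4, rfl⟩ := hX
  obtain ⟨c₁, rfl⟩ := h1.unique k1
  obtain ⟨c₂, rfl⟩ := h2.unique k2
  obtain ⟨c₃, rfl⟩ := h3.unique k3
  obtain ⟨c₄, rfl⟩ := h4.unique k4
  have ne : ∀ {v : Vec} {c : ℍ[ℝ]}, rmul v c ≠ 0 → c ≠ 0 := by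
    rintro v c h rfl
    exact h (rmul_zero v)
  have n1 : star c₁ ≠ 0 := by simpa using ne k1.1
  have n2 : star c₂ ≠ 0 := by simpa using ne k2.1
  have n3 := ne k3.1
  have n4 := ne k4.1
  refine ⟨star c₁, n1, ?_⟩
  have e31 : herm ![((Complex.I : ℂ) : ℍ[ℝ]), 1] ![0, 1] = ((Complex.I : ℂ) : ℍ[ℝ]) := by
    simp [herm]
  have e32 : herm ![((Complex.I : ℂ) : ℍ[ℝ]), 1] ![1, 0] = 1 := by
    simp [herm]
  have e42 : herm ![y, 1] ![1, 0] = 1 := by simp [herm]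
  have e41 : herm ![y, 1] ![0, 1] = y := by simp [herm]
  rw [crossRatio]
  simp only [herm_rmul_left, herm_rmul_right, e31, e32, e41, e42, mul_inv_rev, mul_assoc]
  rw [mul_inv_cancel_left₀ n3, inv_mul_cancel_left₀ n2, mul_inv_cancel_left₀ n4, inv_one,
    one_mul, one_mul]

theorem re_conj {c x : ℍ[ℝ]} (hc : c ≠ 0) : (c * x * c⁻¹).re = x.re := by
  have h : ∀ p q : ℍ[ℝ], (p * q).re = (q * p).re := by
    intro p q
    simp
    ring
  rw [h, ← mul_assoc, inv_mul_cancel₀ hc, one_mul]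

theorem norm_conj {c x : ℍ[ℝ]} (hc : c ≠ 0) : ‖c * x * c⁻¹‖ = ‖x‖ := by
  rw [norm_mul, norm_mul, norm_inv]
  have := norm_pos_iff.2 hc
  field_simp

/-- The modulus yields `|y|`, the real part then yields the `i` component, and the sign condition
fixes the `j` component. -/
theorem eq_of_crossRatio_eq {y y' : ℍ[ℝ]} (hy : y.re = 0) (hyK : y.imK = 0) (hyJ : 0 ≤ y.imJ)
    (hy' : y'.re = 0) (hyK' : y'.imK = 0) (hyJ' : 0 ≤ y'.imJ)
    (hre : (((Complex.I : ℂ) : ℍ[ℝ]) * y⁻¹).re = (((Complex.I : ℂ) : ℍ[ℝ]) * y'⁻¹).re)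
    (hn : ‖((Complex.I : ℂ) : ℍ[ℝ]) * y⁻¹‖ = ‖((Complex.I : ℂ) : ℍ[ℝ]) * y'⁻¹‖) : y = y' := by
  have hI : ‖((Complex.I : ℂ) : ℍ[ℝ])‖ ≠ 0 := by
    rw [norm_ne_zero_iff]
    intro h
    have := congrArg (fun q : ℍ[ℝ] => q.imI) h
    simp at this
  rw [norm_mul, norm_mul, norm_inv, norm_inv] at hn
  have hn' : ‖y‖ = ‖y'‖ := inv_injective (mul_left_cancel₀ hI hn)
  have hsq : Quaternion.normSq y = Quaternion.normSq y' := by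
    rw [Quaternion.normSq_eq_norm_mul_self, Quaternion.normSq_eq_norm_mul_self, hn']
  -- With the convention `0⁻¹ = 0` the modulus alone settles the case `y = 0`.
  by_cases h0 : y = 0
  · subst h0
    rw [norm_zero] at hn'
    exact (norm_eq_zero.1 hn'.symm).symm
  · have hp : Quaternion.normSq y ≠ 0 := Quaternion.normSq_ne_zero.2 h0
    rw [Quaternion.inv_def, Quaternion.inv_def, ← hsq, mul_smul_comm, mul_smul_comm] at hre
    simp at hre
    have hI : y.imI = y'.imI := by
      rcases hre with h | h
      · exact h
      · exact absurd h h0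
    rw [Quaternion.normSq_def', Quaternion.normSq_def', hy, hy', hyK, hyK', hI] at hsq
    have hJ : y.imJ = y'.imJ := by nlinarith
    exact Quaternion.ext _ _ (hy.trans hy'.symm) hI hJ (hyK.trans hyK'.symm)

theorem IsPairCoord.unique {A B A' B' : Sp11} {c : PairCoord} (h : IsPairCoord A B c)
    (h' : IsPairCoord A' B' c) : A = A' ∧ B = B' := by
  obtain ⟨⟨y, hy, hyK, hyJ, a1, a2, a3, a4⟩, tA, tB, ⟨X, hX, hre, hab⟩, pA, pB⟩ := h
  obtain ⟨⟨y', hy', hyK', hyJ', b1, b2, b3, b4⟩, tA', tB', ⟨X', hX', hre', hab'⟩, pA', pB'⟩ := h'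
  obtain ⟨d, hd, e⟩ := crossRatio_eq a1 a2 a3 a4 hX
  obtain ⟨d', hd', e'⟩ := crossRatio_eq b1 b2 b3 b4 hX'
  rw [e, re_conj hd] at hre
  rw [e', re_conj hd'] at hre'
  rw [e, norm_conj hd] at hab
  rw [e', norm_conj hd'] at hab'
  obtain rfl := eq_of_crossRatio_eq hy hyK hyJ hy' hyK' hyJ' (hre.symm.trans hre')
    (hab.symm.trans hab')
  exact ⟨eq_of_realTrace_eq a1 b1 a2 b2 (Or.inl (by simp)) (tA.symm.trans tA') pA pA',
    eq_of_realTrace_eq a3 b3 a4 b4 (Or.inl (by simp)) (tB.symm.trans tB') pB pB'⟩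

/-! ### Fenchel–Nielsen coordinates -/

section FenchelNielsen

variable {g : ℕ} {P : CurveSystem g} {φ : P.Grp ≃* SurfaceGroup g} {ref : Sp11 → Sp11 → Sp11}
  {ρ ρ' : SurfaceGroup g →* Sp11}

theorem IsLoxodromic.conj' {A : Sp11} (h : IsLoxodromic A) (k : Sp11) :
    IsLoxodromic (k⁻¹ * A * k) := by
  simpa using h.conj k⁻¹

theorem exists_isPairCoord {A B : Sp11} (hA : IsLoxodromic A) (hB : IsLoxodromic B)
    (h : IsNormalized A B) : ∃ c, IsPairCoord A B c := by
  obtain ⟨k, hk⟩ := hA.exists_isProjectivePoint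
  obtain ⟨k', hk'⟩ := hB.exists_isProjectivePoint
  obtain ⟨y, -, -, -, h1, h2, h3, h4⟩ := id h
  exact ⟨⟨realTrace A, realTrace B, _, _, k, k'⟩, h, rfl, rfl,
    ⟨_, ⟨_, _, _, _, h1, h2, h3, h4, rfl⟩, rfl, rfl⟩, hk, hk'⟩

theorem IsReference.commute (href : IsReference ref) {S X Y : Sp11} (h : S * Y * S⁻¹ = X⁻¹) :
    S * (ref X Y)⁻¹ * X = X * (S * (ref X Y)⁻¹) := by
  have hr := href X Y (isConj_iff.2 ⟨S, h⟩)
  have e : S * (ref X Y)⁻¹ * X⁻¹ = X⁻¹ * (S * (ref X Y)⁻¹) := by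
    calc S * (ref X Y)⁻¹ * X⁻¹ = S * Y * (ref X Y)⁻¹ := by
          rw [← hr]
          group
      _ = X⁻¹ * (S * (ref X Y)⁻¹) := by
          rw [← h]
          group
  exact (Commute.inv_right_iff (a := S * (ref X Y)⁻¹) (b := X)).1 e

theorem IsGeometric.exists_isFNCoord (href : IsReference ref) (hρ : IsGeometric P φ ρ) :
    ∃ c, IsFNCoord ref P φ ρ c := by
  have hlox := hρ.isLoxodromic
  choose F hF using fun v =>
    (hρ.2.2.2 v).exists_isNormalized (hlox (v, 0)) (hlox (v, 1))
  choose a ha using fun v =>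
    exists_isPairCoord ((hlox (v, 0)).conj' (F v)) ((hlox (v, 1)).conj' (F v)) (hF v)
  have htw : ∀ j, ∃ κ, IsTwistBend
      ((F (P.sides (j, false)).1)⁻¹ * ρ (φ (P.bdryLoop (P.sides (j, false)))) *
        F (P.sides (j, false)).1)
      ((F (P.sides (j, false)).1)⁻¹ * ρ (φ (P.crossing j)) * F (P.sides (j, true)).1 *
        (ref ((F (P.sides (j, false)).1)⁻¹ * ρ (φ (P.bdryLoop (P.sides (j, false)))) *
          F (P.sides (j, false)).1)
          ((F (P.sides (j, true)).1)⁻¹ * ρ (φ (P.bdryLoop (P.sides (j, true)))) *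
          F (P.sides (j, true)).1))⁻¹) κ := by
    intro j
    refine ((hlox _).conj' _).exists_isTwistBend (href.commute ?_)
    rw [mul_inv_rev, mul_inv_rev, mul_inv_rev, mul_inv_rev, ← map_crossing_conj φ ρ j]
    group
  choose κ hκ using htw
  exact ⟨⟨a, κ⟩, F, ha, hκ⟩

theorem IsFNCoord.conj {c : FNCoord g} (h : IsFNCoord ref P φ ρ c) {k : Sp11}
    (hk : ∀ x, ρ' x = k * ρ x * k⁻¹) : IsFNCoord ref P φ ρ' c := by
  obtain ⟨F, h1, h2⟩ := h
  have e : ∀ v w x, (k * F v)⁻¹ * ρ' x * (k * F w) = (F v)⁻¹ * ρ x * F w := by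
    intro v w x
    rw [hk]
    group
  refine ⟨fun v => k * F v, fun v => ?_, fun j => ?_⟩
  · simp only [e]
    exact h1 v
  · simp only [e]
    exact h2 j

/-- Representations with the same Fenchel–Nielsen coordinates are conjugate. -/
theorem IsFNCoord.exists_conj {c : FNCoord g} (hρ : IsGeometric P φ ρ)
    (h : IsFNCoord ref P φ ρ c) (h' : IsFNCoord ref P φ ρ' c) (v₀ : Fin (2 * g - 2)) :
    ∃ k : Sp11, ∀ x, ρ' x = k * ρ x * k⁻¹ := by
  obtain ⟨F, h1, h2⟩ := h
  obtain ⟨F', h1', h2'⟩ := h'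
  have hper : ∀ x, (F x.1)⁻¹ * ρ (φ (P.bdryLoop x)) * F x.1 =
      (F' x.1)⁻¹ * ρ' (φ (P.bdryLoop x)) * F' x.1 := by
    rintro ⟨v, i⟩
    obtain ⟨e0, e1⟩ := (h1 v).unique (h1' v)
    have third : ∀ (σ : SurfaceGroup g →* Sp11) (E : Sp11), E⁻¹ * σ (φ (P.bdryLoop (v, 2))) * E =
        ((E⁻¹ * σ (φ (P.bdryLoop (v, 0))) * E) * (E⁻¹ * σ (φ (P.bdryLoop (v, 1))) * E))⁻¹ := by
      intro σ E
      have e : P.bdryLoop (v, 2) = (P.bdryLoop (v, 0) * P.bdryLoop (v, 1))⁻¹ :=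
        eq_inv_of_mul_eq_one_right (P.bdryLoop_mul v)
      rw [e]
      simp only [map_mul, map_inv]
      group
    fin_cases i
    · exact e0
    · exact e1
    · exact (third ρ (F v)).trans ((congrArg₂ (fun a b : Sp11 => (a * b)⁻¹) e0 e1).trans
        (third ρ' (F' v)).symm)
  -- The normalized peripheral elements agree by `hper`, so both twist-bends refer to the same `X`
  -- and the same reference gluing, and uniqueness of the twist-bend applies.
  have hcross : ∀ j, (F (P.sides (j, false)).1)⁻¹ * ρ (φ (P.crossing j)) * F (P.sides (j, true)).1 =
      (F' (P.sides (j, false)).1)⁻¹ * ρ' (φ (P.crossing j)) * F' (P.sides (j, true)).1 := by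
    intro j
    have t := h2 j
    have t' := h2' j
    simp only [← hper] at t'
    exact mul_right_cancel (t.unique ((hρ.isLoxodromic _).conj' _).1 t')
  -- On a tree edge the crossing is `1`, so `hcross` compares the frames at its two ends directly;
  -- the relation spreads over the connected tree.
  have hconst : ∀ v w, F' v * (F v)⁻¹ = F' w * (F w)⁻¹ := by
    intro v w
    induction P.connected v w with
    | rel v w hvw =>
      obtain ⟨j, hj, rfl, rfl⟩ := hvw
      have := hcross j
      rw [P.crossing_of_mem hj, map_one, map_one, map_one, mul_one, mul_one] at this
      calc _ = F' (P.sides (j, false)).1 * ((F (P.sides (j, false)).1)⁻¹ *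
              F (P.sides (j, true)).1) * (F (P.sides (j, true)).1)⁻¹ := by group
        _ = _ := by
          rw [this]
          group
    | refl v => rfl
    | symm v w _ ih => exact ih.symm
    | trans u v w _ _ ih1 ih2 => exact ih1.trans ih2
  set k := F' v₀ * (F v₀)⁻¹ with hk
  have hF : ∀ v, F' v = k * F v := by
    intro v
    rw [hk, hconst v₀ v, inv_mul_cancel_right]
  refine ⟨k, ?_⟩
  have hhom : ρ'.comp φ.toMonoidHom = ((MulAut.conj k).toMonoidHom.comp ρ).comp φ.toMonoidHom := by
    refine PresentedGroup.ext ?_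
    rintro (x | j)
    · change ρ' (φ (P.bdryLoop x)) = k * ρ (φ (P.bdryLoop x)) * k⁻¹
      have e := hper x
      rw [hF] at e
      calc _ = k * F x.1 * ((k * F x.1)⁻¹ * ρ' (φ (P.bdryLoop x)) * (k * F x.1)) *
              (F x.1)⁻¹ * k⁻¹ := by
            group
        _ = _ := by
            rw [← e]
            group
    · change ρ' (φ (P.crossing j)) = k * ρ (φ (P.crossing j)) * k⁻¹
      have e := hcross j
      rw [hF, hF] at e
      calc _ = k * F (P.sides (j, false)).1 * ((k * F (P.sides (j, false)).1)⁻¹ *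
              ρ' (φ (P.crossing j)) * (k * F (P.sides (j, true)).1)) *
              (F (P.sides (j, true)).1)⁻¹ * k⁻¹ := by
            group
        _ = _ := by
            rw [← e]
            group
  intro x
  obtain ⟨y, rfl⟩ := φ.surjective x
  exact DFunLike.congr_fun hhom y

end FenchelNielsen

end SpOneOne

theorem mainTheorem10 (g : ℕ) (hg : 2 ≤ g) (P : CurveSystem g) (φ : P.Grp ≃* SurfaceGroup g)
    (ref : Sp11 → Sp11 → Sp11) (href : IsReference ref) :
    (∀ ρ : SurfaceGroup g →* Sp11, IsGeometric P φ ρ → ∃ c, IsFNCoord ref P φ ρ c) ∧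
    (∀ ρ ρ' : SurfaceGroup g →* Sp11, IsGeometric P φ ρ → IsGeometric P φ ρ' →
      ((∃ c, IsFNCoord ref P φ ρ c ∧ IsFNCoord ref P φ ρ' c) ↔ repClass ρ = repClass ρ') ∧
      (repClass ρ = repClass ρ' → ∀ c, IsFNCoord ref P φ ρ c ↔ IsFNCoord ref P φ ρ' c)) ∧
    (∀ ρ : SurfaceGroup g →* Sp11, IsGeometric P φ ρ →
      ∃ e : OpenPartialHomeomorph (DeformationSpace (SurfaceGroup g))
          (EuclideanSpace ℝ (Fin (20 * g - 20))),
        repClass ρ ∈ e.source) := by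
  refine ⟨fun ρ hρ => hρ.exists_isFNCoord href, fun ρ ρ' hρ hρ' => ?_,
    fun ρ hρ => hρ.exists_chart hg⟩
  have hconj : repClass ρ = repClass ρ' → ∀ c, IsFNCoord ref P φ ρ c ↔ IsFNCoord ref P φ ρ' c := by
    intro h c
    obtain ⟨k, hk⟩ := (repClass_eq_iff ρ ρ').1 h
    obtain ⟨k', hk'⟩ := (repClass_eq_iff ρ' ρ).1 h.symm
    exact ⟨fun hc => hc.conj hk, fun hc => hc.conj hk'⟩
  refine ⟨⟨?_, fun h => ?_⟩, hconj⟩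
  · rintro ⟨c, hc, hc'⟩
    exact (repClass_eq_iff ρ ρ').2 (hc.exists_conj hρ hc' ⟨0, by omega⟩)
  · obtain ⟨c, hc⟩ := hρ.exists_isFNCoord href
    exact ⟨c, hc, (hconj h c).1 hc⟩
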